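/- **Model.** Base stations (BSs) form a homogeneous Poisson point process $\Phi_B\subset\mathbb R^2$ of intensity $\lambda_B>0$; eavesdroppers form an independent homogeneous Poisson process $\Phi_E$ of intensity $\lambda_E>0$; the typical user is at the origin $o$. A link of length $r$ is LOS (type $L$) with probability $C\in[0,1]$ if $r\le D$ and with probability $0$ if $r>D$ ($D>0$); otherwise it is NLOS (type $N$). The path loss of a link $x\to y$ of type $j\in\{L,N\}$ is $L(x,y)=C_j\|x-y\|^{-\alpha_j}$ with $C_j,\alpha_j>0$. Its small-scale fading ($h_{xo}$ to the user, $g_{xz}$ to an eavesdropper $z$) is gamma distributed with shape $N_j\in\{1,2,\dots\}$ and scale $1$. The antenna gain towards an eavesdropper is $G_b(\theta)=M_s>0$ if $|\theta|\le\theta_b$ and $m_s>0$ otherwise, with $\theta$ uniform on $[-180^\circ,180^\circ]$ and $0\le\theta_b\le180^\circ$. The link types, fadings and angles of different links are independent. Assume $\alpha_N>2$ and $C_ND^{-\alpha_N}\le C_LD^{-\alpha_L}$ (the latter holds if $C_L>C_N$, $\alpha_L<\alpha_N$, $D\ge1$). The serving BS is $x^*=\arg\max_{x\in\Phi_B}L(x,o)$,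 and for colluding eavesdroppers $$I_E=\sum_{z\in\Phi_E}G_b(\theta)L(x^*,z)g_{x^*z},\qquad \tau_c=\Pr\Big(\frac{M_sL(x^*,o)h_{x^*o}}{I_E}\ge1\Big).$$ **Notation.** Let $\mu=(C_L/C_N)^{-1/\alpha_N}D^{\alpha_L/\alpha_N}$, $$A_N=\int_0^{\mu}\Big(e^{-\pi C\lambda_B(C_L/C_N)^{2/\alpha_L}x^{2\alpha_N/\alpha_L}}-e^{-\pi C\lambda_BD^2}\Big)2\pi(1-C)\lambda_Bx\,e^{-\pi(1-C)\lambda_Bx^2}dx+e^{-\pi C\lambda_BD^2},\qquad A_L=1-A_N$$ (the probabilities that the serving BS is NLOS, LOS), and let $f_{r_j}$ be the conditional densities of $\|x^*\|$ given the type $j$: $$f_{r_L}(r)=\frac{1}{A_L}e^{-(1-C)\lambda_B\pi(C_N/C_L)^{2/\alpha_N}r^{2\alpha_L/\alpha_N}}\,2\pi C\lambda_Br\,e^{-C\lambda_B\pi r^2}\,\mathbb I(0\le r\le D)$$ (with $f_{r_L}=0$ if $C=0$, when $A_L=0$), $$f_{r_N}(r)=\frac{2\pi\lambda_Bre^{-\pi\lambda_Br^2}}{A_N}\Big((1-C)e^{\pi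 C\lambda_B(r^2-D^2)}\mathbb I(r\le D)+\mathbb I(r\ge D)\Big)+\frac{2\pi(1-C)\lambda_Bre^{-(1-C)\lambda_B\pi r^2}}{A_N}\Big(e^{-C\lambda_B\pi(C_L/C_N)^{2/\alpha_L}r^{2\alpha_N/\alpha_L}}-e^{-C\lambda_B\pi D^2}\Big)\mathbb I(r\le\mu).$$ Let $q_L=C$, $q_N=1-C$, $\Pr(M_s)=\theta_b/180$, $\Pr(m_s)=(180-\theta_b)/180$, $k_{j,V}=D^{\alpha_j}/(VC_j)$, and $\mathcal L_{I_E}(s)=e^{\Xi(s)}$ with $$\Xi(s)=-2\pi\lambda_Es\Big[\sum_{j\in\{L,N\}}q_j\sum_{V\in\{M_s,m_s\}}\Pr(V)\frac{(VC_j)^{2/\alpha_j}}{\alpha_j}\sum_{m=0}^{N_j-1}\frac{k_{j,V}^{m+2/\alpha_j}}{(m+\frac2{\alpha_j})(s+k_{j,V})^{m+1}}\,{}_2F_1\Big(1,m+1;m+\tfrac2{\alpha_j}+1;\tfrac{k_{j,V}}{k_{j,V}+s}\Big)$$ $$+\sum_{V\in\{M_s,m_s\}}\Pr(V)\frac{(VC_N)^{2/\alpha_N}}{\alpha_N}\sum_{m=0}^{N_N-1}\frac{k_{N,V}^{m+2/\alpha_N}}{(1-\frac2{\alpha_N})(s+k_{N,V})^{m+1}}\,{}_2F_1\Big(1,m+1;2-\tfrac2{\alpha_N};\tfrac{s}{s+k_{N,V}}\Big)\Big].$$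 **Theorem.** $I_E<\infty$ almost surely, and $\mathcal L_{I_E}(s)=\mathbb E(e^{-sI_E})$ for all $s>0$. With $a_j=(N_j!)^{-1/N_j}$, all the integrals below converge absolutely, and $$\tau_c\le\sum_{j\in\{L,N\}}A_j\sum_{n=1}^{N_j}\binom{N_j}{n}(-1)^{n+1}\int_0^\infty f_{r_j}(r)\,\mathcal L_{I_E}\Big(\frac{a_jnr^{\alpha_j}}{M_sC_j}\Big)dr .$$ The same upper bound also holds (in a weaker form) with the weights $A_j$ omitted: $$\tau_c\le\sum_{j\in\{L,N\}}\sum_{n=1}^{N_j}\binom{N_j}{n}(-1)^{n+1}\int_0^\infty f_{r_j}(r)\,\mathcal L_{I_E}\Big(\frac{a_jnr^{\alpha_j}}{M_sC_j}\Big)dr .$$ -/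

import Mathlib

open MeasureTheory ProbabilityTheory
open scoped ENNReal NNReal

noncomputable section

namespace MmWave

/-- The Euclidean plane. -/
abbrev Plane : Type := EuclideanSpace ℝ (Fin 2)

/-- Line-of-sight and non-line-of-sight links. -/
inductive LinkType : Type
  | los
  | nlos
  deriving DecidableEq

instance : Fintype LinkType := ⟨{.los, .nlos}, fun x => by cases x <;> simp⟩

/-- The two lobes (main, side) of the sectored antenna pattern. -/
inductive Lobe : Type
  | main
  | side
  deriving DecidableEq

instance : Fintype Lobe := ⟨{.main, .side}, fun x => by cases x <;> simp⟩

open LinkType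

/-- The parameters of the network. -/
structure Params where
  /-- intensity of the base stations -/
  lamB : ℝ
  /-- intensity of the eavesdroppers -/
  lamE : ℝ
  /-- main-lobe gain `M_s` -/
  Ms : ℝ
  /-- side-lobe gain `m_s` -/
  ms : ℝ
  /-- beam width of the main lobe, in degrees -/
  thetaB : ℝ
  /-- probability that a link of length at most `D` is LOS -/
  C : ℝ
  /-- radius of the LOS ball -/
  D : ℝ
  /-- path-loss intercepts `C_L`, `C_N` -/
  K : LinkType → ℝ
  /-- path-loss exponents `α_L`, `α_N` -/
  α : LinkType → ℝ
  /-- Nakagami parameters `N_L`, `N_N` -/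
  N : LinkType → ℕ
  lamB_pos : 0 < lamB
  lamE_pos : 0 < lamE
  Ms_pos : 0 < Ms
  ms_pos : 0 < ms
  thetaB_nonneg : 0 ≤ thetaB
  thetaB_le : thetaB ≤ 180
  C_nonneg : 0 ≤ C
  C_le_one : C ≤ 1
  D_pos : 0 < D
  K_pos : ∀ j, 0 < K j
  α_pos : ∀ j, 0 < α j
  /-- the total power received from the far (NLOS) field is finite -/
  two_lt_α_nlos : 2 < α nlos
  N_pos : ∀ j, 0 < N j
  /-- at the boundary of the LOS ball, an NLOS link is not better than an LOS link; this follows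
  from `C_N < C_L`, `α_L < α_N` and `1 ≤ D` -/
  nlos_le_los : K nlos * D ^ (-α nlos) ≤ K los * D ^ (-α los)

namespace Params

variable (p : Params)

/-- The probability `q_L(r)` that a link of length `r` is LOS. -/
def qLOS (r : ℝ) : ℝ := if r ≤ p.D then p.C else 0

/-- The probability that a link of length at most `D` is of type `j`: `q_L = C`, `q_N = 1 - C`. -/
def q : LinkType → ℝ
  | los => p.C
  | nlos => 1 - p.C

/-- The antenna gain `G_b(θ)`, the angle being in degrees. -/
def gain (θ : ℝ) : ℝ := if |θ| ≤ p.thetaB then p.Ms else p.ms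

/-- The value of the gain in each lobe. -/
def lobeGain : Lobe → ℝ
  | .main => p.Ms
  | .side => p.ms

/-- The probability of each lobe. -/
def lobeProb : Lobe → ℝ
  | .main => p.thetaB / 180
  | .side => (180 - p.thetaB) / 180

/-- Path loss `C_j d^{-α_j}` of a link of type `j` and length `d`. -/
def pathLoss (j : LinkType) (d : ℝ) : ℝ := p.K j * d ^ (-p.α j)

/-- The probability `A_N` of being served by an NLOS base station, in closed form. -/
def assocNLOS : ℝ :=
  (∫ x in (0 : ℝ)..((p.K los / p.K nlos) ^ (-(1 / p.α nlos)) * p.D ^ (p.α los / p.α nlos)),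
    (Real.exp (-(Real.pi * p.C * p.lamB * (p.K los / p.K nlos) ^ (2 / p.α los)
        * x ^ (2 * p.α nlos / p.α los)))
      - Real.exp (-(Real.pi * p.C * p.lamB * p.D ^ 2)))
    * (2 * Real.pi * (1 - p.C) * p.lamB * x)
    * Real.exp (-(Real.pi * (1 - p.C) * p.lamB * x ^ 2)))
  + Real.exp (-(Real.pi * p.C * p.lamB * p.D ^ 2))

/-- The association probabilities `A_L = 1 - A_N` and `A_N`. -/
def assoc : LinkType → ℝ
  | los => 1 - p.assocNLOS
  | nlos => p.assocNLOS

/-- The density `f_{r_j}` of the distance to the serving base station, given that it is of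
type `j`. (For `C = 0`, where `A_L = 0`, the function `f_{r_L}` is `0`.) -/
def distPdf : LinkType → ℝ → ℝ
  | los, r =>
    Set.indicator (Set.Icc 0 p.D) (fun r =>
      Real.exp (-((1 - p.C) * p.lamB * Real.pi * (p.K nlos / p.K los) ^ (2 / p.α nlos)
          * r ^ (2 * p.α los / p.α nlos)))
        * (2 * Real.pi * p.C * p.lamB * r) * Real.exp (-(p.C * p.lamB * Real.pi * r ^ 2))
        / p.assoc los) r
  | nlos, r =>
    2 * Real.pi * p.lamB * r * Real.exp (-(Real.pi * p.lamB * r ^ 2))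
        * ((1 - p.C) * Real.exp (Real.pi * p.C * p.lamB * (r ^ 2 - p.D ^ 2))
            * (if r ≤ p.D then 1 else 0)
          + (if p.D ≤ r then 1 else 0)) / p.assoc nlos
    + 2 * Real.pi * (1 - p.C) * p.lamB * r * Real.exp (-((1 - p.C) * p.lamB * Real.pi * r ^ 2))
        * (Real.exp (-(p.C * p.lamB * Real.pi * (p.K los / p.K nlos) ^ (2 / p.α los)
              * r ^ (2 * p.α nlos / p.α los)))
          - Real.exp (-(p.C * p.lamB * Real.pi * p.D ^ 2))) / p.assoc nlos
        * (if r ≤ (p.K nlos / p.K los) ^ (1 / p.α nlos) * p.D ^ (p.α los / p.α nlos)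
            then 1 else 0)

/-- The number `D^{α_j} / (V C_j)`. -/
def kappa (j : LinkType) (v : Lobe) : ℝ := p.D ^ p.α j / (p.lobeGain v * p.K j)

/-- The exponent `Ξ(s)`. -/
def Xi (s : ℝ) : ℝ :=
  -s * (2 * Real.pi * p.lamE * (∑ j : LinkType, p.q j * ∑ v : Lobe,
        p.lobeProb v * ((p.lobeGain v * p.K j) ^ (2 / p.α j) / p.α j)
          * ∑ m ∈ Finset.range (p.N j),
              p.kappa j v ^ ((m : ℝ) + 2 / p.α j)
                / (((m : ℝ) + 2 / p.α j) * (s + p.kappa j v) ^ (m + 1))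
              * ordinaryHypergeometric (1 : ℝ) ((m : ℝ) + 1) ((m : ℝ) + 2 / p.α j + 1)
                  (p.kappa j v / (p.kappa j v + s)))
    + 2 * Real.pi * p.lamE * ∑ v : Lobe,
        p.lobeProb v * ((p.lobeGain v * p.K nlos) ^ (2 / p.α nlos) / p.α nlos)
          * ∑ m ∈ Finset.range (p.N nlos),
              p.kappa nlos v ^ ((m : ℝ) + 2 / p.α nlos)
                / ((1 - 2 / p.α nlos) * (s + p.kappa nlos v) ^ (m + 1))
              * ordinaryHypergeometric (1 : ℝ) ((m : ℝ) + 1) (2 - 2 / p.α nlos)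
                  (s / (s + p.kappa nlos v)))

/-- The closed form `exp(Ξ(s))` of the Laplace transform of `I_E`. -/
def laplaceIE (s : ℝ) : ℝ := Real.exp (p.Xi s)

/-- The constant `a_j = (N_j !)^{-1/N_j}`. -/
def a (j : LinkType) : ℝ := ((p.N j).factorial : ℝ) ^ (-(1 / (p.N j : ℝ)))

end Params

/-- The points `X 0, X 1, …` form a Poisson point process with intensity measure `Λ`: the number
of points in a measurable set `B` with `Λ B < ∞` is Poisson with mean `Λ B`, and the numbers of
points in pairwise disjoint such sets are independent. -/
structure IsPoissonProcess {Ω E : Type*} [MeasurableSpace Ω] [MeasurableSpace E]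
    (X : ℕ → Ω → E) (Λ : Measure E) (P : Measure Ω) : Prop where
  measurable : ∀ i, Measurable (X i)
  law : ∀ B : Set E, MeasurableSet B → Λ B ≠ ∞ →
    HasLaw (fun ω => {i | X i ω ∈ B}.encard)
      ((poissonMeasure (Λ B).toNNReal).map (fun n : ℕ => (n : ℕ∞))) P
  indep : ∀ (k : ℕ) (B : Fin k → Set E), (∀ l, MeasurableSet (B l)) → (∀ l, Λ (B l) ≠ ∞) →
    Pairwise (Function.onFun Disjoint B) →
    iIndepFun (fun (l : Fin k) (ω : Ω) => {i | X i ω ∈ B l}.encard) P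

/-- Indices of the scalar random marks. In `userBlock i`, `userFade j i` the number `i` is a base
station, and the link is the one to the typical user; in `eveBlock i k`, `eveFade j i k`,
`eveAngle i k` the link is the one from base station `i` to eavesdropper `k`. -/
inductive Mark : Type
  | userBlock (i : ℕ)
  | userFade (j : LinkType) (i : ℕ)
  | eveBlock (i k : ℕ)
  | eveFade (j : LinkType) (i k : ℕ)
  | eveAngle (i k : ℕ)

/-- The law of each mark: blockage marks are uniform on `[0, 1]`, fading marks are gamma with shape
`N_j` and scale `1`, angles are uniform on `[-180, 180]` (degrees). -/
def markLaw (p : Params) : Mark → Measure ℝ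
  | .userBlock _ => cond volume (Set.Icc 0 1)
  | .userFade j _ => gammaMeasure (p.N j) 1
  | .eveBlock _ _ => cond volume (Set.Icc 0 1)
  | .eveFade j _ _ => gammaMeasure (p.N j) 1
  | .eveAngle _ _ => cond volume (Set.Icc (-180) 180)

/-- A realization of the network on a probability space: base stations and eavesdroppers form
independent homogeneous Poisson processes, and the blockage, the fading and the direction of the
links are independent of them and of each other. -/
structure Network (p : Params) {Ω : Type*} [MeasurableSpace Ω] (P : Measure Ω) where
  /-- the positions of the base stations -/
  bs : ℕ → Ω → Plane
  /-- the positions of the eavesdroppers -/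
  eve : ℕ → Ω → Plane
  /-- the scalar marks -/
  mark : Mark → Ω → ℝ
  bs_poisson : IsPoissonProcess bs (ENNReal.ofReal p.lamB • volume) P
  eve_poisson : IsPoissonProcess eve (ENNReal.ofReal p.lamE • volume) P
  mark_measurable : ∀ c, Measurable (mark c)
  mark_law : ∀ c, HasLaw (mark c) (markLaw p c) P
  mark_indep : iIndepFun mark P
  bs_indep_eve : IndepFun (fun ω i => bs i ω) (fun ω k => eve k ω) P
  points_indep_mark :
    IndepFun (fun ω => ((fun i => bs i ω), (fun k => eve k ω))) (fun ω c => mark c ω) P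

namespace Network

variable {p : Params} {Ω : Type*} [MeasurableSpace Ω] {P : Measure Ω} (net : Network p P)

/-- The type of the link from base station `i` to the typical user at the origin. -/
def userLink (i : ℕ) (ω : Ω) : LinkType :=
  if net.mark (.userBlock i) ω < p.qLOS ‖net.bs i ω‖ then los else nlos

/-- The path loss `L(x_i, o)`. -/
def userLoss (i : ℕ) (ω : Ω) : ℝ := p.pathLoss (net.userLink i ω) ‖net.bs i ω‖

/-- The fading `h_{x_i o}`. -/
def userFading (i : ℕ) (ω : Ω) : ℝ := net.mark (.userFade (net.userLink i ω) i) ω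

/-- The type of the link from base station `i` to eavesdropper `k`. -/
def eveLink (i k : ℕ) (ω : Ω) : LinkType :=
  if net.mark (.eveBlock i k) ω < p.qLOS ‖net.bs i ω - net.eve k ω‖ then los else nlos

/-- The path loss `L(x_i, z_k)`. -/
def eveLoss (i k : ℕ) (ω : Ω) : ℝ :=
  p.pathLoss (net.eveLink i k ω) ‖net.bs i ω - net.eve k ω‖

/-- The fading `g_{x_i z_k}`. -/
def eveFading (i k : ℕ) (ω : Ω) : ℝ := net.mark (.eveFade (net.eveLink i k ω) i k) ω

/-- The gain `G_b(θ)` of base station `i` towards eavesdropper `k`. -/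
def eveGain (i k : ℕ) (ω : Ω) : ℝ := p.gain (net.mark (.eveAngle i k) ω)

/-- The index of the serving base station `x* = argmax_x L(x, o)` (almost surely there is exactly
one maximizer). -/
def serving (ω : Ω) : ℕ := sInf {i | ∀ k, net.userLoss k ω ≤ net.userLoss i ω}

/-- The total eavesdropped power `I_E = ∑_z G_b(θ) L(x*, z) g_{x* z}`. -/
def powerE (ω : Ω) : ℝ≥0∞ :=
  ∑' k, ENNReal.ofReal (net.eveGain (net.serving ω) k ω * net.eveLoss (net.serving ω) k ω
    * net.eveFading (net.serving ω) k ω)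

/-- The secure connectivity probability `τ_c = Pr(M_s L(x*, o) h_{x* o} / I_E ≥ 1)` for colluding
eavesdroppers. -/
def tauC : ℝ :=
  P.real {ω | 1 ≤ ENNReal.ofReal (p.Ms * net.userLoss (net.serving ω) ω
    * net.userFading (net.serving ω) ω) / net.powerE ω}

end Network

end MmWave

end

noncomputable section

namespace MmWave

open LinkType

/-! ### Poisson processes: the probability generating functional -/

/-! Given that the serving station is of type j at distance r, secure connection means h ≥ I_E /
(M_s L), with h a gamma variable independent of I_E. Alzer's inequality (`alzer`,
`gammaMeasure_Ici_le`) bounds the tail P(h ≥ x) by 1 - (1 - exp(-a_j x))^{N_j}. Expanding the power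
and taking expectations gives an alternating sum of values of the Laplace transform of I_E, called
`coverBound j r`. Averaging over the type and the distance of the serving station gives the bound.
Three ingredients are needed.

The Laplace transform. The probability generating functional of a marked Poisson process
(`IsPoissonProcess.lintegral_pgf_marked`) expresses E exp(-s I) as exp(-λ_E ∫ (1 - E exp(-s W_z))
dz), where W_z is the power received over a link ending at z. Averaging over link type, lobe and
gamma fading makes the integrand a combination of terms 1 - (1 + s w r^{-α})^{-N}. A finite
geometric sum and a power substitution turn its radial integrals into incomplete beta integrals
(`radial_near`, `radial_far`), whose series is hypergeometric (`betaInt_eq_hypergeometric`); the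
result is `Xi_eq`. Letting s tend to 0 shows that the power is almost surely finite
(`ae_totalPower_ne_top`).

The law of the serving distance. The void probability of the marked process of base stations gives
the joint survival function of the nearest LOS and nearest NLOS distances (`measure_le_nearest`). It
factorises, so the two distances are independent with explicit densities. The serving station is of
type j exactly when the nearest station of the other type lies beyond the threshold `thr j r`; this
gives `lintegral_served`, the closed forms of the densities, and the association probabilities
(`measure_served`).

Decoupling. The serving index depends only on the base station positions and the blockage of the
user links. For each fixed index these are independent of everything that enters the fading, the
eavesdroppers and their links. Splitting over the countably many values of the index allows the
remaining randomness to be redrawn independently (`lintegral_serving`), so statements proved for a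
fixed station at a fixed position transfer to the serving one.

The bound without weights follows because each A_j is at most 1 and each type's contribution, being
the integral of an expectation of a nonnegative variable, is nonnegative. -/

lemma lintegral_pow_poissonMeasure (r : ℝ≥0) {c : ℝ≥0∞} (hc : c ≤ 1) :
    ∫⁻ n, c ^ n ∂(poissonMeasure r) = ENNReal.ofReal (Real.exp (-(r * (1 - c).toReal))) := by
  have hct : c ≠ ∞ := ne_top_of_le_ne_top ENNReal.one_ne_top hc
  rw [poissonMeasure, lintegral_sum_measure]
  simp_rw [lintegral_smul_measure, lintegral_dirac, smul_eq_mul]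
  lift c to ℝ≥0 using hct
  have h1 : ∀ n : ℕ, ENNReal.ofReal (Real.exp (-r) * r ^ n / n.factorial) * (c : ℝ≥0∞) ^ n
      = ENNReal.ofReal (Real.exp (-r) * ((r * c : ℝ) ^ n / n.factorial)) := by
    intro n
    rw [← ENNReal.coe_pow, ← ENNReal.ofReal_coe_nnreal, ← ENNReal.ofReal_mul (by positivity)]
    congr 1
    push_cast
    ring
  have h2 : HasSum (fun n : ℕ => Real.exp (-r) * ((r * c : ℝ) ^ n / n.factorial))
      (Real.exp (-r) * Real.exp (r * c)) := by
    rw [Real.exp_eq_exp_ℝ]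
    exact (NormedSpace.expSeries_div_hasSum_exp (r * c : ℝ)).mul_left _
  simp_rw [h1]
  rw [← ENNReal.ofReal_tsum_of_nonneg (fun n => by positivity) h2.summable, h2.tsum_eq,
    ← Real.exp_add, ENNReal.toReal_sub_of_le hc ENNReal.one_ne_top]
  congr 2
  simp
  ring

/-- The power `c ^ n` for an extended natural number `n`, with the value `0` at `n = ∞`. -/
def extPow (c : ℝ≥0∞) (n : ℕ∞) : ℝ≥0∞ := if n = ⊤ then 0 else c ^ n.toNat

section Poisson

variable {Ω E : Type*} [MeasurableSpace Ω] [MeasurableSpace E] {X : ℕ → Ω → E} {Λ : Measure E}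
  {P : Measure Ω}

lemma measurable_count (hX : ∀ i, Measurable (X i)) {B : Set E} (hB : MeasurableSet B) :
    Measurable (fun ω => {i | X i ω ∈ B}.encard) := by
  have h : Measurable (fun ω => {i | X i ω ∈ B}) := by
    rw [measurable_set_iff]
    intro i
    exact measurableSet_setOfPred.1 (hX i hB)
  exact measurable_encard.comp h

namespace IsPoissonProcess

lemma lintegral_extPow_count (h : IsPoissonProcess X Λ P) {B : Set E} (hB : MeasurableSet B)
    (hΛ : Λ B ≠ ∞) {c : ℝ≥0∞} (hc : c ≤ 1) :
    ∫⁻ ω, extPow (1 - c) {i | X i ω ∈ B}.encard ∂P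
      = ENNReal.ofReal (Real.exp (-(c * Λ B).toReal)) := by
  have hl := h.law B hB hΛ
  have h1 : ∫⁻ n : ℕ∞, extPow (1 - c) n ∂(P.map (fun ω => {i | X i ω ∈ B}.encard))
      = ∫⁻ ω, extPow (1 - c) {i | X i ω ∈ B}.encard ∂P :=
    lintegral_map .of_discrete (measurable_count h.measurable hB)
  rw [← h1, hl.map_eq, lintegral_map .of_discrete .of_discrete]
  have : ∀ n : ℕ, extPow (1 - c) (n : ℕ∞) = (1 - c) ^ n := by
    intro n
    simp [extPow]
  simp_rw [this]
  rw [lintegral_pow_poissonMeasure _ tsub_le_self, ENNReal.sub_sub_cancel ENNReal.one_ne_top hc,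
    ENNReal.toReal_mul, mul_comm]
  rfl

lemma ae_count_ne_top (h : IsPoissonProcess X Λ P) {B : Set E} (hB : MeasurableSet B)
    (hΛ : Λ B ≠ ∞) : ∀ᵐ ω ∂P, {i | X i ω ∈ B}.encard ≠ ⊤ := by
  have hl := h.law B hB hΛ
  have h1 : ∀ᵐ n : ℕ∞ ∂(P.map (fun ω => {i | X i ω ∈ B}.encard)), n ≠ ⊤ := by
    rw [hl.map_eq, ae_map_iff .of_discrete .of_discrete]
    exact ae_of_all _ fun n => ENat.natCast_ne_top n
  exact ae_of_ae_map hl.aemeasurable h1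

end IsPoissonProcess

/-- With factors at most 1, infinite products can be written as infima of partial products: no
convergence question arises, and monotone convergence moves them through integrals. -/
lemma antitone_prod_range {u : ℕ → ℝ≥0∞} (hu : ∀ i, u i ≤ 1) :
    Antitone (fun n => ∏ i ∈ Finset.range n, u i) :=
  antitone_nat_of_succ_le fun n => by
    rw [Finset.prod_range_succ]
    exact mul_le_of_le_one_right' (hu n)

open Classical in
lemma exists_prod_ite_eq_extPow (A : Set ℕ) (hA : A.encard ≠ ⊤) (c : ℝ≥0∞) :
    ∃ n₀, ∀ n, n₀ ≤ n →
      (∏ i ∈ Finset.range n, if i ∈ A then c else 1) = extPow c A.encard := by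
  have hfin : A.Finite := Set.encard_ne_top_iff.1 hA
  obtain ⟨m, hm⟩ := hfin.bddAbove
  refine ⟨m + 1, fun n hn => ?_⟩
  rw [extPow, if_neg hA, Finset.prod_ite, Finset.prod_const, Finset.prod_const_one, mul_one]
  congr 1
  rw [← Set.ncard_def, Set.ncard_eq_toFinset_card A hfin]
  congr 1
  ext i
  simp only [Finset.mem_filter, Finset.mem_range, Set.Finite.mem_toFinset, and_iff_right_iff_imp]
  intro hi
  have := hm hi
  omega

lemma iInf_eq_of_eventually_const {u : ℕ → ℝ≥0∞} (hu : Antitone u) {n₀ : ℕ} {a : ℝ≥0∞}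
    (h : ∀ n, n₀ ≤ n → u n = a) : ⨅ n, u n = a := by
  refine le_antisymm ((iInf_le u n₀).trans (h n₀ le_rfl).le) (le_iInf fun n => ?_)
  rw [← h (max n n₀) (le_max_right _ _)]
  exact hu (le_max_left _ _)

lemma ENNReal.prod_ofReal_exp_neg {ι : Type*} (s : Finset ι) (f : ι → ℝ) :
    ∏ i ∈ s, ENNReal.ofReal (Real.exp (-f i)) = ENNReal.ofReal (Real.exp (-∑ i ∈ s, f i)) := by
  rw [← ENNReal.ofReal_prod_of_nonneg (fun i _ => (Real.exp_pos _).le), ← Real.exp_sum,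
    Finset.sum_neg_distrib]

namespace IsPoissonProcess

/-- Grouping the points by the value c of `u` turns the product into ∏ (1 - c)^{count}. The level
sets are disjoint, so the counts are independent Poisson variables. The value 0 is discarded: it
contributes factors 1, and its level set may have infinite measure. -/
lemma lintegral_pgf_simpleFunc (h : IsPoissonProcess X Λ P) (u : SimpleFunc E ℝ≥0∞)
    (hu : ∀ x, u x ≤ 1) (hΛ : ∀ c, c ≠ 0 → Λ (u ⁻¹' {c}) ≠ ∞) :
    ∫⁻ ω, ⨅ n, ∏ i ∈ Finset.range n, (1 - u (X i ω)) ∂P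
      = ENNReal.ofReal (Real.exp (-(∫⁻ x, u x ∂Λ).toReal)) := by
  classical
  set T := u.range.filter (· ≠ 0) with hT
  have hT0 : ∀ c ∈ T, c ≠ 0 := fun c hc => (Finset.mem_filter.1 hc).2
  have hT1 : ∀ c ∈ T, c ≤ 1 := fun c hc => by
    obtain ⟨x, rfl⟩ := SimpleFunc.mem_range.1 (Finset.mem_filter.1 hc).1
    exact hu x
  have hprod : ∀ x, 1 - u x = ∏ c ∈ T, if x ∈ u ⁻¹' {c} then 1 - c else 1 := by
    intro x
    by_cases hx : u x = 0
    · rw [Finset.prod_eq_one, hx, tsub_zero]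
      intro c hc
      rw [if_neg]
      rintro hxc
      exact hT0 c hc (hxc ▸ hx)
    · rw [Finset.prod_eq_single (u x)]
      · simp
      · intro c _ hc
        rw [if_neg]
        exact fun hxc => hc hxc.symm
      · intro hxT
        exact absurd (Finset.mem_filter.2 ⟨SimpleFunc.mem_range_self u x, hx⟩) hxT
  have hae : ∀ᵐ ω ∂P, ⨅ n, ∏ i ∈ Finset.range n, (1 - u (X i ω))
      = ∏ c ∈ T, extPow (1 - c) {i | X i ω ∈ u ⁻¹' {c}}.encard := by
    have hfin : ∀ᵐ ω ∂P, ∀ c ∈ T, {i | X i ω ∈ u ⁻¹' {c}}.encard ≠ ⊤ :=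
      (Finset.eventually_all T).2 fun c hc =>
        h.ae_count_ne_top (u.measurableSet_preimage _) (hΛ c (hT0 c hc))
    filter_upwards [hfin] with ω hω
    -- Each level set contains finitely many points, so the partial products are constant beyond the
    -- largest of the finitely many `n₀ c`.
    choose! n₀ hn₀ using fun c (hc : c ∈ T) => exists_prod_ite_eq_extPow _ (hω c hc) (1 - c)
    refine iInf_eq_of_eventually_const (antitone_prod_range fun i => tsub_le_self)
      (n₀ := T.sup n₀) fun n hn => ?_
    simp_rw [hprod]
    rw [Finset.prod_comm]
    refine Finset.prod_congr rfl fun c hc => ?_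
    rw [← hn₀ c hc n ((Finset.le_sup hc).trans hn)]
    rfl
  rw [lintegral_congr_ae hae]
  let B : Fin T.card → Set E := fun l => u ⁻¹' {(T.equivFin.symm l : ℝ≥0∞)}
  have hBm : ∀ l, MeasurableSet (B l) := fun l => u.measurableSet_preimage _
  have hind := h.indep T.card B hBm (fun l => hΛ _ (hT0 _ (T.equivFin.symm l).2)) (by
    intro l l' hll'
    refine Disjoint.preimage _ (Set.disjoint_singleton.2 fun he => hll' ?_)
    exact T.equivFin.symm.injective (Subtype.ext he))
  have hind2 := hind.comp (fun l => extPow (1 - (T.equivFin.symm l : ℝ≥0∞)))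
    (fun l => .of_discrete)
  have hprod2 : ∀ ω, ∏ c ∈ T, extPow (1 - c) {i | X i ω ∈ u ⁻¹' {c}}.encard
      = ∏ l : Fin T.card, extPow (1 - (T.equivFin.symm l : ℝ≥0∞)) {i | X i ω ∈ B l}.encard := by
    intro ω
    rw [← Finset.prod_coe_sort, ← T.equivFin.symm.prod_comp]
  simp_rw [hprod2]
  refine (lintegral_prod_eq_prod_lintegral_of_indepFun Finset.univ _ hind2 fun l =>
    Measurable.comp .of_discrete (measurable_count h.measurable (hBm l))).trans ?_
  have hval : ∀ l, ∫⁻ ω, ((extPow (1 - (T.equivFin.symm l : ℝ≥0∞))) ∘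
      fun ω => {i | X i ω ∈ B l}.encard) ω ∂P
      = ENNReal.ofReal (Real.exp (-((T.equivFin.symm l : ℝ≥0∞) * Λ (B l)).toReal)) := fun l =>
    h.lintegral_extPow_count (hBm l) (hΛ _ (hT0 _ (T.equivFin.symm l).2))
      (hT1 _ (T.equivFin.symm l).2)
  simp_rw [hval]
  rw [ENNReal.prod_ofReal_exp_neg]
  congr 3
  rw [T.equivFin.symm.sum_comp (fun c : T => ((c : ℝ≥0∞) * Λ (u ⁻¹' {(c : ℝ≥0∞)})).toReal),
    Finset.sum_coe_sort T (fun c => (c * Λ (u ⁻¹' {c})).toReal),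
    SimpleFunc.lintegral_eq_lintegral, SimpleFunc.lintegral, ← ENNReal.toReal_sum]
  · congr 1
    refine Finset.sum_filter_of_ne fun c _ hc => ?_
    rintro rfl
    simp at hc
  · intro c hc
    exact ENNReal.mul_ne_top (ne_top_of_le_ne_top ENNReal.one_ne_top (hT1 c hc)) (hΛ c (hT0 c hc))

/-- The probability generating functional of a Poisson process. -/
theorem lintegral_pgf [IsProbabilityMeasure P] (h : IsPoissonProcess X Λ P) {ψ : E → ℝ≥0∞}
    (hψ : Measurable ψ) (hψ1 : ∀ x, ψ x ≤ 1) (hΛ : ∫⁻ x, (1 - ψ x) ∂Λ ≠ ∞) :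
    ∫⁻ ω, ⨅ n, ∏ i ∈ Finset.range n, ψ (X i ω) ∂P
      = ENNReal.ofReal (Real.exp (-(∫⁻ x, (1 - ψ x) ∂Λ).toReal)) := by
  set v : E → ℝ≥0∞ := fun x => 1 - ψ x with hv
  have hvm : Measurable v := measurable_const.sub hψ
  set u := SimpleFunc.eapprox v with hu
  have huv : ∀ m x, u m x ≤ v x := fun m x => by
    rw [← SimpleFunc.iSup_eapprox_apply hvm x]
    exact le_iSup (fun m => u m x) m
  have hu1 : ∀ m x, u m x ≤ 1 := fun m x => (huv m x).trans tsub_le_self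
  have hmono : ∀ x, Monotone fun m => u m x := fun x m m' hm => SimpleFunc.monotone_eapprox v hm x
  have hstep : ∀ m, ∫⁻ ω, ⨅ n, ∏ i ∈ Finset.range n, (1 - u m (X i ω)) ∂P
      = ENNReal.ofReal (Real.exp (-(∫⁻ x, u m x ∂Λ).toReal)) := by
    intro m
    refine h.lintegral_pgf_simpleFunc (u m) (hu1 m) fun c hc => ?_
    -- Markov's inequality: finiteness of ∫ v makes every nonzero level set of an approximant below
    -- v of finite measure.
    refine ne_top_of_le_ne_top ?_ (measure_mono (t := {x | c ≤ v x}) ?_)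
    · by_cases hct : c = ∞
      · have : {x | c ≤ v x} = ∅ := by
          ext x
          simp only [hct, top_le_iff, Set.mem_ofPred_eq, Set.mem_empty_iff_false, iff_false]
          exact ne_top_of_le_ne_top ENNReal.one_ne_top tsub_le_self
        simp [this]
      · have := meas_ge_le_lintegral_div hvm.aemeasurable hc hct (μ := Λ)
        exact ne_top_of_le_ne_top (ENNReal.div_ne_top hΛ hc) this
    · rintro x rfl
      exact huv m x
  have hψu : ∀ x, ⨅ m, (1 - u m x) = ψ x := by
    intro x
    rw [← ENNReal.sub_iSup ENNReal.one_ne_top, SimpleFunc.iSup_eapprox_apply hvm x]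
    exact ENNReal.sub_sub_cancel ENNReal.one_ne_top (hψ1 x)
  -- For fixed n the finite product is continuous in its factors, so the limit in m commutes with
  -- it. Exchanging the two infima leaves the simple-function case inside a decreasing limit in m.
  have hswap : ∀ ω, ⨅ n, ∏ i ∈ Finset.range n, ψ (X i ω)
      = ⨅ m, ⨅ n, ∏ i ∈ Finset.range n, (1 - u m (X i ω)) := by
    intro ω
    rw [iInf_comm]
    congr 1
    ext n
    have ht : Filter.Tendsto (fun m => ∏ i ∈ Finset.range n, (1 - u m (X i ω))) Filter.atTop
        (nhds (∏ i ∈ Finset.range n, ψ (X i ω))) := by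
      induction n with
      | zero => simp
      | succ n ih =>
        simp_rw [Finset.prod_range_succ]
        refine ENNReal.Tendsto.mul ih (Or.inr ?_) ?_ (Or.inr ?_)
        · exact ne_top_of_le_ne_top ENNReal.one_ne_top (hψ1 _)
        · rw [← hψu]
          exact tendsto_atTop_iInf fun m m' hm => tsub_le_tsub_left (hmono _ hm) _
        · exact ne_top_of_le_ne_top ENNReal.one_ne_top
            (Finset.prod_le_one' fun i _ => hψ1 _)
    refine tendsto_nhds_unique ht (tendsto_atTop_iInf fun m m' hm => ?_)
    exact Finset.prod_le_prod' fun i _ => tsub_le_tsub_left (hmono _ hm) _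
  simp_rw [hswap]
  have hXm := h.measurable
  rw [lintegral_iInf]
  · simp_rw [hstep]
    have ht : Filter.Tendsto (fun m => ENNReal.ofReal (Real.exp (-(∫⁻ x, u m x ∂Λ).toReal)))
        Filter.atTop (nhds (ENNReal.ofReal (Real.exp (-(∫⁻ x, v x ∂Λ).toReal)))) := by
      refine ENNReal.tendsto_ofReal ((Real.continuous_exp.tendsto _).comp
        (Filter.Tendsto.neg ?_))
      refine (ENNReal.tendsto_toReal hΛ).comp ?_
      refine lintegral_tendsto_of_tendsto_of_monotone (fun m => (u m).measurable.aemeasurable)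
        (ae_of_all _ hmono) (ae_of_all _ fun x => SimpleFunc.tendsto_eapprox hvm x)
    refine tendsto_nhds_unique (tendsto_atTop_iInf fun m m' hm => ?_) ht
    refine ENNReal.ofReal_le_ofReal (Real.exp_le_exp.2 (neg_le_neg ?_))
    refine ENNReal.toReal_mono ?_ (lintegral_mono fun x => hmono x hm)
    exact ne_top_of_le_ne_top hΛ (lintegral_mono fun x => huv m' x)
  · intro m
    refine Measurable.iInf fun n => Finset.measurable_prod _ fun i _ => ?_
    exact measurable_const.sub ((u m).measurable.comp (hXm i))
  · intro m m' hm ω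
    exact iInf_mono fun n => Finset.prod_le_prod' fun i _ => tsub_le_tsub_left (hmono _ hm) _
  · refine ne_top_of_le_ne_top ENNReal.one_ne_top ?_
    calc _ ≤ ∫⁻ _, 1 ∂P := lintegral_mono fun ω => by
          refine iInf_le_of_le 0 ?_
          simp
      _ = 1 := by simp

end IsPoissonProcess

/-- Averaging a product over independent identically distributed marks. -/
lemma lintegral_prod_marks [IsProbabilityMeasure P] {F : Type*} [MeasurableSpace F]
    {Y : ℕ → Ω → F} {ν : Measure F} (hX : ∀ i, Measurable (X i)) (hY : ∀ i, Measurable (Y i))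
    (hXY : IndepFun (fun ω i => X i ω) (fun ω i => Y i ω) P) (hYi : iIndepFun Y P)
    (hν : ∀ i, P.map (Y i) = ν) {φ : E → F → ℝ≥0∞} (hφ : Measurable (Function.uncurry φ))
    (n : ℕ) :
    ∫⁻ ω, ∏ i ∈ Finset.range n, φ (X i ω) (Y i ω) ∂P
      = ∫⁻ ω, ∏ i ∈ Finset.range n, ∫⁻ y, φ (X i ω) y ∂ν ∂P := by
  have hXm : Measurable (fun ω i => X i ω) := measurable_pi_lambda _ hX
  have hYm : Measurable (fun ω i => Y i ω) := measurable_pi_lambda _ hY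
  have hlaw := (indepFun_iff_map_prod_eq_prod_map_map hXm.aemeasurable hYm.aemeasurable).1 hXY
  let G : (ℕ → E) × (ℕ → F) → ℝ≥0∞ := fun q => ∏ i ∈ Finset.range n, φ (q.1 i) (q.2 i)
  have hG : Measurable G := Finset.measurable_prod _ fun i _ =>
    hφ.comp (f := fun q : (ℕ → E) × (ℕ → F) => (q.1 i, q.2 i)) (by fun_prop)
  have : IsProbabilityMeasure (P.map fun ω i => Y i ω) :=
    Measure.isProbabilityMeasure_map hYm.aemeasurable
  calc ∫⁻ ω, ∏ i ∈ Finset.range n, φ (X i ω) (Y i ω) ∂P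
      = ∫⁻ q, G q ∂(P.map fun ω => (fun i => X i ω, fun i => Y i ω)) :=
        (lintegral_map hG (hXm.prodMk hYm)).symm
    _ = ∫⁻ x, ∫⁻ y, G (x, y) ∂(P.map fun ω i => Y i ω) ∂(P.map fun ω i => X i ω) := by
        rw [hlaw, lintegral_prod _ hG.aemeasurable]
    _ = ∫⁻ x, ∏ i ∈ Finset.range n, ∫⁻ y, φ (x i) y ∂ν ∂(P.map fun ω i => X i ω) := by
        refine lintegral_congr fun x => ?_
        rw [lintegral_map (f := fun y => G (x, y)) (hG.comp measurable_prodMk_left) hYm]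
        have := lintegral_prod_eq_prod_lintegral_of_indepFun (Finset.range n)
          (fun i ω => φ (x i) (Y i ω))
          (hYi.comp (fun i => φ (x i)) fun i => hφ.comp measurable_prodMk_left)
          (fun i => (hφ.comp measurable_prodMk_left).comp (hY i))
        refine this.trans (Finset.prod_congr rfl fun i _ => ?_)
        rw [← hν i, lintegral_map (f := fun y => φ (x i) y) (hφ.comp measurable_prodMk_left) (hY i)]
    _ = _ := by
        have hνs : SFinite ν := by
          rw [← hν 0]
          infer_instance
        rw [lintegral_map _ hXm]
        exact Finset.measurable_prod _ fun i _ =>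
          (Measurable.lintegral_prod_right' (f := Function.uncurry φ) hφ).comp
            (measurable_pi_apply i)

/-- The probability generating functional of an independently marked Poisson process. -/
theorem IsPoissonProcess.lintegral_pgf_marked [IsProbabilityMeasure P] {F : Type*}
    [MeasurableSpace F] (h : IsPoissonProcess X Λ P)
    {Y : ℕ → Ω → F} {ν : Measure F} (hY : ∀ i, Measurable (Y i))
    (hXY : IndepFun (fun ω i => X i ω) (fun ω i => Y i ω) P) (hYi : iIndepFun Y P)
    (hν : ∀ i, P.map (Y i) = ν) {φ : E → F → ℝ≥0∞} (hφ : Measurable (Function.uncurry φ))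
    (hφ1 : ∀ x y, φ x y ≤ 1) (hΛ : ∫⁻ x, (1 - ∫⁻ y, φ x y ∂ν) ∂Λ ≠ ∞) :
    ∫⁻ ω, ⨅ n, ∏ i ∈ Finset.range n, φ (X i ω) (Y i ω) ∂P
      = ENNReal.ofReal (Real.exp (-(∫⁻ x, (1 - ∫⁻ y, φ x y ∂ν) ∂Λ).toReal)) := by
  have hνp : IsProbabilityMeasure ν := by
    rw [← hν 0]
    exact Measure.isProbabilityMeasure_map (hY 0).aemeasurable
  have hψ : Measurable fun x => ∫⁻ y, φ x y ∂ν :=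
    Measurable.lintegral_prod_right' (f := Function.uncurry φ) hφ
  have hψ1 : ∀ x, ∫⁻ y, φ x y ∂ν ≤ 1 := fun x =>
    (lintegral_mono fun y => hφ1 x y).trans (by simp)
  -- Both infima come out of the integrals, and the finite products then agree for every n by
  -- `lintegral_prod_marks`.
  rw [← h.lintegral_pgf hψ hψ1 hΛ, lintegral_iInf, lintegral_iInf]
  · simp_rw [lintegral_prod_marks h.measurable hY hXY hYi hν hφ]
  · exact fun n => Finset.measurable_prod _ fun i _ => hψ.comp (h.measurable i)
  · exact fun n m hnm ω => antitone_prod_range (fun i => hψ1 (X i ω)) hnm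
  · simp
  · exact fun n => Finset.measurable_prod _ fun i _ => hφ.comp ((h.measurable i).prodMk (hY i))
  · exact fun n m hnm ω => antitone_prod_range (fun i => hφ1 (X i ω) (Y i ω)) hnm
  · simp

end Poisson

/-! ### Gamma distributions with integer shape -/

lemma integrable_gammaPDFReal {a r : ℝ} (ha : 0 < a) (hr : 0 < r) :
    Integrable (gammaPDFReal a r) := by
  refine ⟨(stronglyMeasurable_gammaPDFReal a r).aestronglyMeasurable, ?_⟩
  rw [hasFiniteIntegral_iff_ofReal (ae_of_all _ fun x => gammaPDFReal_nonneg ha hr x)]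
  exact (lintegral_gammaPDF_eq_one ha hr).trans_lt ENNReal.one_lt_top

lemma cdf_gammaMeasure_nat (M : ℕ) {x : ℝ} (hx : 0 ≤ x) :
    cdf (gammaMeasure ((M + 1 : ℕ) : ℝ) 1) x
      = ∫ t in (0 : ℝ)..x, t ^ M * Real.exp (-t) / M.factorial := by
  have hM : (0 : ℝ) < ((M + 1 : ℕ) : ℝ) := by positivity
  have hint := integrable_gammaPDFReal hM one_pos
  rw [cdf_gammaMeasure_eq_integral hM one_pos]
  have h0 : ∫ t in Set.Iic (0 : ℝ), gammaPDFReal ((M + 1 : ℕ) : ℝ) 1 t = 0 := by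
    rw [integral_Iic_eq_integral_Iio]
    apply setIntegral_eq_zero_of_forall_eq_zero
    intro t (ht : t < 0)
    rw [gammaPDFReal, if_neg (not_le.2 ht)]
  have h1 := intervalIntegral.integral_Iic_sub_Iic (a := 0) (b := x) hint.integrableOn
    hint.integrableOn
  rw [h0, sub_zero] at h1
  rw [h1]
  apply intervalIntegral.integral_congr
  intro t ht
  rw [Set.uIcc_of_le hx] at ht
  simp only [gammaPDFReal]
  rw [if_pos ht.1]
  push_cast
  rw [Real.Gamma_nat_eq_factorial, Real.one_rpow, add_sub_cancel_right, Real.rpow_natCast, one_mul]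
  ring

/-- Exponential tilting: exp(-t g) times the gamma density of rate 1 is (1 + t)^{-N} times the gamma
density of rate 1 + t. -/
lemma lintegral_exp_gammaMeasure {N : ℕ} (hN : 0 < N) {t : ℝ} (ht : 0 ≤ t) :
    ∫⁻ g, ENNReal.ofReal (Real.exp (-(t * g))) ∂(gammaMeasure N 1)
      = ENNReal.ofReal (((1 + t) ^ N)⁻¹) := by
  have hN' : (0 : ℝ) < N := by positivity
  have ht1 : 0 < 1 + t := by linarith
  rw [gammaMeasure, lintegral_withDensity_eq_lintegral_mul₀
    (by exact (measurable_gammaPDFReal _ _).ennreal_ofReal.aemeasurable) (by fun_prop)]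
  have h : ∀ g, (gammaPDF N 1 * fun g => ENNReal.ofReal (Real.exp (-(t * g)))) g
      = ENNReal.ofReal (((1 + t) ^ N)⁻¹) * gammaPDF N (1 + t) g := by
    intro g
    rw [Pi.mul_apply, gammaPDF, gammaPDF, ← ENNReal.ofReal_mul (gammaPDFReal_nonneg hN' one_pos _),
      ← ENNReal.ofReal_mul (by positivity)]
    congr 1
    unfold gammaPDFReal
    split_ifs
    · rw [Real.one_rpow, Real.rpow_natCast (1 + t) N]
      have : Real.exp (-((1 + t) * g)) = Real.exp (-(1 * g)) * Real.exp (-(t * g)) := by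
        rw [← Real.exp_add]
        ring_nf
      rw [this]
      field_simp
    · simp
  simp_rw [h]
  rw [lintegral_const_mul _ (by exact (measurable_gammaPDFReal _ _).ennreal_ofReal),
    lintegral_gammaPDF_eq_one hN' ht1, mul_one]

/-! ### Alzer's inequality -/

lemma integral_exp_neg_mul {y : ℝ} (hy : y ≠ 0) :
    ∫ t in Set.Ioc (0 : ℝ) 1, Real.exp (-(y * t)) = (1 - Real.exp (-y)) / y := by
  rw [← intervalIntegral.integral_of_le zero_le_one]
  have : ∀ t, HasDerivAt (fun t => -Real.exp (-(y * t)) / y) (Real.exp (-(y * t))) t := by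
    intro t
    have h := ((((hasDerivAt_id t).const_mul y).neg).exp.neg).div_const y
    convert! h using 1
    simp
    field_simp
  rw [intervalIntegral.integral_eq_sub_of_hasDerivAt (fun t _ => this t)
    (by apply Continuous.intervalIntegrable; fun_prop)]
  simp
  ring

/-- The moment generating function of the uniform law on `[-1, 0]` is log-convex. -/
lemma one_sub_exp_div_le_rpow {y l : ℝ} (hy : 0 < y) (hl0 : 0 < l) (hl1 : l ≤ 1) :
    (1 - Real.exp (-(l * y))) / (l * y) ≤ ((1 - Real.exp (-y)) / y) ^ l := by
  rw [← integral_exp_neg_mul hy.ne', ← integral_exp_neg_mul (by positivity)]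
  have : IsProbabilityMeasure (volume.restrict (Set.Ioc (0 : ℝ) 1)) := ⟨by simp⟩
  -- Jensen's inequality for the concave map u ↦ u^l, applied to exp(-y t) with t uniform on (0, 1].
  have h := (Real.concaveOn_rpow hl0.le hl1).le_map_integral
    (μ := volume.restrict (Set.Ioc (0 : ℝ) 1)) (f := fun t => Real.exp (-(y * t)))
    (Real.continuous_rpow_const hl0.le).continuousOn isClosed_Ici
    (ae_of_all _ fun t => (Real.exp_pos _).le)
    ((Continuous.integrableOn_Icc (by fun_prop)).mono_set Set.Ioc_subset_Icc_self)
    ((Continuous.integrableOn_Icc ((Real.continuous_rpow_const hl0.le).comp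
      (by fun_prop))).mono_set Set.Ioc_subset_Icc_self)
  refine le_trans (le_of_eq ?_) h
  congr 1
  ext t
  rw [← Real.exp_mul]
  ring_nf

/-- A function on `[0, ∞)` vanishing at both ends, whose derivative changes sign at most once, from
plus to minus, is nonnegative. -/
lemma nonneg_of_deriv_sign_change {F F' : ℝ → ℝ} (hcont : ContinuousOn F (Set.Ici 0))
    (hderiv : ∀ x, 0 < x → HasDerivAt F (F' x) x) (h0 : F 0 = 0)
    (hlim : Filter.Tendsto F Filter.atTop (nhds 0))
    (hsign : ∀ x y, 0 < x → x ≤ y → 0 ≤ F' y → 0 ≤ F' x) {x : ℝ} (hx : 0 ≤ x) : 0 ≤ F x := by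
  rcases hx.eq_or_lt with rfl | hx
  · exact h0.ge
  -- If F' x ≥ 0, then F increases from F 0 = 0 up to x. Otherwise F' stays negative after x, so F
  -- decreases from x on towards its limit 0.
  by_cases h : 0 ≤ F' x
  · rw [← h0]
    refine monotoneOn_of_deriv_nonneg (convex_Icc 0 x) (hcont.mono Set.Icc_subset_Ici_self)
      ?_ ?_ (Set.left_mem_Icc.2 hx.le) (Set.right_mem_Icc.2 hx.le) hx.le
    · rw [interior_Icc]
      exact fun y hy => (hderiv y hy.1).differentiableAt.differentiableWithinAt
    · rw [interior_Icc]
      intro y hy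
      rw [(hderiv y hy.1).deriv]
      exact hsign y x hy.1 hy.2.le h
  · have hanti : AntitoneOn F (Set.Ici x) := by
      refine antitoneOn_of_deriv_nonpos (convex_Ici x)
        (hcont.mono (Set.Ici_subset_Ici.2 hx.le)) ?_ ?_
      · rw [interior_Ici]
        exact fun y hy => (hderiv y (hx.trans hy)).differentiableAt.differentiableWithinAt
      · rw [interior_Ici]
        intro y hy
        rw [(hderiv y (hx.trans hy)).deriv]
        by_contra hy'
        exact h (hsign x y hx (le_of_lt hy) (not_le.1 hy').le)
    refine le_of_tendsto hlim ?_
    filter_upwards [Filter.eventually_ge_atTop x] with y hy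
    exact hanti Set.self_mem_Ici hy hy

/-- The normalisation of `a` says (M + 1) a = 1 / (M! a^M), which lets a common positive factor be
taken out of both terms of the derivative. What remains is a comparison whose two sides behave well
under scaling of x. -/
lemma alzer_deriv_sign (M : ℕ) {a : ℝ} (ha : 0 < a)
    (hpow : a ^ (M + 1) * (M + 1).factorial = 1) {x : ℝ} (hx : 0 < x) :
    0 ≤ x ^ M * Real.exp (-x) / M.factorial
        - (M + 1 : ℕ) * (1 - Real.exp (-(a * x))) ^ M * (Real.exp (-(a * x)) * a)
      ↔ ((1 - Real.exp (-(a * x))) / (a * x)) ^ M ≤ Real.exp (-(x * (1 - a))) := by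
  have hf : (0 : ℝ) < M.factorial := by positivity
  have h1 : ((M + 1 : ℕ) : ℝ) * a = 1 / (M.factorial * a ^ M) := by
    rw [eq_div_iff (by positivity), ← hpow, Nat.factorial_succ]
    push_cast
    ring
  have h2 : x ^ M * Real.exp (-x) / M.factorial
        - (M + 1 : ℕ) * (1 - Real.exp (-(a * x))) ^ M * (Real.exp (-(a * x)) * a)
      = (x ^ M * Real.exp (-(a * x)) / M.factorial) * (Real.exp (-(x * (1 - a)))
        - ((1 - Real.exp (-(a * x))) / (a * x)) ^ M) := by
    have h3 : Real.exp (-x) = Real.exp (-(a * x)) * Real.exp (-(x * (1 - a))) := by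
      rw [← Real.exp_add]
      ring_nf
    have h4 : ((M + 1 : ℕ) : ℝ) * (1 - Real.exp (-(a * x))) ^ M * (Real.exp (-(a * x)) * a)
        = (((M + 1 : ℕ) : ℝ) * a) * ((1 - Real.exp (-(a * x))) ^ M * Real.exp (-(a * x))) := by
      ring
    rw [h4, h1, h3, div_pow, mul_pow]
    field_simp
  rw [h2, mul_nonneg_iff_of_pos_left (by positivity), sub_nonneg]

/-- Alzer's inequality: a lower bound for the distribution function of a gamma law. -/
lemma alzer (M : ℕ) {a : ℝ} (ha : 0 < a)
    (hpow : a ^ (M + 1) * (M + 1).factorial = 1) {x : ℝ} (hx : 0 ≤ x) :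
    (1 - Real.exp (-(a * x))) ^ (M + 1) ≤ cdf (gammaMeasure ((M + 1 : ℕ) : ℝ) 1) x := by
  set f : ℝ → ℝ := fun t => t ^ M * Real.exp (-t) / M.factorial with hf
  have hfc : Continuous f := by fun_prop
  have hd : ∀ x : ℝ, HasDerivAt
      (fun x => (∫ t in (0 : ℝ)..x, f t) - (1 - Real.exp (-(a * x))) ^ (M + 1))
      (x ^ M * Real.exp (-x) / M.factorial
        - (M + 1 : ℕ) * (1 - Real.exp (-(a * x))) ^ M * (Real.exp (-(a * x)) * a)) x := by
    intro x
    have h1 := (((((hasDerivAt_id x).const_mul a).neg).exp.const_sub 1).pow (M + 1))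
    have h2 := (hfc.integral_hasStrictDerivAt 0 x).hasDerivAt
    convert! h2.sub h1 using 1
    simp [hf]
  have hprob : IsProbabilityMeasure (gammaMeasure ((M + 1 : ℕ) : ℝ) 1) :=
    isProbabilityMeasure_gammaMeasure (by positivity) one_pos
  rw [cdf_gammaMeasure_nat M hx, ← sub_nonneg]
  refine nonneg_of_deriv_sign_change
    (fun x _ => (hd x).continuousAt.continuousWithinAt) (fun x _ => hd x) (by simp) ?_ ?_ hx
  · have h1 := tendsto_cdf_atTop (gammaMeasure ((M + 1 : ℕ) : ℝ) 1)
    have h2 : Filter.Tendsto (fun x : ℝ => (1 - Real.exp (-(a * x))) ^ (M + 1)) Filter.atTop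
        (nhds ((1 - 0) ^ (M + 1))) := by
      refine Filter.Tendsto.pow (Filter.Tendsto.const_sub 1 ?_) _
      exact Real.tendsto_exp_neg_atTop_nhds_zero.comp
        (Filter.tendsto_id.const_mul_atTop ha)
    have h3 := h1.sub h2
    rw [sub_zero, one_pow, sub_self] at h3
    refine h3.congr' ?_
    filter_upwards [Filter.eventually_ge_atTop 0] with y hy
    rw [cdf_gammaMeasure_nat M hy]
  · intro x y hx hxy hy
    rw [alzer_deriv_sign M ha hpow hx]
    have hy0 := hx.trans_le hxy
    rw [alzer_deriv_sign M ha hpow hy0] at hy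
    have hl0 : 0 < x / y := by positivity
    have hl1 : x / y ≤ 1 := (div_le_one hy0).2 hxy
    -- The sign condition passes from y to x ≤ y on raising it to the power x / y: log-convexity
    -- controls the left side, while the exponential on the right scales exactly.
    have h := one_sub_exp_div_le_rpow (mul_pos ha hy0) hl0 hl1
    have hxy' : x / y * (a * y) = a * x := by field_simp
    rw [hxy'] at h
    have hnn : ∀ z : ℝ, 0 < z → 0 ≤ (1 - Real.exp (-z)) / z := fun z hz =>
      div_nonneg (by rw [sub_nonneg, Real.exp_le_one_iff]; linarith) hz.le
    calc ((1 - Real.exp (-(a * x))) / (a * x)) ^ M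
        ≤ (((1 - Real.exp (-(a * y))) / (a * y)) ^ (x / y)) ^ M :=
          pow_le_pow_left₀ (hnn _ (mul_pos ha hx)) h _
      _ = (((1 - Real.exp (-(a * y))) / (a * y)) ^ M) ^ (x / y) := by
          rw [← Real.rpow_natCast, ← Real.rpow_natCast, ← Real.rpow_mul (hnn _ (mul_pos ha hy0)),
            ← Real.rpow_mul (hnn _ (mul_pos ha hy0)), mul_comm (x / y)]
      _ ≤ (Real.exp (-(y * (1 - a)))) ^ (x / y) :=
          Real.rpow_le_rpow (pow_nonneg (hnn _ (mul_pos ha hy0)) _) hy hl0.le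
      _ = Real.exp (-(x * (1 - a))) := by
          rw [← Real.exp_mul]
          congr 1
          field_simp

/-- The tail of a gamma law with integer shape is at most that of the maximum of `N` independent
exponential variables with rate `(N!)^{-1/N}`. -/
lemma gammaMeasure_Ici_le {N : ℕ} (hN : 0 < N) {x : ℝ} (hx : 0 ≤ x) :
    gammaMeasure N 1 (Set.Ici x) ≤ ENNReal.ofReal
      (1 - (1 - Real.exp (-((N.factorial : ℝ) ^ (-(1 / (N : ℝ))) * x))) ^ N) := by
  obtain ⟨M, rfl⟩ : ∃ M, N = M + 1 := ⟨N - 1, by omega⟩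
  set a : ℝ := ((M + 1).factorial : ℝ) ^ (-(1 / ((M + 1 : ℕ) : ℝ))) with ha
  have hf : (0 : ℝ) < (M + 1).factorial := by positivity
  have ha0 : 0 < a := by positivity
  have hpow : a ^ (M + 1) * (M + 1).factorial = 1 := by
    rw [ha, ← Real.rpow_natCast, ← Real.rpow_mul hf.le, neg_mul, one_div,
      inv_mul_cancel₀ (by positivity), Real.rpow_neg_one, inv_mul_cancel₀ hf.ne']
  have hprob : IsProbabilityMeasure (gammaMeasure ((M + 1 : ℕ) : ℝ) 1) :=
    isProbabilityMeasure_gammaMeasure (by positivity) one_pos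
  have hatoms : NullSingletonClass (gammaMeasure ((M + 1 : ℕ) : ℝ) 1) := by
    unfold gammaMeasure
    infer_instance
  have h1 : gammaMeasure ((M + 1 : ℕ) : ℝ) 1 (Set.Ici x)
      = ENNReal.ofReal (1 - cdf (gammaMeasure ((M + 1 : ℕ) : ℝ) 1) x) := by
    rw [cdf_eq_real, ← probReal_compl_eq_one_sub measurableSet_Iic, Set.compl_Iic,
      ofReal_measureReal, measure_congr Ioi_ae_eq_Ici]
  rw [h1]
  exact ENNReal.ofReal_le_ofReal (sub_le_sub_left (alzer M ha0 hpow hx) _)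

/-! ### An Euler integral of hypergeometric type -/

/-- The incomplete beta-type integral `∫₀ᵏ t^(b-1) (t+s)^(-a) dt`. -/
def betaInt (a : ℕ) (b s k : ℝ) : ℝ := ∫ t in (0 : ℝ)..k, t ^ (b - 1) * ((t + s) ^ a)⁻¹

lemma continuousOn_inv_add_pow (a : ℕ) {s k : ℝ} (hs : 0 < s) (hk : 0 ≤ k) :
    ContinuousOn (fun t : ℝ => ((t + s) ^ a)⁻¹) (Set.uIcc 0 k) := by
  refine ContinuousOn.inv₀ (by fun_prop) fun t ht => ?_
  rw [Set.uIcc_of_le hk] at ht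
  have : 0 < t + s := by linarith [ht.1]
  positivity

lemma intervalIntegrable_betaInt (a : ℕ) {b s k : ℝ} (hb : 0 < b) (hs : 0 < s) (hk : 0 ≤ k) :
    IntervalIntegrable (fun t : ℝ => t ^ (b - 1) * ((t + s) ^ a)⁻¹) volume 0 k :=
  (intervalIntegral.intervalIntegrable_rpow' (by linarith)).mul_continuousOn
    (continuousOn_inv_add_pow a hs hk)

/-- Integration by parts, integrating t^{b-1}. The boundary terms of the iterated identity are the
terms of the hypergeometric series. -/
lemma betaInt_succ (a : ℕ) {b s k : ℝ} (hb : 0 < b) (hs : 0 < s) (hk : 0 < k) :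
    betaInt a b s k = k ^ b / b * ((k + s) ^ a)⁻¹ + a / b * betaInt (a + 1) (b + 1) s k := by
  have hi1 := intervalIntegrable_betaInt a hb hs hk.le
  have hi2 := (intervalIntegrable_betaInt (a + 1) (b := b + 1) (by linarith) hs hk.le).const_mul
    ((a : ℝ) / b)
  have hcont : ContinuousOn (fun t : ℝ => t ^ b / b * ((t + s) ^ a)⁻¹) (Set.Icc 0 k) := by
    rw [← Set.uIcc_of_le hk.le]
    exact ((Real.continuous_rpow_const hb.le).div_const b).continuousOn.mul
      (continuousOn_inv_add_pow a hs hk.le)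
  have hd : ∀ t ∈ Set.Ioo 0 k, HasDerivAt (fun t : ℝ => t ^ b / b * ((t + s) ^ a)⁻¹)
      (t ^ (b - 1) * ((t + s) ^ a)⁻¹ - a / b * (t ^ (b + 1 - 1) * ((t + s) ^ (a + 1))⁻¹)) t := by
    intro t ht
    have hts : 0 < t + s := by linarith [ht.1]
    have h1 := (Real.hasDerivAt_rpow_const (x := t) (p := b) (Or.inl ht.1.ne')).div_const b
    have h2 := (((hasDerivAt_id t).add_const s).pow a).inv (pow_pos hts a).ne'
    convert! h1.mul h2 using 1
    rcases Nat.eq_zero_or_pos a with rfl | ha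
    · simp
      field_simp
    · obtain ⟨a, rfl⟩ : ∃ a', a = a' + 1 := ⟨a - 1, by omega⟩
      simp
      field_simp
      ring
  have h := intervalIntegral.integral_eq_sub_of_hasDerivAt_of_le hk.le hcont hd (hi1.sub hi2)
  rw [intervalIntegral.integral_sub hi1 hi2, intervalIntegral.integral_const_mul,
    Real.zero_rpow hb.ne'] at h
  simp only [zero_div, zero_mul, sub_zero] at h
  unfold betaInt
  linarith

lemma betaInt_nonneg (a : ℕ) (b : ℝ) {s k : ℝ} (hs : 0 < s) (hk : 0 < k) :
    0 ≤ betaInt a b s k := by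
  refine intervalIntegral.integral_nonneg hk.le fun t ht => ?_
  have h1 := ht.1
  positivity

/-- On (0, k) the extra factor t / (t + s) is at most k / (k + s) < 1, which makes the remainder
after M integrations by parts geometrically small. -/
lemma betaInt_succ_le (a : ℕ) {b s k : ℝ} (hb : 0 < b) (hs : 0 < s) (hk : 0 < k) :
    betaInt (a + 1) (b + 1) s k ≤ k / (k + s) * betaInt a b s k := by
  unfold betaInt
  rw [← intervalIntegral.integral_const_mul]
  refine intervalIntegral.integral_mono_on_of_le_Ioo hk.le
    (intervalIntegrable_betaInt (a + 1) (by linarith) hs hk.le)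
    ((intervalIntegrable_betaInt a hb hs hk.le).const_mul _) fun t ht => ?_
  have ht0 := ht.1
  have h1 : t ^ (b + 1 - 1) = t ^ (b - 1) * t := by
    rw [← Real.rpow_add_one ht0.ne']
    ring_nf
  have h2 : t / (t + s) ≤ k / (k + s) := by
    rw [div_le_div_iff₀ (by linarith) (by linarith)]
    nlinarith [ht.2]
  calc t ^ (b + 1 - 1) * ((t + s) ^ (a + 1))⁻¹
      = t / (t + s) * (t ^ (b - 1) * ((t + s) ^ a)⁻¹) := by
        rw [h1, pow_succ]
        have : t + s ≠ 0 := by linarith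
        field_simp
    _ ≤ _ := mul_le_mul_of_nonneg_right h2 (by positivity)

lemma betaInt_add_le (a : ℕ) {b s k : ℝ} (hb : 0 < b) (hs : 0 < s) (hk : 0 < k) (M : ℕ) :
    betaInt (a + M) (b + M) s k ≤ (k / (k + s)) ^ M * betaInt a b s k := by
  induction M with
  | zero => simp
  | succ M ih =>
    have h := betaInt_succ_le (a + M) (b := b + M) (by positivity) hs hk
    have : 0 ≤ k / (k + s) := by positivity
    calc betaInt (a + (M + 1)) (b + (M + 1 : ℕ)) s k
        = betaInt (a + M + 1) (b + M + 1) s k := by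
          push_cast
          ring_nf
      _ ≤ k / (k + s) * betaInt (a + M) (b + M) s k := h
      _ ≤ k / (k + s) * ((k / (k + s)) ^ M * betaInt a b s k) := by gcongr
      _ = _ := by ring

/-- The ratio `(a)_n / (b)_n` of Pochhammer symbols. -/
def pochRatio (a : ℕ) (b : ℝ) (n : ℕ) : ℝ := ∏ i ∈ Finset.range n, ((a + i : ℝ) / (b + i))

lemma pochRatio_succ (a : ℕ) (b : ℝ) (n : ℕ) :
    pochRatio a b (n + 1) = pochRatio a b n * ((a + n : ℝ) / (b + n)) :=
  Finset.prod_range_succ _ _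

lemma pochRatio_pos {a : ℕ} (ha : 0 < a) {b : ℝ} (hb : 0 < b) (n : ℕ) : 0 < pochRatio a b n :=
  Finset.prod_pos fun i _ => by positivity

lemma betaInt_eq_sum_add (a : ℕ) {b s k : ℝ} (hb : 0 < b) (hs : 0 < s) (hk : 0 < k) (M : ℕ) :
    betaInt a b s k = (∑ n ∈ Finset.range M,
        k ^ (b + n) / (b + n) * ((k + s) ^ (a + n))⁻¹ * pochRatio a b n)
      + pochRatio a b M * betaInt (a + M) (b + M) s k := by
  induction M with
  | zero => simp [pochRatio]
  | succ M ih =>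
    rw [ih, Finset.sum_range_succ, pochRatio_succ,
      betaInt_succ (a + M) (b := b + M) (by positivity) hs hk]
    push_cast
    rw [show a + M + 1 = a + (M + 1) by ring, show b + M + 1 = b + (M + 1 : ℝ) by ring]
    ring

/-- Ratio test: successive Pochhammer ratios differ by the factor (a + n) / (b + n), which tends to
1, so the geometric factor wins. -/
lemma tendsto_pochRatio_mul_pow {a : ℕ} (ha : 0 < a) {b z : ℝ} (hb : 0 < b) (hz : 0 < z)
    (hz1 : z < 1) :
    Filter.Tendsto (fun n => pochRatio a b n * z ^ n) Filter.atTop (nhds 0) := by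
  refine (summable_of_ratio_test_tendsto_lt_one hz1 (Filter.Eventually.of_forall fun n =>
    (mul_pos (pochRatio_pos ha hb n) (pow_pos hz n)).ne') ?_).tendsto_atTop_zero
  have h1 : ∀ n : ℕ, ‖pochRatio a b (n + 1) * z ^ (n + 1)‖ / ‖pochRatio a b n * z ^ n‖
      = (1 + (a - b) / (b + n)) * z := by
    intro n
    have := pochRatio_pos ha hb n
    have := pochRatio_pos ha hb (n + 1)
    rw [Real.norm_of_nonneg (by positivity), Real.norm_of_nonneg (by positivity), pochRatio_succ]
    have : b + n ≠ 0 := by positivity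
    field_simp
    ring
  simp_rw [h1]
  have h2 : Filter.Tendsto (fun n : ℕ => (a - b) / (b + (n : ℝ))) Filter.atTop (nhds 0) :=
    tendsto_const_nhds.div_atTop
      (Filter.tendsto_atTop_add_const_left _ _ tendsto_natCast_atTop_atTop)
  simpa using (h2.const_add 1).mul_const z

lemma hasSum_betaInt {a : ℕ} (ha : 0 < a) {b s k : ℝ} (hb : 0 < b) (hs : 0 < s) (hk : 0 < k) :
    HasSum (fun n : ℕ => k ^ (b + n) / (b + n) * ((k + s) ^ (a + n))⁻¹ * pochRatio a b n)
      (betaInt a b s k) := by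
  have hz1 : k / (k + s) < 1 := (div_lt_one (by linarith)).2 (by linarith)
  rw [hasSum_iff_tendsto_nat_of_nonneg]
  · have h0 : Filter.Tendsto (fun M => pochRatio a b M * betaInt (a + M) (b + M) s k)
        Filter.atTop (nhds 0) := by
      have h1 := (tendsto_pochRatio_mul_pow ha hb (z := k / (k + s)) (by positivity)
        hz1).mul_const (betaInt a b s k)
      rw [zero_mul] at h1
      refine squeeze_zero (fun M => mul_nonneg (pochRatio_pos ha hb M).le
        (betaInt_nonneg _ _ hs hk)) (fun M => ?_) h1
      rw [mul_assoc]
      exact mul_le_mul_of_nonneg_left (betaInt_add_le a hb hs hk M) (pochRatio_pos ha hb M).le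
    have h2 := h0.const_sub (betaInt a b s k)
    rw [sub_zero] at h2
    refine h2.congr fun M => ?_
    have := betaInt_eq_sum_add a hb hs hk M
    linarith
  · intro n
    have := pochRatio_pos ha hb n
    positivity

lemma ascPochhammer_eval_eq_prod (x : ℝ) (n : ℕ) :
    (ascPochhammer ℝ n).eval x = ∏ i ∈ Finset.range n, (x + i) := by
  induction n with
  | zero => simp
  | succ n ih => rw [ascPochhammer_succ_eval, ih, Finset.prod_range_succ]

/-- The series agree term by term: (1)_n cancels n!, and (b)_n (b + n) = b (b + 1)_n absorbs the
denominator left by the integrations by parts. -/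
lemma betaInt_eq_hypergeometric {a : ℕ} (ha : 0 < a) {b s k : ℝ} (hb : 0 < b) (hs : 0 < s)
    (hk : 0 < k) :
    betaInt a b s k = k ^ b / (b * (k + s) ^ a)
      * ordinaryHypergeometric (1 : ℝ) (a : ℝ) (b + 1) (k / (k + s)) := by
  rw [← (hasSum_betaInt ha hb hs hk).tsum_eq, ordinaryHypergeometric_eq_tsum, ← tsum_mul_left]
  refine tsum_congr fun n => ?_
  have h1 : (ascPochhammer ℝ n).eval (1 : ℝ) = n.factorial := ascPochhammer_eval_one ℝ n
  have hb1 : 0 < ∏ i ∈ Finset.range n, (b + 1 + i) := Finset.prod_pos fun i _ => by positivity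
  have hb0 : 0 < ∏ i ∈ Finset.range n, (b + i) := Finset.prod_pos fun i _ => by positivity
  have h2 : (∏ i ∈ Finset.range n, (b + i)) * (b + n)
      = b * ∏ i ∈ Finset.range n, (b + 1 + i) := by
    rw [← Finset.prod_range_succ (fun i : ℕ => b + i), Finset.prod_range_succ', mul_comm]
    congr 1
    · simp
    · refine Finset.prod_congr rfl fun i _ => ?_
      push_cast
      ring
  have hbn : 0 < b + n := by positivity
  have hks : 0 < k + s := by positivity
  have hn : (n.factorial : ℝ) ≠ 0 := by positivity
  rw [h1, ascPochhammer_eval_eq_prod, ascPochhammer_eval_eq_prod, pochRatio, Finset.prod_div_distrib,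
    Real.rpow_add hk, Real.rpow_natCast, smul_eq_mul, pow_add, div_pow,
    show (∏ i ∈ Finset.range n, (b + 1 + i)) = (∏ i ∈ Finset.range n, (b + i)) * (b + n) / b by
      rw [h2]; field_simp]
  field_simp

/-! ### Radial integrals -/

/-- A finite geometric sum; it is the source of the inner sums over m < N_j in `Xi`. -/
lemma one_sub_inv_pow (x : ℝ) (hx : 0 ≤ x) (N : ℕ) :
    1 - ((1 + x) ^ N)⁻¹ = x * ∑ m ∈ Finset.range N, ((1 + x) ^ (m + 1))⁻¹ := by
  induction N with
  | zero => simp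
  | succ N ih =>
    rw [Finset.sum_range_succ, mul_add, ← ih]
    field_simp
    ring

lemma image_rpow_Ioo {α D w : ℝ} (hα : 0 < α) (hD : 0 < D) (hw : 0 < w) :
    (fun r : ℝ => r ^ α / w) '' Set.Ioo 0 D = Set.Ioo 0 (D ^ α / w) := by
  ext t
  constructor
  · rintro ⟨r, hr, rfl⟩
    have h0 := hr.1
    exact ⟨by positivity, by
      exact div_lt_div_of_pos_right (Real.rpow_lt_rpow h0.le hr.2 hα) hw⟩
  · rintro ⟨ht0, ht⟩
    have hwt : 0 < w * t := by positivity
    refine ⟨(w * t) ^ α⁻¹, ⟨by positivity, ?_⟩, ?_⟩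
    · rw [Real.rpow_inv_lt_iff_of_pos hwt.le hD.le hα]
      rw [lt_div_iff₀ hw] at ht
      linarith
    · simp only
      rw [Real.rpow_inv_rpow hwt.le hα.ne']
      field_simp

lemma image_rpow_Ioi {α D w : ℝ} (hα : 0 < α) (hD : 0 < D) (hw : 0 < w) :
    (fun r : ℝ => w * r ^ (-α)) '' Set.Ioi D = Set.Ioo 0 ((D ^ α / w)⁻¹) := by
  ext t
  constructor
  · rintro ⟨r, hr, rfl⟩
    have h0 : 0 < r := hD.trans hr
    refine ⟨by positivity, ?_⟩
    simp only [Real.rpow_neg h0.le]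
    rw [inv_div, div_eq_mul_inv]
    have := Real.rpow_lt_rpow hD.le hr hα
    gcongr
  · rintro ⟨ht0, ht⟩
    have hwt : 0 < w / t := by positivity
    refine ⟨(w / t) ^ α⁻¹, ?_, ?_⟩
    · rw [Set.mem_Ioi, Real.lt_rpow_inv_iff_of_pos hD.le hwt.le hα]
      rw [inv_div, lt_div_iff₀ (by positivity)] at ht
      rw [lt_div_iff₀ ht0]
      linarith
    · simp only
      rw [Real.rpow_neg (by positivity), Real.rpow_inv_rpow hwt.le hα.ne']
      field_simp

/-- The integrand `r (1 - (1 + s w r^{-α})^{-N})`. -/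
def radial (s w α : ℝ) (N : ℕ) (r : ℝ) : ℝ := r * (1 - ((1 + s * (w * r ^ (-α))) ^ N)⁻¹)

/-- Substitute t = r^α / w, so that 1 + s w r^{-α} = (t + s) / t and r is proportional to t^{1/α}.
Each term of `one_sub_inv_pow` becomes a beta integrand on (0, D^α / w). -/
lemma radial_near {s w α D : ℝ} (hs : 0 < s) (hw : 0 < w) (hα : 0 < α) (hD : 0 < D) (N : ℕ) :
    IntegrableOn (radial s w α N) (Set.Ioc 0 D) ∧
    ∫ r in Set.Ioc 0 D, radial s w α N r
      = s * (w ^ (2 / α) / α * ∑ m ∈ Finset.range N, betaInt (m + 1) (m + 2 / α) s (D ^ α / w)) := by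
  set k := D ^ α / w with hk
  have hk0 : 0 < k := by positivity
  set G : ℝ → ℝ := fun t => s * (w ^ (2 / α) / α * ∑ m ∈ Finset.range N,
    t ^ ((m : ℝ) + 2 / α - 1) * ((t + s) ^ (m + 1))⁻¹) with hG
  have hder : ∀ r ∈ Set.Ioo 0 D, HasDerivWithinAt (fun r : ℝ => r ^ α / w)
      (α * r ^ (α - 1) / w) (Set.Ioo 0 D) r := fun r hr =>
    ((Real.hasDerivAt_rpow_const (Or.inl hr.1.ne')).div_const w).hasDerivWithinAt
  have hinj : Set.InjOn (fun r : ℝ => r ^ α / w) (Set.Ioo 0 D) := by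
    intro r hr r' hr' h
    simp only at h
    rw [div_left_inj' hw.ne'] at h
    exact (Real.rpow_left_inj hr.1.le hr'.1.le hα.ne').1 h
  have hcongr : ∀ r ∈ Set.Ioo 0 D, |α * r ^ (α - 1) / w| • G (r ^ α / w) = radial s w α N r := by
    intro r hr
    have hr0 := hr.1
    rw [abs_of_nonneg (by positivity), radial, one_sub_inv_pow _ (by positivity), hG]
    simp only [smul_eq_mul, Finset.mul_sum]
    refine Finset.sum_congr rfl fun m _ => ?_
    have e1 : (r ^ α / w) ^ ((m : ℝ) + 2 / α - 1)
        = (r ^ α / w) ^ m * (r ^ 2 / w ^ (2 / α)) / (r ^ α / w) := by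
      rw [Real.rpow_sub_one (by positivity), Real.rpow_add (by positivity), Real.rpow_natCast,
        Real.div_rpow (by positivity) hw.le (2 / α), ← Real.rpow_mul hr0.le,
        mul_div_cancel₀ _ hα.ne']
      norm_num
    have e2 : 1 + s * (w * r ^ (-α)) = (r ^ α / w + s) / (r ^ α / w) := by
      rw [Real.rpow_neg hr0.le]
      field_simp
    have e3 : r ^ (α - 1) = r ^ α / r := Real.rpow_sub_one hr0.ne' α
    rw [e1, e2, e3, Real.rpow_neg hr0.le]
    simp only [div_pow]
    have : r ^ α / w + s ≠ 0 := by positivity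
    have hw2 : w ^ (2 / α) ≠ 0 := by positivity
    have hra : r ^ α ≠ 0 := by positivity
    generalize r ^ α / w + s = A at *
    field_simp
    ring
  have hint : ∀ m ∈ Finset.range N, IntervalIntegrable (fun t : ℝ =>
      t ^ ((m : ℝ) + 2 / α - 1) * ((t + s) ^ (m + 1))⁻¹) volume 0 k := fun m _ =>
    intervalIntegrable_betaInt (m + 1) (by positivity) hs hk0.le
  have hGint : IntervalIntegrable G volume 0 k := by
    refine IntervalIntegrable.const_mul (IntervalIntegrable.const_mul ?_ _) _
    simpa only [Finset.sum_fn] using IntervalIntegrable.sum _ hint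
  have hGio : IntegrableOn G (Set.Ioo 0 k) :=
    (intervalIntegrable_iff_integrableOn_Ioo_of_le hk0.le).1 hGint
  constructor
  · rw [integrableOn_Ioc_iff_integrableOn_Ioo]
    rw [← image_rpow_Ioo hα hD hw,
      integrableOn_image_iff_integrableOn_abs_deriv_smul measurableSet_Ioo hder hinj] at hGio
    exact hGio.congr_fun hcongr measurableSet_Ioo
  · rw [integral_Ioc_eq_integral_Ioo, ← setIntegral_congr_fun measurableSet_Ioo hcongr,
      ← integral_image_eq_integral_abs_deriv_smul measurableSet_Ioo hder hinj,
      image_rpow_Ioo hα hD hw, ← integral_Ioc_eq_integral_Ioo,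
      ← intervalIntegral.integral_of_le hk0.le, hG, intervalIntegral.integral_const_mul,
      intervalIntegral.integral_const_mul, intervalIntegral.integral_finsetSum hint]
    rfl

/-- Here t = w r^{-α} sends the unbounded interval to a bounded one, with infinity going to 0. The
integrand then carries the power t^{-2/α}, and α > 2 makes it integrable at 0. -/
lemma radial_far {s w α D : ℝ} (hs : 0 < s) (hw : 0 < w) (hα : 2 < α) (hD : 0 < D) (N : ℕ) :
    IntegrableOn (radial s w α N) (Set.Ioi D) ∧
    ∫ r in Set.Ioi D, radial s w α N r
      = s * (w ^ (2 / α) / α * ∑ m ∈ Finset.range N,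
        (s ^ (m + 1))⁻¹ * betaInt (m + 1) (1 - 2 / α) s⁻¹ (D ^ α / w)⁻¹) := by
  have hα0 : 0 < α := by linarith
  have hb : 0 < 1 - 2 / α := by
    rw [sub_pos, div_lt_one hα0]
    exact hα
  set k := (D ^ α / w)⁻¹ with hk
  have hk0 : 0 < k := by positivity
  set G : ℝ → ℝ := fun t => s * (w ^ (2 / α) / α * ∑ m ∈ Finset.range N,
    (s ^ (m + 1))⁻¹ * (t ^ (1 - 2 / α - 1) * ((t + s⁻¹) ^ (m + 1))⁻¹)) with hG
  have hder : ∀ r ∈ Set.Ioi D, HasDerivWithinAt (fun r : ℝ => w * r ^ (-α))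
      (w * (-α * r ^ (-α - 1))) (Set.Ioi D) r := fun r hr =>
    ((Real.hasDerivAt_rpow_const (Or.inl (hD.trans hr).ne')).const_mul w).hasDerivWithinAt
  have hinj : Set.InjOn (fun r : ℝ => w * r ^ (-α)) (Set.Ioi D) := by
    intro r hr r' hr' h
    exact (Real.rpow_left_inj (hD.trans hr).le (hD.trans hr').le (neg_ne_zero.2 hα0.ne')).1
      (mul_left_cancel₀ hw.ne' h)
  have hcongr : ∀ r ∈ Set.Ioi D,
      |w * (-α * r ^ (-α - 1))| • G (w * r ^ (-α)) = radial s w α N r := by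
    intro r hr
    have hr0 : 0 < r := hD.trans hr
    have e0 : |w * (-α * r ^ (-α - 1))| = w * (α * (r ^ (-α) / r)) := by
      rw [abs_mul, abs_mul, abs_neg, abs_of_pos hw, abs_of_pos hα0,
        abs_of_nonneg (by positivity), Real.rpow_sub_one hr0.ne']
    rw [e0, radial, one_sub_inv_pow _ (by positivity), hG]
    simp only [smul_eq_mul, Finset.mul_sum]
    refine Finset.sum_congr rfl fun m _ => ?_
    set A := r ^ (-α) with hA
    have hA0 : 0 < A := by positivity
    have e1 : (w * A) ^ (1 - 2 / α - 1) = r ^ 2 / w ^ (2 / α) := by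
      rw [show 1 - 2 / α - 1 = -(2 / α) by ring, Real.mul_rpow hw.le hA0.le, hA,
        ← Real.rpow_mul hr0.le, Real.rpow_neg hw.le, show -α * -(2 / α) = 2 by field_simp]
      norm_num
      ring
    have e2 : w * A + s⁻¹ = (1 + s * (w * A)) / s := by
      field_simp
      ring
    rw [e1, e2, div_pow]
    have : 1 + s * (w * A) ≠ 0 := by positivity
    have hw2 : w ^ (2 / α) ≠ 0 := by positivity
    generalize 1 + s * (w * A) = B at *
    field_simp
  have hint : ∀ m ∈ Finset.range N, IntervalIntegrable (fun t : ℝ =>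
      (s ^ (m + 1))⁻¹ * (t ^ (1 - 2 / α - 1) * ((t + s⁻¹) ^ (m + 1))⁻¹)) volume 0 k := fun m _ =>
    (intervalIntegrable_betaInt (m + 1) hb (inv_pos.2 hs) hk0.le).const_mul _
  have hGint : IntervalIntegrable G volume 0 k := by
    refine IntervalIntegrable.const_mul (IntervalIntegrable.const_mul ?_ _) _
    simpa only [Finset.sum_fn] using IntervalIntegrable.sum _ hint
  have hGio : IntegrableOn G (Set.Ioo 0 k) :=
    (intervalIntegrable_iff_integrableOn_Ioo_of_le hk0.le).1 hGint
  constructor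
  · rw [hk, ← image_rpow_Ioi hα0 hD hw,
      integrableOn_image_iff_integrableOn_abs_deriv_smul measurableSet_Ioi hder hinj] at hGio
    exact hGio.congr_fun hcongr measurableSet_Ioi
  · rw [← setIntegral_congr_fun measurableSet_Ioi hcongr,
      ← integral_image_eq_integral_abs_deriv_smul measurableSet_Ioi hder hinj,
      image_rpow_Ioi hα0 hD hw, ← integral_Ioc_eq_integral_Ioo,
      ← intervalIntegral.integral_of_le hk0.le, hG, intervalIntegral.integral_const_mul,
      intervalIntegral.integral_const_mul, intervalIntegral.integral_finsetSum hint]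
    simp_rw [intervalIntegral.integral_const_mul]
    rfl

/-- Clearing the reciprocals in the far-field integral, notably k⁻¹ / (k⁻¹ + s⁻¹) = s / (s + k),
yields the form in which it occurs in `Xi`. -/
lemma betaInt_far_eq {s k b : ℝ} (hs : 0 < s) (hk : 0 < k) (hb : 0 < b) (m : ℕ) :
    (s ^ (m + 1))⁻¹ * betaInt (m + 1) b s⁻¹ k⁻¹
      = k ^ ((m : ℝ) + (1 - b)) / (b * (s + k) ^ (m + 1))
        * ordinaryHypergeometric (1 : ℝ) ((m + 1 : ℕ) : ℝ) (b + 1) (s / (s + k)) := by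
  rw [betaInt_eq_hypergeometric (Nat.succ_pos m) hb (inv_pos.2 hs) (inv_pos.2 hk)]
  have e1 : k⁻¹ / (k⁻¹ + s⁻¹) = s / (s + k) := by
    field_simp
  have e2 : k⁻¹ + s⁻¹ = (s + k) / (k * s) := by
    field_simp
  have e3 : k ^ ((m : ℝ) + (1 - b)) = k ^ (m + 1) / k ^ b := by
    rw [show (m : ℝ) + (1 - b) = ((m + 1 : ℕ) : ℝ) - b by push_cast; ring, Real.rpow_sub hk,
      Real.rpow_natCast]
  rw [e1, e2, e3, Real.inv_rpow hk.le, ← mul_assoc]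
  congr 1
  have : s + k ≠ 0 := by positivity
  rw [div_pow, mul_pow]
  generalize s + k = A at *
  field_simp

/-! ### Grouping independent families -/

/-- Independence says that the joint law is a product measure, and a product measure over a sigma
type curries into a product of product measures. -/
lemma iIndepFun_curry {Ω ι κ β : Type*} [MeasurableSpace Ω] [MeasurableSpace β] {P : Measure Ω}
    {X : ι → κ → Ω → β} (mX : ∀ i k, Measurable (X i k))
    (h : iIndepFun (fun q : (_ : ι) × κ => X q.1 q.2) P) :
    iIndepFun (fun i ω k => X i k ω) P := by
  have := h.isProbabilityMeasure
  have hP : ∀ i k, IsProbabilityMeasure (P.map (X i k)) :=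
    fun i k => Measure.isProbabilityMeasure_map (mX i k).aemeasurable
  have h1 := (iIndepFun_iff_map_fun_eq_infinitePi_map (fun q : (_ : ι) × κ => mX q.1 q.2)).1 h
  have h2 : ∀ i, P.map (fun ω k => X i k ω) = Measure.infinitePi fun k => P.map (X i k) := fun i =>
    (iIndepFun_iff_map_fun_eq_infinitePi_map (mX i)).1
      (h.precomp (g := fun k => (⟨i, k⟩ : (_ : ι) × κ)) fun k k' hk => by simpa using hk)
  rw [iIndepFun_iff_map_fun_eq_infinitePi_map (fun i => measurable_pi_lambda _ (mX i))]
  simp_rw [h2]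
  rw [← Measure.infinitePi_map_piCurry (fun i k => P.map (X i k)), ← h1,
    Measure.map_map (by fun_prop) (by fun_prop)]
  rfl

lemma comap_pi_le_iSup_range {Ω ι κ β : Type*} [MeasurableSpace β] (X : ι → Ω → β) (e : κ → ι) :
    MeasurableSpace.comap (fun ω k => X (e k) ω) MeasurableSpace.pi
      ≤ ⨆ i ∈ Set.range e, MeasurableSpace.comap (X i) inferInstance := by
  rw [MeasurableSpace.pi, MeasurableSpace.comap_iSup]
  refine iSup_le fun k => ?_
  rw [MeasurableSpace.comap_comp]
  exact le_iSup₂ (f := fun i (_ : i ∈ Set.range e) => MeasurableSpace.comap (X i) inferInstance)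
    (e k) ⟨k, rfl⟩

/-- Disjoint sets of indices of an independent family generate independent σ-algebras. -/
lemma indepFun_of_disjoint_range {Ω ι κ κ' β : Type*} [MeasurableSpace Ω] [MeasurableSpace β]
    {P : Measure Ω} {X : ι → Ω → β} (mX : ∀ i, Measurable (X i)) (h : iIndepFun X P)
    (f : κ → ι) (g : κ' → ι) (hfg : ∀ k k', f k ≠ g k') :
    IndepFun (fun ω k => X (f k) ω) (fun ω k => X (g k) ω) P := by
  have hS := indep_iSup_of_disjoint (S := Set.range f) (T := Set.range g)
    (fun i => (mX i).comap_le) h.iIndep (by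
      rw [Set.disjoint_left]
      rintro _ ⟨k, rfl⟩ ⟨k', hk'⟩
      exact hfg k k' hk'.symm)
  rw [IndepFun_iff_Indep]
  exact indep_of_indep_of_le_left (indep_of_indep_of_le_right hS (comap_pi_le_iSup_range X g))
    (comap_pi_le_iSup_range X f)

lemma comap_prodMk_eq_generateFrom {Ω α γ : Type*} [MeasurableSpace α] [MeasurableSpace γ]
    (X : Ω → α) (Z : Ω → γ) :
    MeasurableSpace.comap (fun ω => (X ω, Z ω)) Prod.instMeasurableSpace
      = MeasurableSpace.generateFrom {s | ∃ t ∈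
          Set.image2 (· ×ˢ ·) {s | MeasurableSet s} {t | MeasurableSet t},
          (fun ω => (X ω, Z ω)) ⁻¹' t = s} := by
  rw [← generateFrom_prod, MeasurableSpace.comap_generateFrom]
  rfl

/-- If `(X, Y)` and `(Z, W)` are independent, `X` and `Y` are independent, and `Z` and `W` are
independent, then `(X, Z)` and `(Y, W)` are independent. -/
lemma indepFun_prod_comm {Ω α β γ δ : Type*} [MeasurableSpace Ω] [MeasurableSpace α]
    [MeasurableSpace β] [MeasurableSpace γ] [MeasurableSpace δ] {P : Measure Ω}
    [IsProbabilityMeasure P] {X : Ω → α} {Y : Ω → β} {Z : Ω → γ} {W : Ω → δ}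
    (hX : Measurable X) (hY : Measurable Y) (hZ : Measurable Z) (hW : Measurable W)
    (hXY : IndepFun X Y P) (hZW : IndepFun Z W P)
    (h : IndepFun (fun ω => (X ω, Y ω)) (fun ω => (Z ω, W ω)) P) :
    IndepFun (fun ω => (X ω, Z ω)) (fun ω => (Y ω, W ω)) P := by
  have key : ∀ a b c d, MeasurableSet a → MeasurableSet b → MeasurableSet c → MeasurableSet d →
      P (X ⁻¹' a ∩ Y ⁻¹' b ∩ (Z ⁻¹' c ∩ W ⁻¹' d))
        = P (X ⁻¹' a) * P (Y ⁻¹' b) * (P (Z ⁻¹' c) * P (W ⁻¹' d)) := by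
    intro a b c d ha hb hc hd
    have h1 := h.measure_inter_preimage_eq_mul _ _ (ha.prod hb) (hc.prod hd)
    rw [← hXY.measure_inter_preimage_eq_mul _ _ ha hb,
      ← hZW.measure_inter_preimage_eq_mul _ _ hc hd]
    exact h1
  rw [IndepFun_iff_Indep]
  refine IndepSets.indep (hX.prodMk hZ).comap_le (hY.prodMk hW).comap_le ?_ ?_
    (comap_prodMk_eq_generateFrom X Z) (comap_prodMk_eq_generateFrom Y W) ?_
  · exact isPiSystem_prod.comap _
  · exact isPiSystem_prod.comap _
  · rw [IndepSets_iff]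
    rintro _ _ ⟨_, ⟨a, ha, c, hc, rfl⟩, rfl⟩ ⟨_, ⟨b, hb, d, hd, rfl⟩, rfl⟩
    have e1 : (fun ω => (X ω, Z ω)) ⁻¹' (a ×ˢ c) = X ⁻¹' a ∩ Z ⁻¹' c := rfl
    have e2 : (fun ω => (Y ω, W ω)) ⁻¹' (b ×ˢ d) = Y ⁻¹' b ∩ W ⁻¹' d := rfl
    have k1 := key a .univ c .univ ha .univ hc .univ
    have k2 := key .univ b .univ d .univ hb .univ hd
    simp only [Set.preimage_univ, Set.inter_univ, Set.univ_inter, measure_univ, mul_one,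
      one_mul] at k1 k2
    simp only [e1, e2]
    rw [k1, k2, Set.inter_inter_inter_comm, key a b c d ha hb hc hd]
    ring

/-! ### The power received over one link -/

/-- The marks of one link to an eavesdropper. -/
inductive LinkMark : Type
  | block
  | fade (j : LinkType)
  | angle
  deriving DecidableEq

/-- The mark of the link from base station `i` to eavesdropper `k`. -/
def eveMark (i k : ℕ) : LinkMark → Mark
  | .block => .eveBlock i k
  | .fade j => .eveFade j i k
  | .angle => .eveAngle i k

namespace Params

variable (p : Params)

/-- The law of a mark of a link to an eavesdropper. -/
def linkLaw (c : LinkMark) : Measure ℝ := markLaw p (eveMark 0 0 c)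

/-- The joint law of the marks of a link to an eavesdropper. -/
def linkMarksLaw : Measure (LinkMark → ℝ) := Measure.infinitePi p.linkLaw

/-- The type of a link of length `d` with blockage mark `b`. -/
def linkType (d b : ℝ) : LinkType := if b < p.qLOS d then los else nlos

/-- The power received by an eavesdropper at distance `d`. -/
def linkPower (d : ℝ) (y : LinkMark → ℝ) : ℝ :=
  p.gain (y .angle) * p.pathLoss (p.linkType d (y .block)) d
    * y (.fade (p.linkType d (y .block)))

/-- The probability that a link of length `d` is of type `j`. -/
def linkProb : LinkType → ℝ → ℝ
  | los, d => p.qLOS d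
  | nlos, d => 1 - p.qLOS d

/-- The lobe of the antenna pattern containing the angle `θ`. -/
def lobe (θ : ℝ) : Lobe := if |θ| ≤ p.thetaB then .main else .side

lemma lobeGain_pos (v : Lobe) : 0 < p.lobeGain v := by
  cases v
  · exact p.Ms_pos
  · exact p.ms_pos

lemma gain_eq (θ : ℝ) : p.gain θ = p.lobeGain (p.lobe θ) := by
  unfold gain lobe
  split_ifs <;> rfl

lemma lobeProb_nonneg (v : Lobe) : 0 ≤ p.lobeProb v := by
  have := p.thetaB_nonneg
  have := p.thetaB_le
  cases v
  · exact div_nonneg (by linarith) (by norm_num)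
  · exact div_nonneg (by linarith) (by norm_num)

lemma sum_lobeProb : ∑ v : Lobe, p.lobeProb v = 1 := by
  change ∑ v ∈ ({.main, .side} : Finset Lobe), p.lobeProb v = 1
  rw [Finset.sum_pair (by simp)]
  simp only [lobeProb]
  ring

lemma qLOS_nonneg (d : ℝ) : 0 ≤ p.qLOS d := by
  unfold qLOS
  split_ifs
  · exact p.C_nonneg
  · exact le_rfl

lemma qLOS_le_one (d : ℝ) : p.qLOS d ≤ 1 := by
  unfold qLOS
  split_ifs
  · exact p.C_le_one
  · exact zero_le_one

lemma linkProb_nonneg (j : LinkType) (d : ℝ) : 0 ≤ p.linkProb j d := by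
  cases j
  · exact p.qLOS_nonneg d
  · exact sub_nonneg.2 (p.qLOS_le_one d)

end Params

lemma sum_linkType {M : Type*} [AddCommMonoid M] (f : LinkType → M) :
    ∑ j : LinkType, f j = f los + f nlos :=
  Finset.sum_pair (by simp)

lemma sum_lobe {M : Type*} [AddCommMonoid M] (f : Lobe → M) :
    ∑ v : Lobe, f v = f .main + f .side :=
  Finset.sum_pair (by simp)

namespace Params

variable (p : Params)

lemma sum_linkProb (d : ℝ) : ∑ j : LinkType, p.linkProb j d = 1 := by
  rw [sum_linkType]
  simp [linkProb]

lemma pathLoss_nonneg (j : LinkType) {d : ℝ} (hd : 0 ≤ d) : 0 ≤ p.pathLoss j d :=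
  mul_nonneg (p.K_pos j).le (Real.rpow_nonneg hd _)

lemma measurable_qLOS : Measurable p.qLOS :=
  Measurable.ite measurableSet_Iic measurable_const measurable_const

lemma measurable_gain : Measurable p.gain :=
  Measurable.ite (measurableSet_le (by fun_prop) measurable_const) measurable_const measurable_const

lemma measurable_pathLoss (j : LinkType) : Measurable (p.pathLoss j) := by
  unfold pathLoss
  fun_prop

lemma measurableSet_linkType_eq_los :
    MeasurableSet {q : ℝ × ℝ | p.linkType q.1 q.2 = los} := by
  have : {q : ℝ × ℝ | p.linkType q.1 q.2 = los} = {q | q.2 < p.qLOS q.1} := by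
    ext q
    simp [linkType]
  rw [this]
  exact measurableSet_lt measurable_snd (p.measurable_qLOS.comp measurable_fst)

lemma measurableSet_linkType_eq (j : LinkType) :
    MeasurableSet {q : ℝ × ℝ | p.linkType q.1 q.2 = j} := by
  cases j
  · exact p.measurableSet_linkType_eq_los
  · have : {q : ℝ × ℝ | p.linkType q.1 q.2 = nlos} = {q : ℝ × ℝ | p.linkType q.1 q.2 = los}ᶜ := by
      ext q
      simp only [linkType, Set.mem_ofPred_eq, Set.mem_compl_iff]
      split_ifs <;> simp
    rw [this]
    exact p.measurableSet_linkType_eq_los.compl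

lemma measurable_linkPower : Measurable fun q : ℝ × (LinkMark → ℝ) => p.linkPower q.1 q.2 := by
  have h : ∀ q : ℝ × (LinkMark → ℝ), p.linkPower q.1 q.2
      = if p.linkType q.1 (q.2 .block) = los
        then p.gain (q.2 .angle) * p.pathLoss los q.1 * q.2 (.fade los)
        else p.gain (q.2 .angle) * p.pathLoss nlos q.1 * q.2 (.fade nlos) := by
    intro q
    unfold linkPower
    split_ifs with hq
    · rw [hq]
    · have : p.linkType q.1 (q.2 .block) = nlos := by
        revert hq
        cases p.linkType q.1 (q.2 .block) <;> simp
      rw [this]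
  have hg := p.measurable_gain
  have hL := p.measurable_pathLoss los
  have hN := p.measurable_pathLoss nlos
  simp_rw [h]
  refine Measurable.ite ?_ (by fun_prop) (by fun_prop)
  exact p.measurableSet_linkType_eq_los.preimage
    (f := fun q : ℝ × (LinkMark → ℝ) => (q.1, q.2 .block)) (by fun_prop)

end Params

instance isProbabilityMeasure_markLaw (p : Params) (c : Mark) :
    IsProbabilityMeasure (markLaw p c) := by
  have h : ∀ a b : ℝ, a < b → IsProbabilityMeasure (cond volume (Set.Icc a b)) := fun a b hab =>
    cond_isProbabilityMeasure_of_finite (by simp [hab]) (by simp)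
  have hN : ∀ j, (0 : ℝ) < p.N j := fun j => by exact_mod_cast p.N_pos j
  cases c
  · exact h 0 1 zero_lt_one
  · exact isProbabilityMeasure_gammaMeasure (hN _) one_pos
  · exact h 0 1 zero_lt_one
  · exact isProbabilityMeasure_gammaMeasure (hN _) one_pos
  · exact h (-180) 180 (by norm_num)

namespace Params

variable (p : Params)

instance isProbabilityMeasure_linkLaw (c : LinkMark) : IsProbabilityMeasure (p.linkLaw c) := by
  unfold linkLaw
  infer_instance

lemma cond_Icc_apply (a b : ℝ) (s : Set ℝ) :
    cond volume (Set.Icc a b) s = (ENNReal.ofReal (b - a))⁻¹ * volume (Set.Icc a b ∩ s) := by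
  rw [cond_apply measurableSet_Icc, Real.volume_Icc]

lemma uniform_linkType (d : ℝ) (j : LinkType) :
    cond volume (Set.Icc (0 : ℝ) 1) {b | p.linkType d b = j}
      = ENNReal.ofReal (p.linkProb j d) := by
  have h0 := p.qLOS_nonneg d
  have h1 := p.qLOS_le_one d
  rw [cond_Icc_apply]
  cases j
  · have : Set.Icc (0 : ℝ) 1 ∩ {b | p.linkType d b = los} = Set.Ico 0 (p.qLOS d) := by
      ext b
      simp only [linkType, Set.mem_inter_iff, Set.mem_Icc, Set.mem_ofPred_eq, Set.mem_Ico]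
      split_ifs with hb
      · simp only [and_true, hb]
        exact ⟨fun h => h.1, fun h => ⟨h, hb.le.trans h1⟩⟩
      · simp [hb]
    rw [this]
    simp [linkProb]
  · have : Set.Icc (0 : ℝ) 1 ∩ {b | p.linkType d b = nlos} = Set.Icc (p.qLOS d) 1 := by
      ext b
      simp only [linkType, Set.mem_inter_iff, Set.mem_Icc, Set.mem_ofPred_eq]
      split_ifs with hb
      · simp [hb]
      · simp only [not_lt] at hb
        simp only [and_true, hb, true_and]
        exact ⟨fun h => h.2, fun h => ⟨h0.trans hb, h⟩⟩
    rw [this]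
    simp [linkProb]

lemma uniform_lobe (v : Lobe) :
    cond volume (Set.Icc (-180 : ℝ) 180) {θ | p.lobe θ = v} = ENNReal.ofReal (p.lobeProb v) := by
  have h0 := p.thetaB_nonneg
  have h1 := p.thetaB_le
  have hprob : IsProbabilityMeasure (cond volume (Set.Icc (-180 : ℝ) 180)) :=
    cond_isProbabilityMeasure_of_finite (by simp) (by simp)
  have hmain : cond volume (Set.Icc (-180 : ℝ) 180) {θ | p.lobe θ = .main}
      = ENNReal.ofReal (p.lobeProb .main) := by
    rw [cond_Icc_apply]
    have : Set.Icc (-180 : ℝ) 180 ∩ {θ | p.lobe θ = .main} = Set.Icc (-p.thetaB) p.thetaB := by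
      ext θ
      simp only [lobe, Set.mem_inter_iff, Set.mem_Icc, Set.mem_ofPred_eq]
      split_ifs with h
      · rw [abs_le] at h
        exact ⟨fun _ => h, fun _ => ⟨⟨by linarith [h.1], by linarith [h.2]⟩, rfl⟩⟩
      · rw [abs_le] at h
        simp [h]
    rw [this, Real.volume_Icc, ← ENNReal.ofReal_inv_of_pos (by norm_num),
      ← ENNReal.ofReal_mul (by norm_num)]
    congr 1
    simp only [lobeProb]
    ring
  cases v
  · exact hmain
  · have hms : MeasurableSet {θ | p.lobe θ = .main} := by
      have : {θ | p.lobe θ = .main} = {θ | |θ| ≤ p.thetaB} := by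
        ext θ
        simp [lobe]
      rw [this]
      exact measurableSet_le (by fun_prop) measurable_const
    have : {θ | p.lobe θ = .side} = {θ | p.lobe θ = .main}ᶜ := by
      ext θ
      simp only [lobe, Set.mem_ofPred_eq, Set.mem_compl_iff]
      split_ifs <;> simp
    rw [this, prob_compl_eq_one_sub hms, hmain, ← ENNReal.ofReal_one,
      ← ENNReal.ofReal_sub _ (p.lobeProb_nonneg _)]
    congr 1
    simp only [lobeProb]
    ring

end Params

/-! ### The Laplace transform of one link and the exponent as a radial integral -/

namespace Params

variable (p : Params)

/-- The factor `exp(-s W⁺)` contributed by a link of length `d` and received power `W`. -/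
def linkFactor (s d : ℝ) (y : LinkMark → ℝ) : ℝ≥0∞ :=
  ENNReal.ofReal (Real.exp (-(s * max (p.linkPower d y) 0)))

/-- The Laplace transform of the power received over a link of length `d`. -/
def linkLaplace (s d : ℝ) : ℝ :=
  ∑ j : LinkType, ∑ v : Lobe, p.linkProb j d * p.lobeProb v
    * ((1 + s * (p.lobeGain v * p.pathLoss j d)) ^ p.N j)⁻¹

lemma linkFactor_le_one {s : ℝ} (hs : 0 ≤ s) (d : ℝ) (y : LinkMark → ℝ) :
    p.linkFactor s d y ≤ 1 := by
  unfold linkFactor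
  rw [ENNReal.ofReal_le_one, Real.exp_le_one_iff, neg_nonpos]
  positivity

lemma measurable_linkFactor (s : ℝ) :
    Measurable fun q : ℝ × (LinkMark → ℝ) => p.linkFactor s q.1 q.2 := by
  unfold linkFactor
  have := p.measurable_linkPower
  fun_prop

/-- The part of `linkFactor` coming from links of type `j` in the lobe `v`, as a product of
functions of the separate marks. -/
def linkFactorPart (s d : ℝ) (j : LinkType) (v : Lobe) : LinkMark → ℝ → ℝ≥0∞
  | .block => Set.indicator {b | p.linkType d b = j} 1
  | .angle => Set.indicator {θ | p.lobe θ = v} 1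
  | .fade _ => fun g => ENNReal.ofReal (Real.exp (-(s * (p.lobeGain v * p.pathLoss j d) * max g 0)))

lemma measurableSet_lobe (v : Lobe) : MeasurableSet {θ | p.lobe θ = v} := by
  have hm : MeasurableSet {θ | p.lobe θ = .main} := by
    have : {θ | p.lobe θ = .main} = {θ | |θ| ≤ p.thetaB} := by
      ext θ
      simp [lobe]
    rw [this]
    exact measurableSet_le (by fun_prop) measurable_const
  cases v
  · exact hm
  · have : {θ | p.lobe θ = .side} = {θ | p.lobe θ = .main}ᶜ := by
      ext θ
      simp only [lobe, Set.mem_ofPred_eq, Set.mem_compl_iff]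
      split_ifs <;> simp
    rw [this]
    exact hm.compl

lemma measurable_linkFactorPart (s d : ℝ) (j : LinkType) (v : Lobe) (c : LinkMark) :
    Measurable (p.linkFactorPart s d j v c) := by
  cases c
  · exact measurable_one.indicator ((p.measurableSet_linkType_eq j).preimage
      (f := fun b : ℝ => (d, b)) (by fun_prop))
  · unfold linkFactorPart
    fun_prop
  · exact measurable_one.indicator (p.measurableSet_lobe v)

/-- Only the pair (j, v) actually drawn contributes a nonzero term. Once j and v are fixed, the
factor splits as a product over separate marks, whose independence can then be used. -/
lemma linkFactor_eq_sum (s : ℝ) {d : ℝ} (hd : 0 ≤ d) (y : LinkMark → ℝ) :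
    p.linkFactor s d y = ∑ j : LinkType, ∑ v : Lobe,
      ∏ c ∈ {.block, .angle, .fade j}, p.linkFactorPart s d j v c (y c) := by
  have hprod : ∀ j v, ∏ c ∈ ({.block, .angle, .fade j} : Finset LinkMark),
      p.linkFactorPart s d j v c (y c)
      = Set.indicator {b | p.linkType d b = j} 1 (y .block)
        * (Set.indicator {θ | p.lobe θ = v} 1 (y .angle) * ENNReal.ofReal
          (Real.exp (-(s * (p.lobeGain v * p.pathLoss j d) * max (y (.fade j)) 0)))) := by
    intro j v
    rw [Finset.prod_insert (by simp), Finset.prod_insert (by simp), Finset.prod_singleton]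
    rfl
  simp_rw [hprod]
  set j₀ := p.linkType d (y .block) with hj₀
  set v₀ := p.lobe (y .angle) with hv₀
  rw [Finset.sum_eq_single j₀, Finset.sum_eq_single v₀]
  · rw [Set.indicator_of_mem (by exact hj₀.symm), Set.indicator_of_mem (by exact hv₀.symm)]
    simp only [Pi.one_apply, one_mul]
    unfold linkFactor linkPower
    rw [← hj₀, p.gain_eq, ← hv₀]
    have hpos : 0 ≤ p.lobeGain v₀ * p.pathLoss j₀ d :=
      mul_nonneg (p.lobeGain_pos _).le (p.pathLoss_nonneg _ hd)
    rw [mul_assoc s, mul_max_of_nonneg _ _ hpos, mul_zero]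
  · intro v _ hv
    rw [Set.indicator_of_notMem (s := {θ | p.lobe θ = v}) (fun h => hv (Eq.symm h))]
    simp
  · simp
  · intro j _ hj
    rw [Set.indicator_of_notMem (s := {b | p.linkType d b = j}) (fun h => hj (Eq.symm h))]
    simp
  · simp

lemma lintegral_linkFactorPart {s d : ℝ} (hs : 0 ≤ s) (hd : 0 ≤ d) (j : LinkType) (v : Lobe) :
    ∫⁻ y, ∏ c ∈ ({.block, .angle, .fade j} : Finset LinkMark),
        p.linkFactorPart s d j v c (y c) ∂p.linkMarksLaw
      = ENNReal.ofReal (p.linkProb j d * p.lobeProb v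
        * ((1 + s * (p.lobeGain v * p.pathLoss j d)) ^ p.N j)⁻¹) := by
  have hind := iIndepFun_infinitePi (P := p.linkLaw) (X := p.linkFactorPart s d j v)
    (p.measurable_linkFactorPart s d j v)
  have hnn : 0 ≤ s * (p.lobeGain v * p.pathLoss j d) :=
    mul_nonneg hs (mul_nonneg (p.lobeGain_pos _).le (p.pathLoss_nonneg _ hd))
  unfold linkMarksLaw
  rw [lintegral_prod_eq_prod_lintegral_of_indepFun _ _ hind
    (fun c => (p.measurable_linkFactorPart s d j v c).comp (measurable_pi_apply c))]
  have hmarg : ∀ c, ∫⁻ y, p.linkFactorPart s d j v c (y c) ∂(Measure.infinitePi p.linkLaw)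
      = ∫⁻ t, p.linkFactorPart s d j v c t ∂(p.linkLaw c) := by
    intro c
    rw [← lintegral_map (p.measurable_linkFactorPart s d j v c) (measurable_pi_apply c)]
    congr 1
    exact Measure.infinitePi_map_eval p.linkLaw c
  rw [Finset.prod_insert (by simp), Finset.prod_insert (by simp), Finset.prod_singleton,
    hmarg, hmarg, hmarg]
  have h1 : ∫⁻ t, p.linkFactorPart s d j v .block t ∂(p.linkLaw .block)
      = ENNReal.ofReal (p.linkProb j d) := by
    rw [← p.uniform_linkType d j]
    exact lintegral_indicator_one ((p.measurableSet_linkType_eq j).preimage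
      (f := fun b : ℝ => (d, b)) (by fun_prop))
  have h2 : ∫⁻ t, p.linkFactorPart s d j v .angle t ∂(p.linkLaw .angle)
      = ENNReal.ofReal (p.lobeProb v) := by
    rw [← p.uniform_lobe v]
    exact lintegral_indicator_one (p.measurableSet_lobe v)
  have h3 : ∫⁻ t, p.linkFactorPart s d j v (.fade j) t ∂(p.linkLaw (.fade j))
      = ENNReal.ofReal (((1 + s * (p.lobeGain v * p.pathLoss j d)) ^ p.N j)⁻¹) := by
    rw [← lintegral_exp_gammaMeasure (p.N_pos j) hnn]
    refine lintegral_congr_ae ?_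
    -- Gamma variables are almost surely nonnegative, so the positive part in `linkFactorPart` does
    -- not change the integral.
    have hae : ∀ᵐ g ∂(gammaMeasure (p.N j) 1), 0 ≤ g := by
      rw [ae_iff]
      simp only [not_le]
      change gammaMeasure (p.N j) 1 (Set.Iio 0) = 0
      rw [gammaMeasure, withDensity_apply _ measurableSet_Iio]
      exact lintegral_gammaPDF_of_nonpos le_rfl
    filter_upwards [hae] with g hg
    simp only [linkFactorPart, max_eq_left hg]
  rw [h1, h2, h3, ← ENNReal.ofReal_mul (p.lobeProb_nonneg _),
    ← ENNReal.ofReal_mul (p.linkProb_nonneg _ _), mul_assoc]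

lemma lintegral_linkFactor {s d : ℝ} (hs : 0 ≤ s) (hd : 0 ≤ d) :
    ∫⁻ y, p.linkFactor s d y ∂p.linkMarksLaw = ENNReal.ofReal (p.linkLaplace s d) := by
  have hm : ∀ j v, Measurable fun y : LinkMark → ℝ =>
      ∏ c ∈ ({.block, .angle, .fade j} : Finset LinkMark), p.linkFactorPart s d j v c (y c) :=
    fun j v => Finset.measurable_prod _ fun c _ =>
      (p.measurable_linkFactorPart s d j v c).comp (measurable_pi_apply c)
  have hnn : ∀ j v, 0 ≤ p.linkProb j d * p.lobeProb v
        * ((1 + s * (p.lobeGain v * p.pathLoss j d)) ^ p.N j)⁻¹ := by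
    intro j v
    have h1 := p.linkProb_nonneg j d
    have h2 := p.lobeProb_nonneg v
    have h3 := p.pathLoss_nonneg j hd
    have h4 := (p.lobeGain_pos v).le
    positivity
  simp_rw [p.linkFactor_eq_sum s hd]
  rw [lintegral_finsetSum _ fun j _ => Finset.measurable_sum _ fun v _ => hm j v]
  simp_rw [lintegral_finsetSum _ fun v _ => hm _ v, p.lintegral_linkFactorPart hs hd]
  unfold linkLaplace
  rw [ENNReal.ofReal_sum_of_nonneg fun j _ => Finset.sum_nonneg fun v _ => hnn j v]
  simp_rw [ENNReal.ofReal_sum_of_nonneg fun v _ => hnn _ v]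

/-- The probability `1 - E exp(-s W)` that a link of length `d` is lost. -/
def linkLoss (s d : ℝ) : ℝ :=
  ∑ j : LinkType, ∑ v : Lobe, p.linkProb j d * p.lobeProb v
    * (1 - ((1 + s * (p.lobeGain v * p.pathLoss j d)) ^ p.N j)⁻¹)

lemma one_sub_linkLaplace (s d : ℝ) : 1 - p.linkLaplace s d = p.linkLoss s d := by
  unfold linkLaplace linkLoss
  simp_rw [mul_sub, mul_one, Finset.sum_sub_distrib]
  congr 1
  simp_rw [← Finset.mul_sum, p.sum_lobeProb, mul_one, p.sum_linkProb]

lemma one_sub_inv_pow_nonneg {s d : ℝ} (hs : 0 ≤ s) (hd : 0 ≤ d) (j : LinkType) (v : Lobe) :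
    0 ≤ 1 - ((1 + s * (p.lobeGain v * p.pathLoss j d)) ^ p.N j)⁻¹ := by
  have h3 := p.pathLoss_nonneg j hd
  have h4 := (p.lobeGain_pos v).le
  rw [sub_nonneg]
  exact inv_le_one_of_one_le₀ (one_le_pow₀ (by
    have : 0 ≤ s * (p.lobeGain v * p.pathLoss j d) := by positivity
    linarith))

lemma linkLoss_nonneg {s d : ℝ} (hs : 0 ≤ s) (hd : 0 ≤ d) : 0 ≤ p.linkLoss s d :=
  Finset.sum_nonneg fun j _ => Finset.sum_nonneg fun v _ =>
    mul_nonneg (mul_nonneg (p.linkProb_nonneg j d) (p.lobeProb_nonneg v))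
      (p.one_sub_inv_pow_nonneg hs hd j v)

lemma linkLoss_mono {s s' d : ℝ} (hs : 0 ≤ s) (hss : s ≤ s') (hd : 0 ≤ d) :
    p.linkLoss s d ≤ p.linkLoss s' d := by
  refine Finset.sum_le_sum fun j _ => Finset.sum_le_sum fun v _ =>
    mul_le_mul_of_nonneg_left ?_ (mul_nonneg (p.linkProb_nonneg j d) (p.lobeProb_nonneg v))
  have h3 := p.pathLoss_nonneg j hd
  have h4 := (p.lobeGain_pos v).le
  gcongr

lemma one_sub_lintegral_linkFactor {s d : ℝ} (hs : 0 ≤ s) (hd : 0 ≤ d) :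
    1 - ∫⁻ y, p.linkFactor s d y ∂p.linkMarksLaw = ENNReal.ofReal (p.linkLoss s d) := by
  have h0 : 0 ≤ p.linkLaplace s d := by
    refine Finset.sum_nonneg fun j _ => Finset.sum_nonneg fun v _ => ?_
    have h1 := p.linkProb_nonneg j d
    have h2 := p.lobeProb_nonneg v
    have h3 := p.pathLoss_nonneg j hd
    have h4 := (p.lobeGain_pos v).le
    positivity
  rw [p.lintegral_linkFactor hs hd, ← one_sub_linkLaplace, ENNReal.ofReal_sub _ h0,
    ENNReal.ofReal_one]

lemma mul_linkLoss_eq_radial {s r : ℝ} :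
    r * p.linkLoss s r = ∑ j : LinkType, ∑ v : Lobe, p.linkProb j r * p.lobeProb v
      * radial s (p.lobeGain v * p.K j) (p.α j) (p.N j) r := by
  unfold linkLoss radial pathLoss
  simp_rw [Finset.mul_sum, mul_assoc]
  refine Finset.sum_congr rfl fun j _ => Finset.sum_congr rfl fun v _ => ?_
  ring

lemma linkProb_of_le (j : LinkType) {r : ℝ} (hr : r ≤ p.D) : p.linkProb j r = p.q j := by
  cases j <;> simp [linkProb, q, qLOS, hr]

lemma linkLoss_integral_near {s : ℝ} (hs : 0 < s) :
    IntegrableOn (fun r => r * p.linkLoss s r) (Set.Ioc 0 p.D) ∧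
    ∫ r in Set.Ioc 0 p.D, r * p.linkLoss s r
      = ∑ j : LinkType, ∑ v : Lobe, p.q j * p.lobeProb v
        * (s * ((p.lobeGain v * p.K j) ^ (2 / p.α j) / p.α j * ∑ m ∈ Finset.range (p.N j),
          betaInt (m + 1) (m + 2 / p.α j) s (p.kappa j v))) := by
  have hrad := fun j v => radial_near hs (mul_pos (p.lobeGain_pos v) (p.K_pos j)) (p.α_pos j)
    p.D_pos (p.N j)
  have hcongr : Set.EqOn (fun r => r * p.linkLoss s r) (fun r => ∑ j : LinkType, ∑ v : Lobe,
      p.q j * p.lobeProb v * radial s (p.lobeGain v * p.K j) (p.α j) (p.N j) r)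
      (Set.Ioc 0 p.D) := by
    intro r hr
    simp only [p.mul_linkLoss_eq_radial, p.linkProb_of_le _ hr.2]
  have hint : ∀ j v, Integrable (fun r => p.q j * p.lobeProb v
      * radial s (p.lobeGain v * p.K j) (p.α j) (p.N j) r) (volume.restrict (Set.Ioc 0 p.D)) :=
    fun j v => (hrad j v).1.const_mul _
  constructor
  · exact IntegrableOn.congr_fun (integrable_finsetSum _ fun j _ =>
      integrable_finsetSum _ fun v _ => hint j v) hcongr.symm measurableSet_Ioc
  · rw [setIntegral_congr_fun measurableSet_Ioc hcongr,
      integral_finsetSum _ fun j _ => integrable_finsetSum _ fun v _ => hint j v]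
    refine Finset.sum_congr rfl fun j _ => ?_
    rw [integral_finsetSum _ fun v _ => hint j v]
    refine Finset.sum_congr rfl fun v _ => ?_
    rw [integral_const_mul, (hrad j v).2]
    rfl

/-- Beyond D every link is NLOS, which is why only the NLOS exponent has to exceed 2. -/
lemma linkLoss_integral_far {s : ℝ} (hs : 0 < s) :
    IntegrableOn (fun r => r * p.linkLoss s r) (Set.Ioi p.D) ∧
    ∫ r in Set.Ioi p.D, r * p.linkLoss s r
      = ∑ v : Lobe, p.lobeProb v
        * (s * ((p.lobeGain v * p.K nlos) ^ (2 / p.α nlos) / p.α nlos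
          * ∑ m ∈ Finset.range (p.N nlos), (s ^ (m + 1))⁻¹
            * betaInt (m + 1) (1 - 2 / p.α nlos) s⁻¹ (p.kappa nlos v)⁻¹)) := by
  have hrad := fun v => radial_far hs (mul_pos (p.lobeGain_pos v) (p.K_pos nlos)) p.two_lt_α_nlos
    p.D_pos (p.N nlos)
  have hcongr : Set.EqOn (fun r => r * p.linkLoss s r) (fun r => ∑ v : Lobe,
      p.lobeProb v * radial s (p.lobeGain v * p.K nlos) (p.α nlos) (p.N nlos) r)
      (Set.Ioi p.D) := by
    intro r hr
    have hq : p.qLOS r = 0 := if_neg (not_le.2 hr)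
    simp only [p.mul_linkLoss_eq_radial]
    rw [sum_linkType]
    simp [linkProb, hq]
  have hint : ∀ v, Integrable (fun r => p.lobeProb v
      * radial s (p.lobeGain v * p.K nlos) (p.α nlos) (p.N nlos) r)
      (volume.restrict (Set.Ioi p.D)) :=
    fun v => (hrad v).1.const_mul _
  constructor
  · exact IntegrableOn.congr_fun (integrable_finsetSum _ fun v _ => hint v) hcongr.symm
      measurableSet_Ioi
  · rw [setIntegral_congr_fun measurableSet_Ioi hcongr, integral_finsetSum _ fun v _ => hint v]
    refine Finset.sum_congr rfl fun v _ => ?_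
    rw [integral_const_mul, (hrad v).2]
    rfl

lemma integrableOn_linkLoss {s : ℝ} (hs : 0 < s) :
    IntegrableOn (fun r => r * p.linkLoss s r) (Set.Ioi 0) := by
  rw [← Set.Ioc_union_Ioi_eq_Ioi p.D_pos.le]
  exact (p.linkLoss_integral_near hs).1.union (p.linkLoss_integral_far hs).1

lemma kappa_pos (j : LinkType) (v : Lobe) : 0 < p.kappa j v :=
  div_pos (Real.rpow_pos_of_pos p.D_pos _) (mul_pos (p.lobeGain_pos v) (p.K_pos j))

/-- The exponent `Ξ(s)` as a radial integral. -/
lemma Xi_eq {s : ℝ} (hs : 0 < s) :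
    p.Xi s = -(2 * Real.pi * p.lamE * ∫ r in Set.Ioi 0, r * p.linkLoss s r) := by
  have hb : 0 < 1 - 2 / p.α nlos := by
    rw [sub_pos, div_lt_one (p.α_pos _)]
    exact p.two_lt_α_nlos
  rw [← Set.Ioc_union_Ioi_eq_Ioi p.D_pos.le, setIntegral_union (by simp) measurableSet_Ioi
    (p.linkLoss_integral_near hs).1 (p.linkLoss_integral_far hs).1,
    (p.linkLoss_integral_near hs).2, (p.linkLoss_integral_far hs).2]
  have h1 : ∀ j v (m : ℕ), betaInt (m + 1) (m + 2 / p.α j) s (p.kappa j v)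
      = p.kappa j v ^ ((m : ℝ) + 2 / p.α j)
                / (((m : ℝ) + 2 / p.α j) * (s + p.kappa j v) ^ (m + 1))
              * ordinaryHypergeometric (1 : ℝ) ((m : ℝ) + 1) ((m : ℝ) + 2 / p.α j + 1)
                  (p.kappa j v / (p.kappa j v + s)) := by
    intro j v m
    have := p.α_pos j
    rw [betaInt_eq_hypergeometric (Nat.succ_pos m) (by positivity) hs (p.kappa_pos j v),
      add_comm (p.kappa j v) s]
    push_cast
    rfl
  have h2 : ∀ v (m : ℕ), (s ^ (m + 1))⁻¹
            * betaInt (m + 1) (1 - 2 / p.α nlos) s⁻¹ (p.kappa nlos v)⁻¹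
      = p.kappa nlos v ^ ((m : ℝ) + 2 / p.α nlos)
                / ((1 - 2 / p.α nlos) * (s + p.kappa nlos v) ^ (m + 1))
              * ordinaryHypergeometric (1 : ℝ) ((m : ℝ) + 1) (2 - 2 / p.α nlos)
                  (s / (s + p.kappa nlos v)) := by
    intro v m
    rw [betaInt_far_eq hs (p.kappa_pos nlos v) hb]
    rw [show 1 - (1 - 2 / p.α nlos) = 2 / p.α nlos by ring,
      show 1 - 2 / p.α nlos + 1 = 2 - 2 / p.α nlos by ring]
    push_cast
    rfl
  simp_rw [h1, h2]
  unfold Xi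
  simp only [sum_linkType, sum_lobe]
  ring

end Params

/-! ### The intensity integral over the plane and the behaviour of the exponent in s -/

namespace Params

variable (p : Params)

/-- Translation invariance removes x, and polar coordinates reduce the integral to `Xi_eq`; the
factor 2π is the dimension times the area of the unit disc. -/
lemma lintegral_linkLoss_plane {s : ℝ} (hs : 0 < s) (x : Plane) :
    ∫⁻ z : Plane, ENNReal.ofReal (p.linkLoss s ‖x - z‖) ∂(ENNReal.ofReal p.lamE • volume)
      = ENNReal.ofReal (-p.Xi s) := by
  have hdim : Module.finrank ℝ Plane = 2 := by simp
  have hint : Integrable (fun z : Plane => p.linkLoss s ‖z‖) := by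
    rw [integrable_fun_norm_addHaar, hdim]
    simpa using p.integrableOn_linkLoss hs
  rw [lintegral_smul_measure,
    lintegral_sub_left_eq_self (fun z : Plane => ENNReal.ofReal (p.linkLoss s ‖z‖)) x,
    ← ofReal_integral_eq_lintegral_ofReal hint
      (ae_of_all _ fun z => p.linkLoss_nonneg hs.le (norm_nonneg z)),
    integral_fun_norm_addHaar, hdim, smul_eq_mul, ← ENNReal.ofReal_mul p.lamE_pos.le, p.Xi_eq hs]
  congr 1
  have hvol : (volume : Measure Plane).real (Metric.ball 0 1) = Real.pi := by
    rw [Measure.real, EuclideanSpace.volume_ball_fin_two]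
    simp [Real.pi_pos.le]
  simp only [hvol, smul_eq_mul, nsmul_eq_mul, Nat.add_one_sub_one, pow_one]
  push_cast
  ring

lemma lintegral_one_sub_linkFactor {s : ℝ} (hs : 0 < s) (x : Plane) :
    ∫⁻ z : Plane, (1 - ∫⁻ y, p.linkFactor s ‖x - z‖ y ∂p.linkMarksLaw)
        ∂(ENNReal.ofReal p.lamE • volume) = ENNReal.ofReal (-p.Xi s) := by
  simp_rw [p.one_sub_lintegral_linkFactor hs.le (norm_nonneg _)]
  exact p.lintegral_linkLoss_plane hs x

lemma Xi_nonpos {s : ℝ} (hs : 0 < s) : p.Xi s ≤ 0 := by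
  rw [p.Xi_eq hs, neg_nonpos]
  have h := setIntegral_nonneg (μ := volume) (s := Set.Ioi (0 : ℝ))
    (f := fun r => r * p.linkLoss s r) measurableSet_Ioi fun r hr =>
      mul_nonneg (le_of_lt hr) (p.linkLoss_nonneg hs.le (le_of_lt hr))
  have := Real.pi_pos
  have := p.lamE_pos
  positivity

lemma laplaceIE_pos (s : ℝ) : 0 < p.laplaceIE s := Real.exp_pos _

lemma laplaceIE_le_one {s : ℝ} (hs : 0 < s) : p.laplaceIE s ≤ 1 :=
  Real.exp_le_one_iff.2 (p.Xi_nonpos hs)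

lemma laplaceIE_antitoneOn : AntitoneOn p.laplaceIE (Set.Ioi 0) := by
  intro s hs s' hs' hss
  refine Real.exp_le_exp.2 ?_
  rw [p.Xi_eq hs, p.Xi_eq hs', neg_le_neg_iff]
  have h := setIntegral_mono_on (p.integrableOn_linkLoss hs) (p.integrableOn_linkLoss hs')
    measurableSet_Ioi fun r hr => mul_le_mul_of_nonneg_left
      (p.linkLoss_mono (le_of_lt hs) hss (le_of_lt hr)) (le_of_lt hr)
  have := Real.pi_pos
  have := p.lamE_pos
  gcongr

lemma tendsto_linkLoss (r : ℝ) : Filter.Tendsto (fun s => p.linkLoss s r) (nhds 0) (nhds 0) := by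
  have h : ContinuousAt (fun s => p.linkLoss s r) 0 := by
    unfold linkLoss
    refine tendsto_finsetSum _ fun j _ => tendsto_finsetSum _ fun v _ => ?_
    refine ContinuousAt.mul continuousAt_const (continuousAt_const.sub (ContinuousAt.inv₀ ?_ ?_))
    · fun_prop
    · simp
  have h0 : p.linkLoss 0 r = 0 := by simp [linkLoss]
  rw [ContinuousAt, h0] at h
  exact h

/-- Dominated convergence, with the integrand at s = 1 as the dominating function since `linkLoss`
increases with s. -/
lemma tendsto_Xi : Filter.Tendsto (fun n : ℕ => p.Xi (1 / ((n : ℝ) + 1))) Filter.atTop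
    (nhds 0) := by
  have hs : ∀ n : ℕ, (0 : ℝ) < 1 / ((n : ℝ) + 1) := fun n => by positivity
  have hs1 : ∀ n : ℕ, 1 / ((n : ℝ) + 1) ≤ 1 := fun n => by
    rw [div_le_one (by positivity)]
    have : (0 : ℝ) ≤ n := by positivity
    linarith
  have h : Filter.Tendsto (fun n : ℕ => ∫ r in Set.Ioi (0 : ℝ), r * p.linkLoss (1 / ((n : ℝ) + 1)) r)
      Filter.atTop (nhds (∫ r in Set.Ioi (0 : ℝ), (0 : ℝ))) := by
    refine tendsto_integral_of_dominated_convergence (fun r => r * p.linkLoss 1 r)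
      (fun n => (p.integrableOn_linkLoss (hs n)).aestronglyMeasurable)
      (p.integrableOn_linkLoss one_pos) (fun n => ?_) ?_
    · filter_upwards [ae_restrict_mem measurableSet_Ioi] with r hr
      have hr0 : (0 : ℝ) ≤ r := le_of_lt hr
      rw [Real.norm_of_nonneg (mul_nonneg hr0 (p.linkLoss_nonneg (hs n).le hr0))]
      exact mul_le_mul_of_nonneg_left (p.linkLoss_mono (hs n).le (hs1 n) hr0) hr0
    · filter_upwards with r
      have h1 := ((p.tendsto_linkLoss r).comp
        (tendsto_one_div_add_atTop_nhds_zero_nat (𝕜 := ℝ))).const_mul r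
      rw [mul_zero] at h1
      exact h1
  rw [integral_zero] at h
  have h2 := (h.const_mul (2 * Real.pi * p.lamE)).neg
  rw [mul_zero, neg_zero] at h2
  exact h2.congr fun n => (p.Xi_eq (hs n)).symm

/-- The total power received at the points `z k` from a base station at `x`. -/
def totalPower (x : Plane) (z : ℕ → Plane) (y : ℕ → LinkMark → ℝ) : ℝ≥0∞ :=
  ∑' k, ENNReal.ofReal (p.linkPower ‖x - z k‖ (y k))

lemma measurable_totalPower :
    Measurable fun q : Plane × (ℕ → Plane) × (ℕ → LinkMark → ℝ) =>
      p.totalPower q.1 q.2.1 q.2.2 := by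
  unfold totalPower
  refine Measurable.tsum fun k => Measurable.ennreal_ofReal ?_
  exact p.measurable_linkPower.comp
    (f := fun q : Plane × (ℕ → Plane) × (ℕ → LinkMark → ℝ) => (‖q.1 - q.2.1 k‖, q.2.2 k))
    (by fun_prop)

end Params

/-- The infinite product of `exp(-s w_k⁺)` is `exp(-s ∑ w_k⁺)`. -/
lemma iInf_prod_exp_neg {s : ℝ} (hs : 0 < s) (w : ℕ → ℝ) :
    ⨅ n, ∏ k ∈ Finset.range n, ENNReal.ofReal (Real.exp (-(s * max (w k) 0)))
      = if ∑' k, ENNReal.ofReal (w k) = ∞ then 0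
        else ENNReal.ofReal (Real.exp (-(s * (∑' k, ENNReal.ofReal (w k)).toReal))) := by
  have hw : ∀ k, ENNReal.ofReal (w k) = ENNReal.ofReal (max (w k) 0) := fun k => by
    rw [ENNReal.ofReal_max, ENNReal.ofReal_zero, max_eq_left (zero_le)]
  have hanti : Antitone fun n => ∏ k ∈ Finset.range n,
      ENNReal.ofReal (Real.exp (-(s * max (w k) 0))) := antitone_prod_range fun k => by
    rw [ENNReal.ofReal_le_one, Real.exp_le_one_iff, neg_nonpos]
    positivity
  refine tendsto_nhds_unique (tendsto_atTop_iInf hanti) ?_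
  simp_rw [ENNReal.prod_ofReal_exp_neg, ← Finset.mul_sum, hw]
  by_cases hsum : Summable fun k => max (w k) 0
  · rw [← ENNReal.ofReal_tsum_of_nonneg (fun k => le_max_right _ _) hsum,
      if_neg ENNReal.ofReal_ne_top, ENNReal.toReal_ofReal (tsum_nonneg fun k => le_max_right _ _)]
    refine ENNReal.tendsto_ofReal ((Real.continuous_exp.tendsto _).comp ?_)
    exact (hsum.hasSum.tendsto_sum_nat.const_mul s).neg
  · rw [if_pos]
    · rw [← ENNReal.ofReal_zero]
      refine ENNReal.tendsto_ofReal (Real.tendsto_exp_neg_atTop_nhds_zero.comp ?_)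
      exact ((not_summable_iff_tendsto_nat_atTop_of_nonneg fun k => le_max_right _ _).1
        hsum).const_mul_atTop hs
    · by_contra h
      refine hsum ?_
      have := ENNReal.summable_toReal h
      simp only [ENNReal.toReal_ofReal (le_max_right _ (0 : ℝ))] at this
      exact this

/-! ### The power received from a fixed base station -/

namespace Network

variable {p : Params} {Ω : Type*} [MeasurableSpace Ω] {P : Measure Ω} (net : Network p P)

/-- The marks of the links from base station `i` to the eavesdroppers. -/
def eveMarks (i : ℕ) (ω : Ω) (k : ℕ) (c : LinkMark) : ℝ := net.mark (eveMark i k c) ω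

lemma powerE_eq (ω : Ω) : net.powerE ω = p.totalPower (net.bs (net.serving ω) ω)
    (fun k => net.eve k ω) (net.eveMarks (net.serving ω) ω) := rfl

lemma eveMark_injective (i : ℕ) :
    Function.Injective fun q : (_ : ℕ) × LinkMark => eveMark i q.1 q.2 := by
  rintro ⟨k, c⟩ ⟨k', c'⟩ h
  cases c <;> cases c' <;> simp_all [eveMark]

lemma markLaw_eveMark (i k : ℕ) (c : LinkMark) : markLaw p (eveMark i k c) = p.linkLaw c := by
  cases c <;> rfl

lemma iIndepFun_eveMarks (i : ℕ) : iIndepFun (fun k ω => net.eveMarks i ω k) P :=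
  iIndepFun_curry (X := fun k c ω => net.mark (eveMark i k c) ω)
    (fun _ _ => net.mark_measurable _) (net.mark_indep.precomp (eveMark_injective i))

lemma measurable_eveMarks (i : ℕ) : Measurable (net.eveMarks i) :=
  measurable_pi_lambda _ fun _ => measurable_pi_lambda _ fun _ => net.mark_measurable _

lemma map_eveMarks (i k : ℕ) : P.map (fun ω => net.eveMarks i ω k) = p.linkMarksLaw := by
  have h := (net.mark_indep.precomp (eveMark_injective i)).precomp
    (g := fun c : LinkMark => (⟨k, c⟩ : (_ : ℕ) × LinkMark)) fun c c' hc => by simpa using hc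
  have h2 := h.hasLaw_infinitePi (μ := p.linkLaw) (fun c => by
    have := net.mark_law (eveMark i k c)
    rw [markLaw_eveMark] at this
    exact this) (measurable_pi_lambda _ fun c => net.mark_measurable _).aemeasurable
  exact h2.map_eq

lemma indepFun_eve_eveMarks (i : ℕ) :
    IndepFun (fun ω k => net.eve k ω) (net.eveMarks i) P :=
  net.points_indep_mark.comp (φ := Prod.snd)
    (ψ := fun m : Mark → ℝ => fun k c => m (eveMark i k c)) measurable_snd (by fun_prop)

/-- The generating functional is applied to the eavesdroppers, each marked by the marks of its link
from station i. The answer depends on neither i nor x. -/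
lemma lintegral_prod_linkFactor [IsProbabilityMeasure P] (i : ℕ) (x : Plane) {s : ℝ}
    (hs : 0 < s) :
    ∫⁻ ω, ⨅ n, ∏ k ∈ Finset.range n, p.linkFactor s ‖x - net.eve k ω‖ (net.eveMarks i ω k) ∂P
      = ENNReal.ofReal (p.laplaceIE s) := by
  have hφ : Measurable (Function.uncurry fun (z : Plane) (y : LinkMark → ℝ) =>
      p.linkFactor s ‖x - z‖ y) :=
    (p.measurable_linkFactor s).comp
      (f := fun q : Plane × (LinkMark → ℝ) => (‖x - q.1‖, q.2)) (by fun_prop)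
  have h := net.eve_poisson.lintegral_pgf_marked (Y := fun k ω => net.eveMarks i ω k)
    (ν := p.linkMarksLaw) (φ := fun z y => p.linkFactor s ‖x - z‖ y)
    (fun k => (measurable_pi_apply k).comp (net.measurable_eveMarks i))
    (net.indepFun_eve_eveMarks i) (net.iIndepFun_eveMarks i) (net.map_eveMarks i) hφ
    (fun z y => p.linkFactor_le_one hs.le _ _)
    (by rw [p.lintegral_one_sub_linkFactor hs x]; exact ENNReal.ofReal_ne_top)
  rw [h, p.lintegral_one_sub_linkFactor hs x,
    ENNReal.toReal_ofReal (neg_nonneg.2 (p.Xi_nonpos hs)), neg_neg]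
  rfl

lemma iInf_prod_linkFactor (i : ℕ) (x : Plane) {s : ℝ} (hs : 0 < s) (ω : Ω) :
    ⨅ n, ∏ k ∈ Finset.range n, p.linkFactor s ‖x - net.eve k ω‖ (net.eveMarks i ω k)
      = if p.totalPower x (fun k => net.eve k ω) (net.eveMarks i ω) = ∞ then 0
        else ENNReal.ofReal (Real.exp
          (-(s * (p.totalPower x (fun k => net.eve k ω) (net.eveMarks i ω)).toReal))) :=
  iInf_prod_exp_neg hs fun k => p.linkPower ‖x - net.eve k ω‖ (net.eveMarks i ω k)

lemma measurable_totalPower_eve (i : ℕ) (x : Plane) :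
    Measurable fun ω => p.totalPower x (fun k => net.eve k ω) (net.eveMarks i ω) :=
  p.measurable_totalPower.comp (f := fun ω => (x, (fun k => net.eve k ω, net.eveMarks i ω)))
    (measurable_const.prodMk
      ((measurable_pi_lambda _ net.eve_poisson.measurable).prodMk (net.measurable_eveMarks i)))

/-- The product of the link factors is at most 1, and it is 0 where the power is infinite. Hence
P(power finite) ≥ exp(Ξ(s)) for every s > 0, and the right side tends to 1 as s → 0. -/
lemma ae_totalPower_ne_top [IsProbabilityMeasure P] (i : ℕ) (x : Plane) :
    ∀ᵐ ω ∂P, p.totalPower x (fun k => net.eve k ω) (net.eveMarks i ω) ≠ ∞ := by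
  set A := {ω | p.totalPower x (fun k => net.eve k ω) (net.eveMarks i ω) ≠ ∞} with hA
  have hAm : MeasurableSet A :=
    (net.measurable_totalPower_eve i x) (measurableSet_singleton ∞).compl
  have hle : ∀ n : ℕ, ENNReal.ofReal (Real.exp (p.Xi (1 / ((n : ℝ) + 1)))) ≤ P A := by
    intro n
    have hs : (0 : ℝ) < 1 / ((n : ℝ) + 1) := by positivity
    rw [← lintegral_indicator_one hAm]
    refine (net.lintegral_prod_linkFactor i x hs).ge.trans (lintegral_mono fun ω => ?_)
    simp only
    rw [net.iInf_prod_linkFactor i x hs]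
    split_ifs with h
    · exact zero_le
    · rw [Set.indicator_of_mem (show ω ∈ A from h), Pi.one_apply, ENNReal.ofReal_le_one,
        Real.exp_le_one_iff, neg_nonpos]
      positivity
  have hlim : Filter.Tendsto (fun n : ℕ => ENNReal.ofReal (Real.exp (p.Xi (1 / ((n : ℝ) + 1)))))
      Filter.atTop (nhds 1) := by
    have := ENNReal.tendsto_ofReal ((Real.continuous_exp.tendsto 0).comp p.tendsto_Xi)
    simpa using this
  have h1 : 1 ≤ P A := le_of_tendsto' hlim hle
  exact (prob_compl_eq_zero_iff hAm).2 (le_antisymm prob_le_one h1)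

/-- The Laplace transform of the power received from a base station at the fixed position `x`. -/
theorem lintegral_exp_totalPower [IsProbabilityMeasure P] (i : ℕ) (x : Plane) {s : ℝ}
    (hs : 0 < s) :
    ∫⁻ ω, ENNReal.ofReal (Real.exp
        (-(s * (p.totalPower x (fun k => net.eve k ω) (net.eveMarks i ω)).toReal))) ∂P
      = ENNReal.ofReal (p.laplaceIE s) := by
  rw [← net.lintegral_prod_linkFactor i x hs]
  refine lintegral_congr_ae ?_
  filter_upwards [net.ae_totalPower_ne_top i x] with ω hω
  rw [net.iInf_prod_linkFactor i x hs, if_neg hω]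

end Network

/-! ### Mean numbers of base stations of each type -/

/-- The other link type. -/
def LinkType.other : LinkType → LinkType
  | los => nlos
  | nlos => los

namespace Params

variable (p : Params)

/-- The probability that a link longer than `D` is of type `j`. -/
def qFar : LinkType → ℝ
  | los => 0
  | nlos => 1

lemma linkProb_eq (j : LinkType) (r : ℝ) :
    p.linkProb j r = if r ≤ p.D then p.q j else qFar j := by
  cases j
  · rfl
  · simp only [linkProb, q, qLOS, qFar]
    split_ifs <;> simp

lemma q_nonneg (j : LinkType) : 0 ≤ p.q j := by
  rw [← p.linkProb_of_le j le_rfl]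
  exact p.linkProb_nonneg j _

lemma qFar_nonneg (j : LinkType) : 0 ≤ qFar j := by
  cases j
  · exact le_rfl
  · exact zero_le_one

/-- The mean number of base stations of type `j` at distance less than `u` from the origin. -/
def meanBS (j : LinkType) (u : ℝ) : ℝ :=
  Real.pi * p.lamB * (p.q j * min u p.D ^ 2 + qFar j * (u ^ 2 - min u p.D ^ 2))

lemma meanBS_of_le (j : LinkType) {u : ℝ} (hu : u ≤ p.D) :
    p.meanBS j u = Real.pi * p.lamB * (p.q j * u ^ 2) := by
  rw [meanBS, min_eq_left hu, sub_self, mul_zero, add_zero]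

lemma meanBS_of_ge (j : LinkType) {u : ℝ} (hu : p.D ≤ u) :
    p.meanBS j u = Real.pi * p.lamB * (p.q j * p.D ^ 2 + qFar j * (u ^ 2 - p.D ^ 2)) := by
  rw [meanBS, min_eq_right hu]

lemma meanBS_nonneg (j : LinkType) {u : ℝ} (hu : 0 ≤ u) : 0 ≤ p.meanBS j u := by
  have h1 : min u p.D ^ 2 ≤ u ^ 2 :=
    pow_le_pow_left₀ (le_min hu p.D_pos.le) (min_le_left _ _) 2
  have h2 := p.q_nonneg j
  have h3 := qFar_nonneg j
  have h4 := p.lamB_pos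
  have h5 := Real.pi_pos
  have h6 : 0 ≤ u ^ 2 - min u p.D ^ 2 := by linarith
  unfold meanBS
  positivity

lemma lintegral_linkProb_ball (j : LinkType) {u : ℝ} (hu : 0 ≤ u) :
    ∫⁻ x : Plane, (Metric.ball (0 : Plane) u).indicator
        (fun x => ENNReal.ofReal (p.linkProb j ‖x‖)) x ∂(ENNReal.ofReal p.lamB • volume)
      = ENNReal.ofReal (p.meanBS j u) := by
  have hball : ∀ r : ℝ, 0 ≤ r → (volume : Measure Plane) (Metric.ball 0 r)
      = ENNReal.ofReal (Real.pi * r ^ 2) := by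
    intro r hr
    rw [EuclideanSpace.volume_ball_fin_two, mul_comm Real.pi, ENNReal.ofReal_mul (by positivity),
      ← ENNReal.ofReal_pow hr, ← NNReal.coe_real_pi, ENNReal.ofReal_coe_nnreal]
  have hcball : ∀ r : ℝ, 0 ≤ r → (volume : Measure Plane) (Metric.closedBall 0 r)
      = ENNReal.ofReal (Real.pi * r ^ 2) := by
    intro r hr
    rw [Measure.addHaar_closedBall_eq_addHaar_ball, hball r hr]
  have h4 := p.lamB_pos
  have h5 := Real.pi_pos
  have hq := p.q_nonneg j
  have hD := p.D_pos
  rw [lintegral_smul_measure, smul_eq_mul, lintegral_indicator measurableSet_ball]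
  rcases le_total u p.D with h | h
  · rw [setLIntegral_congr_fun (g := fun _ => ENNReal.ofReal (p.q j)) measurableSet_ball,
      setLIntegral_const, hball u hu, p.meanBS_of_le j h, ← ENNReal.ofReal_mul hq,
      ← ENNReal.ofReal_mul h4.le]
    · congr 1
      ring
    · intro x hx
      rw [mem_ball_zero_iff] at hx
      simp only
      rw [p.linkProb_eq, if_pos (hx.le.trans h)]
  · have hae : (Metric.ball (0 : Plane) u : Set Plane) =ᵐ[volume] Metric.closedBall (0 : Plane) u := by
      refine Filter.EventuallyEq.symm (ae_eq_of_subset_of_measure_ge Metric.ball_subset_closedBall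
        ?_ measurableSet_ball.nullMeasurableSet ?_).symm
      · rw [hball u hu, hcball u hu]
      · rw [hcball u hu]
        exact ENNReal.ofReal_ne_top
    have hsub : Metric.closedBall (0 : Plane) p.D ⊆ Metric.closedBall 0 u :=
      Metric.closedBall_subset_closedBall h
    have hfar := qFar_nonneg j
    have hdiff : 0 ≤ u ^ 2 - p.D ^ 2 := by nlinarith
    rw [setLIntegral_congr hae, ← Set.union_sdiff_cancel hsub,
      lintegral_union (measurableSet_closedBall.diff measurableSet_closedBall)
        Set.disjoint_sdiff_right,
      setLIntegral_congr_fun (g := fun _ => ENNReal.ofReal (p.q j)) measurableSet_closedBall,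
      setLIntegral_congr_fun (g := fun _ => ENNReal.ofReal (qFar j))
        (measurableSet_closedBall.diff measurableSet_closedBall),
      setLIntegral_const, setLIntegral_const,
      measure_sdiff hsub measurableSet_closedBall.nullMeasurableSet
        (by rw [hcball _ hD.le]; exact ENNReal.ofReal_ne_top),
      hcball u hu, hcball _ hD.le, p.meanBS_of_ge j h, ← ENNReal.ofReal_sub _ (by positivity),
      ← mul_sub, ← ENNReal.ofReal_mul hq, ← ENNReal.ofReal_mul hfar,
      ← ENNReal.ofReal_add (by positivity) (by positivity), ← ENNReal.ofReal_mul h4.le]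
    · congr 1
      ring
    · intro x hx
      have hx2 := hx.2
      rw [mem_closedBall_zero_iff] at hx2
      simp only
      rw [p.linkProb_eq, if_neg hx2]
    · intro x hx
      rw [mem_closedBall_zero_iff] at hx
      simp only
      rw [p.linkProb_eq, if_pos hx]

end Params

/-! ### The nearest base station of each type -/

/-- Writes the event that no point falls outside G as an infinite product, so that void
probabilities become values of the generating functional. -/
lemma iInf_prod_indicator {α : Type*} (G : Set α) (a : ℕ → α) :
    ⨅ n, ∏ i ∈ Finset.range n, G.indicator (1 : α → ℝ≥0∞) (a i)
      = {b : ℕ → α | ∀ i, b i ∈ G}.indicator 1 a := by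
  by_cases h : ∀ i, a i ∈ G
  · rw [Set.indicator_of_mem (show a ∈ {b : ℕ → α | ∀ i, b i ∈ G} from h)]
    simp [h]
  · rw [Set.indicator_of_notMem (show a ∉ {b : ℕ → α | ∀ i, b i ∈ G} from h)]
    push Not at h
    obtain ⟨i, hi⟩ := h
    refine le_antisymm ((iInf_le _ (i + 1)).trans ?_) zero_le
    rw [Finset.prod_eq_zero (Finset.mem_range.2 (Nat.lt_succ_self i))]
    exact Set.indicator_of_notMem hi _

namespace Network

variable {p : Params} {Ω : Type*} [MeasurableSpace Ω] {P : Measure Ω} (net : Network p P)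

lemma userLink_eq (i : ℕ) (ω : Ω) :
    net.userLink i ω = p.linkType ‖net.bs i ω‖ (net.mark (.userBlock i) ω) := rfl

open Classical in
/-- The distance to the nearest base station of type `j` (`∞` if there is none). -/
def nearest (j : LinkType) (ω : Ω) : ℝ≥0∞ :=
  ⨅ i, if net.userLink i ω = j then ‖net.bs i ω‖ₑ else ∞

lemma le_nearest_iff (j : LinkType) (ω : Ω) (u : ℝ≥0∞) :
    u ≤ net.nearest j ω ↔ ∀ i, net.userLink i ω = j → u ≤ ‖net.bs i ω‖ₑ := by
  unfold nearest
  rw [le_iInf_iff]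
  refine forall_congr' fun i => ?_
  split_ifs with h <;> simp [h]

lemma measurableSet_userLink_eq (i : ℕ) (j : LinkType) :
    MeasurableSet {ω | net.userLink i ω = j} :=
  (p.measurableSet_linkType_eq j).preimage
    (f := fun ω => (‖net.bs i ω‖, net.mark (.userBlock i) ω))
    ((net.bs_poisson.measurable i).norm.prodMk (net.mark_measurable _))

lemma measurable_nearest (j : LinkType) : Measurable (net.nearest j) :=
  Measurable.iInf fun i => Measurable.ite (net.measurableSet_userLink_eq i j)
    (net.bs_poisson.measurable i).enorm measurable_const

/-- The joint survival function of the distances to the nearest base stations of both types. -/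
lemma measure_le_nearest [IsProbabilityMeasure P] {u : LinkType → ℝ} (hu : ∀ j, 0 ≤ u j) :
    P {ω | ∀ j, ENNReal.ofReal (u j) ≤ net.nearest j ω}
      = ENNReal.ofReal (Real.exp (-∑ j, p.meanBS j (u j))) := by
  -- The admissible marked points: those not closer to the origin than the bound for their own type.
  -- The event says that all marked points lie in G.
  set G : Set (Plane × ℝ) := {q | u (p.linkType ‖q.1‖ q.2) ≤ ‖q.1‖} with hG
  have hGm : MeasurableSet G := by
    have : G = ⋃ j : LinkType, {q : Plane × ℝ | p.linkType ‖q.1‖ q.2 = j}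
        ∩ {q : Plane × ℝ | u j ≤ ‖q.1‖} := by
      ext q
      simp [hG]
    rw [this]
    refine MeasurableSet.iUnion fun j => MeasurableSet.inter ?_ ?_
    · exact (p.measurableSet_linkType_eq j).preimage
        (f := fun q : Plane × ℝ => (‖q.1‖, q.2)) (by fun_prop)
    · exact measurableSet_le measurable_const (by fun_prop)
  have hset : {ω | ∀ j, ENNReal.ofReal (u j) ≤ net.nearest j ω}
      = {ω | ∀ i, (net.bs i ω, net.mark (.userBlock i) ω) ∈ G} := by
    ext ω
    simp only [Set.mem_ofPred_eq, le_nearest_iff, userLink_eq, hG, ← ofReal_norm,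
      ENNReal.ofReal_le_ofReal_iff (norm_nonneg _)]
    exact ⟨fun h i => h _ i rfl, fun h j i hij => hij ▸ h i⟩
  have hsetm : MeasurableSet {ω | ∀ j, ENNReal.ofReal (u j) ≤ net.nearest j ω} := by
    have : {ω | ∀ j, ENNReal.ofReal (u j) ≤ net.nearest j ω}
        = ⋂ j, {ω | ENNReal.ofReal (u j) ≤ net.nearest j ω} := by
      ext ω
      simp
    rw [this]
    exact MeasurableSet.iInter fun j => measurableSet_le measurable_const (net.measurable_nearest j)
  have hmark : iIndepFun (fun i => net.mark (.userBlock i)) P :=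
    net.mark_indep.precomp (g := Mark.userBlock) fun i i' h => by simpa using h
  have hind : IndepFun (fun ω i => net.bs i ω) (fun ω i => net.mark (.userBlock i) ω) P :=
    net.points_indep_mark.comp (φ := Prod.fst)
      (ψ := fun m : Mark → ℝ => fun i => m (.userBlock i)) measurable_fst (by fun_prop)
  have hψ : ∀ x : Plane, 1 - ∫⁻ b, G.indicator 1 (x, b) ∂(cond volume (Set.Icc (0 : ℝ) 1))
      = ∑ j, (Metric.ball (0 : Plane) (u j)).indicator
        (fun x => ENNReal.ofReal (p.linkProb j ‖x‖)) x := by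
    intro x
    have hprob : IsProbabilityMeasure (cond volume (Set.Icc (0 : ℝ) 1)) :=
      isProbabilityMeasure_markLaw p (.userBlock 0)
    have hm : ∀ j, MeasurableSet {b | p.linkType ‖x‖ b = j} := fun j =>
      (p.measurableSet_linkType_eq j).preimage (f := fun b : ℝ => (‖x‖, b)) (by fun_prop)
    have hGx : MeasurableSet {b | (x, b) ∈ G} := hGm.preimage measurable_prodMk_left
    have h1 : ∫⁻ b, G.indicator 1 (x, b) ∂(cond volume (Set.Icc (0 : ℝ) 1))
        = cond volume (Set.Icc (0 : ℝ) 1) {b | (x, b) ∈ G} := lintegral_indicator_one hGx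
    rw [h1, ← prob_compl_eq_one_sub hGx]
    -- The forbidden marks split according to the type they produce, so the exponent is a sum over
    -- the types; this is the source of the independence of the two nearest distances.
    have hdec : {b | (x, b) ∈ G}ᶜ
        = ⋃ j : LinkType, {b | p.linkType ‖x‖ b = j ∧ ‖x‖ < u j} := by
      ext b
      simp [hG]
    rw [hdec, measure_iUnion, tsum_fintype]
    · refine Finset.sum_congr rfl fun j _ => ?_
      by_cases hx : ‖x‖ < u j
      · rw [Set.indicator_of_mem (mem_ball_zero_iff.2 hx), ← p.uniform_linkType]
        simp [hx]
      · rw [Set.indicator_of_notMem (by rwa [mem_ball_zero_iff])]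
        simp [hx]
    · intro j j' hjj'
      rw [Function.onFun, Set.disjoint_left]
      rintro b ⟨rfl, _⟩ ⟨h, _⟩
      exact hjj' h
    · intro j
      by_cases hx : ‖x‖ < u j
      · simpa [hx] using hm j
      · simp [hx]
  have hΛ : ∫⁻ x, (1 - ∫⁻ b, G.indicator 1 (x, b) ∂(cond volume (Set.Icc (0 : ℝ) 1)))
      ∂(ENNReal.ofReal p.lamB • (volume : Measure Plane))
      = ENNReal.ofReal (∑ j, p.meanBS j (u j)) := by
    have hmeas : ∀ j, Measurable ((Metric.ball (0 : Plane) (u j)).indicator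
        (fun x => ENNReal.ofReal (p.linkProb j ‖x‖))) := by
      have := p.measurable_qLOS
      intro j
      refine Measurable.indicator ?_ measurableSet_ball
      cases j <;> simp only [Params.linkProb] <;> fun_prop
    simp_rw [hψ]
    rw [lintegral_finsetSum _ fun j _ => hmeas j,
      ENNReal.ofReal_sum_of_nonneg fun j _ => p.meanBS_nonneg j (hu j)]
    exact Finset.sum_congr rfl fun j _ => p.lintegral_linkProb_ball j (hu j)
  have h := net.bs_poisson.lintegral_pgf_marked (Y := fun i => net.mark (.userBlock i))
    (ν := cond volume (Set.Icc (0 : ℝ) 1)) (φ := fun x b => G.indicator 1 (x, b))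
    (fun i => net.mark_measurable _) hind hmark (fun i => (net.mark_law (.userBlock i)).map_eq)
    (measurable_one.indicator hGm) (fun x b => Set.indicator_le_self' (fun _ _ => zero_le) _)
    (by rw [hΛ]; exact ENNReal.ofReal_ne_top)
  rw [hΛ, ENNReal.toReal_ofReal (Finset.sum_nonneg fun j _ => p.meanBS_nonneg j (hu j))] at h
  rw [← h, ← lintegral_indicator_one hsetm]
  refine lintegral_congr fun ω => ?_
  rw [iInf_prod_indicator G fun i => (net.bs i ω, net.mark (.userBlock i) ω), hset]
  rfl

end Network

/-! ### Densities and independence of the nearest distances -/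

namespace Params

variable (p : Params)

lemma meanBS_zero (j : LinkType) : p.meanBS j 0 = 0 := by
  simp [p.meanBS_of_le j p.D_pos.le]

/-- The density of the distance to the nearest base station of type `j`. -/
def nearestDensity (j : LinkType) (r : ℝ) : ℝ :=
  2 * Real.pi * p.lamB * r * p.linkProb j r * Real.exp (-p.meanBS j r)

lemma nearestDensity_nonneg (j : LinkType) {r : ℝ} (hr : 0 ≤ r) : 0 ≤ p.nearestDensity j r := by
  have h1 := p.linkProb_nonneg j r
  have h2 := p.lamB_pos
  have h3 := Real.pi_pos
  unfold nearestDensity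
  positivity

lemma measurable_linkProb (j : LinkType) : Measurable (p.linkProb j) := by
  have := p.measurable_qLOS
  cases j
  · exact this
  · exact measurable_const.sub this

lemma continuous_meanBS (j : LinkType) : Continuous (p.meanBS j) := by
  unfold meanBS
  fun_prop

lemma measurable_nearestDensity (j : LinkType) : Measurable (p.nearestDensity j) := by
  have h1 := p.measurable_linkProb j
  have h2 := (p.continuous_meanBS j).measurable
  unfold nearestDensity
  fun_prop

lemma linkProb_le_one (j : LinkType) (r : ℝ) : p.linkProb j r ≤ 1 := by
  have h0 := p.qLOS_nonneg r
  have h1 := p.qLOS_le_one r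
  cases j
  · exact h1
  · simp only [linkProb]
    linarith

/-- The radius D is excluded because the type probabilities may jump there; one exceptional point is
harmless for the fundamental theorem of calculus. -/
lemma hasDerivAt_exp_meanBS (j : LinkType) {r : ℝ} (hr : r ≠ p.D) :
    HasDerivAt (fun r => -Real.exp (-p.meanBS j r)) (p.nearestDensity j r) r := by
  have hM : HasDerivAt (p.meanBS j) (2 * Real.pi * p.lamB * r * p.linkProb j r) r := by
    rcases lt_or_gt_of_ne hr with h | h
    · have h1 : HasDerivAt (fun u : ℝ => Real.pi * p.lamB * (p.q j * u ^ 2))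
          (2 * Real.pi * p.lamB * r * p.linkProb j r) r := by
        have := (((hasDerivAt_pow 2 r).const_mul (p.q j))).const_mul (Real.pi * p.lamB)
        rw [p.linkProb_of_le j h.le]
        convert! this using 1
        push_cast
        ring
      refine h1.congr_of_eventuallyEq ?_
      filter_upwards [eventually_lt_nhds h] with u hu
      exact p.meanBS_of_le j hu.le
    · have h1 : HasDerivAt (fun u : ℝ => Real.pi * p.lamB *
          (p.q j * p.D ^ 2 + qFar j * (u ^ 2 - p.D ^ 2)))
          (2 * Real.pi * p.lamB * r * p.linkProb j r) r := by
        have := ((((hasDerivAt_pow 2 r).sub_const (p.D ^ 2)).const_mul (qFar j)).const_add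
          (p.q j * p.D ^ 2)).const_mul (Real.pi * p.lamB)
        rw [p.linkProb_eq j, if_neg (not_le.2 h)]
        convert! this using 1
        push_cast
        ring
      refine h1.congr_of_eventuallyEq ?_
      filter_upwards [eventually_gt_nhds h] with u hu
      exact p.meanBS_of_ge j hu.le
  have := hM.neg.exp.neg
  convert! this using 1
  simp only [nearestDensity, Pi.neg_apply]
  ring

lemma intervalIntegrable_nearestDensity (j : LinkType) (a b : ℝ) :
    IntervalIntegrable (p.nearestDensity j) volume a b := by
  have hc : Continuous fun r => 2 * Real.pi * p.lamB * r * Real.exp (-p.meanBS j r) := by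
    have := p.continuous_meanBS j
    fun_prop
  refine (hc.intervalIntegrable a b).mono_fun (p.measurable_nearestDensity j).aestronglyMeasurable
    (ae_of_all _ fun r => ?_)
  have h1 := p.linkProb_nonneg j r
  have h2 := p.linkProb_le_one j r
  simp only [nearestDensity]
  rw [mul_right_comm, norm_mul]
  refine mul_le_of_le_one_right (norm_nonneg _) ?_
  rw [Real.norm_of_nonneg h1]
  exact h2

lemma lintegral_nearestDensity (j : LinkType) {a b : ℝ} (ha : 0 ≤ a) (hab : a ≤ b) :
    ∫⁻ r in Set.Ico a b, ENNReal.ofReal (p.nearestDensity j r)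
      = ENNReal.ofReal (Real.exp (-p.meanBS j a) - Real.exp (-p.meanBS j b)) := by
  have hi := p.intervalIntegrable_nearestDensity j a b
  have hint := MeasureTheory.integral_eq_of_hasDerivAt_off_countable_of_le
    (fun r => -Real.exp (-p.meanBS j r)) (p.nearestDensity j) hab (Set.countable_singleton p.D)
    (by
      have := p.continuous_meanBS j
      fun_prop) (fun r hr => p.hasDerivAt_exp_meanBS j hr.2) hi
  rw [setLIntegral_congr Ico_ae_eq_Ioc, ← ofReal_integral_eq_lintegral_ofReal
    ((intervalIntegrable_iff_integrableOn_Ioc_of_le hab).1 hi), ← intervalIntegral.integral_of_le hab,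
    hint]
  · congr 1
    ring
  · filter_upwards [ae_restrict_mem measurableSet_Ioc] with r hr
    exact p.nearestDensity_nonneg j (ha.trans hr.1.le)

end Params

/-- The survival functions are known at finite thresholds only. These suffice, since {∞} is a
countable intersection of half-lines with finite endpoints. -/
lemma ENNReal.borel_eq_generateFrom_Ici_ofReal :
    ENNReal.measurableSpace
      = MeasurableSpace.generateFrom {s | ∃ u : ℝ, 0 ≤ u ∧ Set.Ici (ENNReal.ofReal u) = s} := by
  refine le_antisymm ?_ (MeasurableSpace.generateFrom_le ?_)
  · rw [BorelSpace.measurable_eq (α := ℝ≥0∞), borel_eq_generateFrom_Ici]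
    refine MeasurableSpace.generateFrom_le ?_
    rintro _ ⟨u, rfl⟩
    have hbase : ∀ u : ℝ, 0 ≤ u → MeasurableSet[MeasurableSpace.generateFrom
        {s | ∃ u : ℝ, 0 ≤ u ∧ Set.Ici (ENNReal.ofReal u) = s}] (Set.Ici (ENNReal.ofReal u)) :=
      fun u hu => MeasurableSpace.measurableSet_generateFrom ⟨u, hu, rfl⟩
    rcases eq_or_ne u ∞ with rfl | hu
    · have : Set.Ici (∞ : ℝ≥0∞) = ⋂ n : ℕ, Set.Ici (ENNReal.ofReal n) := by
        ext x
        simp only [Set.Ici_top, Set.mem_singleton_iff, Set.mem_iInter, Set.mem_Ici,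
          ENNReal.ofReal_natCast]
        exact ⟨fun h n => h ▸ le_top, fun h => ENNReal.eq_top_of_forall_nnreal_le fun r =>
          (ENNReal.coe_le_coe.2 (Nat.le_ceil r)).trans (by simpa using h ⌈r⌉₊)⟩
      rw [this]
      exact MeasurableSet.iInter fun n => hbase n (Nat.cast_nonneg n)
    · rw [← ENNReal.ofReal_toReal hu]
      exact hbase _ ENNReal.toReal_nonneg
  · rintro _ ⟨u, _, rfl⟩
    exact measurableSet_Ici

namespace Network

variable {p : Params} {Ω : Type*} [MeasurableSpace Ω] {P : Measure Ω} (net : Network p P)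

/-- A threshold 0 imposes nothing on the other type, and `meanBS` vanishes there. -/
lemma measure_le_nearest_single [IsProbabilityMeasure P] (j : LinkType) {u : ℝ} (hu : 0 ≤ u) :
    P {ω | ENNReal.ofReal u ≤ net.nearest j ω} = ENNReal.ofReal (Real.exp (-p.meanBS j u)) := by
  have h := net.measure_le_nearest (u := Function.update (fun _ => (0 : ℝ)) j u) (fun j' => by
    by_cases hj : j' = j
    · subst hj
      simpa using hu
    · simp [hj])
  have hs : {ω | ∀ j', ENNReal.ofReal (Function.update (fun _ => (0 : ℝ)) j u j') ≤ net.nearest j' ω}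
      = {ω | ENNReal.ofReal u ≤ net.nearest j ω} := by
    ext ω
    simp only [Set.mem_ofPred_eq]
    refine ⟨fun h => by simpa using h j, fun h j' => ?_⟩
    by_cases hj : j' = j
    · subst hj
      simpa using h
    · simp [hj]
  rw [hs, Finset.sum_eq_single j] at h
  · simpa using h
  · intro j' _ hj
    simp [hj, p.meanBS_zero]
  · simp

/-- The joint survival function is the product of the marginal ones, and the half-lines form a
π-system generating the Borel sets. -/
lemma indepFun_nearest [IsProbabilityMeasure P] (j : LinkType) :
    IndepFun (net.nearest j) (net.nearest j.other) P := by
  have hpi : IsPiSystem {s : Set ℝ≥0∞ | ∃ u : ℝ, 0 ≤ u ∧ Set.Ici (ENNReal.ofReal u) = s} := by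
    rintro _ ⟨u, hu, rfl⟩ _ ⟨v, hv, rfl⟩ _
    refine ⟨max u v, le_max_of_le_left hu, ?_⟩
    rw [Set.Ici_inter_Ici, ENNReal.ofReal_max]
  rw [IndepFun_iff_Indep]
  refine IndepSets.indep (net.measurable_nearest _).comap_le (net.measurable_nearest _).comap_le
    (hpi.comap (net.nearest j)) (hpi.comap (net.nearest j.other)) ?_ ?_ ?_
  · rw [ENNReal.borel_eq_generateFrom_Ici_ofReal, MeasurableSpace.comap_generateFrom]
    rfl
  · rw [ENNReal.borel_eq_generateFrom_Ici_ofReal, MeasurableSpace.comap_generateFrom]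
    rfl
  · rw [IndepSets_iff]
    rintro _ _ ⟨_, ⟨u, hu, rfl⟩, rfl⟩ ⟨_, ⟨v, hv, rfl⟩, rfl⟩
    have e1 : ∀ j u, net.nearest j ⁻¹' Set.Ici (ENNReal.ofReal u)
        = {ω | ENNReal.ofReal u ≤ net.nearest j ω} := fun _ _ => rfl
    simp only [e1]
    rw [net.measure_le_nearest_single _ hu, net.measure_le_nearest_single _ hv,
      ← ENNReal.ofReal_mul (Real.exp_pos _).le, ← Real.exp_add]
    cases j
    · have h := net.measure_le_nearest (u := fun | los => u | nlos => v) (fun j => by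
        cases j <;> assumption)
      rw [sum_linkType, neg_add] at h
      rw [other, ← h]
      congr 1
      ext ω
      exact ⟨fun h j => by cases j; exacts [h.1, h.2], fun h => ⟨h los, h nlos⟩⟩
    · have h := net.measure_le_nearest (u := fun | los => v | nlos => u) (fun j => by
        cases j <;> assumption)
      rw [sum_linkType, neg_add, add_comm] at h
      rw [other, ← h]
      congr 1
      ext ω
      exact ⟨fun h j => by cases j; exacts [h.2, h.1], fun h => ⟨h nlos, h los⟩⟩

/-- The law of the distance to the nearest base station of type `j`, if there is one. -/
lemma map_nearest [IsProbabilityMeasure P] (j : LinkType) :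
    (P.restrict {ω | net.nearest j ω ≠ ∞}).map (fun ω => (net.nearest j ω).toReal)
      = (volume.restrict (Set.Ioi 0)).withDensity
        fun r => ENNReal.ofReal (p.nearestDensity j r) := by
  have hm : Measurable fun ω => (net.nearest j ω).toReal := (net.measurable_nearest j).ennreal_toReal
  have hfin : IsFiniteMeasure
      ((P.restrict {ω | net.nearest j ω ≠ ∞}).map (fun ω => (net.nearest j ω).toReal)) :=
    Measure.isFiniteMeasure_map _ _
  refine Measure.ext_of_Ico _ _ fun a b hab => ?_
  rw [Measure.map_apply hm measurableSet_Ico, Measure.restrict_apply (hm measurableSet_Ico),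
    withDensity_apply _ measurableSet_Ico, Measure.restrict_restrict measurableSet_Ico]
  rcases le_or_gt b 0 with hb | hb
  · have h1 : (fun ω => (net.nearest j ω).toReal) ⁻¹' Set.Ico a b = ∅ := by
      ext ω
      simp only [Set.mem_preimage, Set.mem_Ico, Set.mem_empty_iff_false, iff_false, not_and, not_lt]
      exact fun _ => hb.trans ENNReal.toReal_nonneg
    have h2 : Set.Ico a b ∩ Set.Ioi 0 = ∅ := by
      ext r
      simp only [Set.mem_inter_iff, Set.mem_Ico, Set.mem_Ioi, Set.mem_empty_iff_false, iff_false]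
      intro h
      linarith [h.1.2, h.2]
    simp [h1, h2]
  · set c := max a 0 with hc
    have hc0 : 0 ≤ c := le_max_right _ _
    have hcb : c ≤ b := max_le hab.le hb.le
    have h1 : (fun ω => (net.nearest j ω).toReal) ⁻¹' Set.Ico a b ∩ {ω | net.nearest j ω ≠ ∞}
        = {ω | ENNReal.ofReal c ≤ net.nearest j ω} \ {ω | ENNReal.ofReal b ≤ net.nearest j ω} := by
      ext ω
      simp only [Set.mem_inter_iff, Set.mem_preimage, Set.mem_Ico, Set.mem_ofPred_eq, Set.mem_sdiff,
        not_le]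
      constructor
      · rintro ⟨⟨h1, h2⟩, h3⟩
        exact ⟨ENNReal.ofReal_le_of_le_toReal (max_le h1 ENNReal.toReal_nonneg),
          (ENNReal.lt_ofReal_iff_toReal_lt h3).2 h2⟩
      · rintro ⟨h1, h2⟩
        have h3 : net.nearest j ω ≠ ∞ := h2.ne_top
        exact ⟨⟨(le_max_left a 0).trans ((ENNReal.ofReal_le_iff_le_toReal h3).1 h1),
          (ENNReal.lt_ofReal_iff_toReal_lt h3).1 h2⟩, h3⟩
    have h2 : (Set.Ico a b ∩ Set.Ioi 0 : Set ℝ) =ᵐ[volume] Set.Ico c b := by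
      have : Set.Ico c b = Set.Ico a b ∩ Set.Ici 0 := by
        ext r
        simp only [Set.mem_Ico, Set.mem_inter_iff, Set.mem_Ici, hc, max_le_iff]
        tauto
      rw [this]
      exact Filter.EventuallyEq.inter (Filter.EventuallyEq.refl _ _) Ioi_ae_eq_Ici
    rw [h1, setLIntegral_congr h2, p.lintegral_nearestDensity j hc0 hcb, measure_sdiff,
      net.measure_le_nearest_single j hc0, net.measure_le_nearest_single j hb.le,
      ENNReal.ofReal_sub _ (Real.exp_pos _).le]
    · intro ω hω
      exact (ENNReal.ofReal_le_ofReal hcb).trans hω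
    · exact (measurableSet_le measurable_const (net.measurable_nearest j)).nullMeasurableSet
    · exact measure_ne_top _ _

lemma measure_nearest_eq_ofReal [IsProbabilityMeasure P] (j : LinkType) (u : ℝ) :
    P {ω | net.nearest j ω = ENNReal.ofReal u} = 0 := by
  have hm : Measurable fun ω => (net.nearest j ω).toReal := (net.measurable_nearest j).ennreal_toReal
  have h : ((P.restrict {ω | net.nearest j ω ≠ ∞}).map (fun ω => (net.nearest j ω).toReal))
      {(ENNReal.ofReal u).toReal} = 0 := by
    rw [net.map_nearest j]
    exact measure_singleton _
  rw [Measure.map_apply hm (measurableSet_singleton _),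
    Measure.restrict_apply (hm (measurableSet_singleton _))] at h
  refine measure_mono_null ?_ h
  intro ω hω
  have hω' : net.nearest j ω = ENNReal.ofReal u := hω
  simp [hω']

lemma measure_lt_nearest [IsProbabilityMeasure P] (j : LinkType) {u : ℝ} (hu : 0 ≤ u) :
    P {ω | ENNReal.ofReal u < net.nearest j ω} = ENNReal.ofReal (Real.exp (-p.meanBS j u)) := by
  rw [← net.measure_le_nearest_single j hu]
  refine measure_congr ?_
  have h : ∀ᵐ ω ∂P, net.nearest j ω ≠ ENNReal.ofReal u :=
    measure_eq_zero_iff_ae_notMem.1 (net.measure_nearest_eq_ofReal j u)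
  filter_upwards [h] with ω hω
  exact propext ⟨fun h => le_of_lt h, fun h => lt_of_le_of_ne h (Ne.symm hω)⟩

end Network

/-! ### Association thresholds and the closed-form densities -/

namespace Params

variable (p : Params)

/-- A link of the other type beats a link of type `j` and length `r` when it is shorter than
`thr j r`. -/
def thr (j : LinkType) (r : ℝ) : ℝ :=
  (p.K j.other / p.K j) ^ (1 / p.α j.other) * r ^ (p.α j / p.α j.other)

lemma thr_nonneg (j : LinkType) {r : ℝ} (hr : 0 ≤ r) : 0 ≤ p.thr j r := by
  have h1 := p.K_pos j
  have h2 := p.K_pos j.other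
  unfold thr
  positivity

lemma measurable_thr (j : LinkType) : Measurable (p.thr j) := by
  unfold thr
  fun_prop

lemma thr_rpow (j : LinkType) {r : ℝ} (hr : 0 ≤ r) (c : ℝ) :
    p.thr j r ^ c = (p.K j.other / p.K j) ^ (c / p.α j.other)
      * r ^ (c * p.α j / p.α j.other) := by
  have h1 := p.K_pos j
  have h2 := p.K_pos j.other
  rw [thr, Real.mul_rpow (by positivity) (by positivity), ← Real.rpow_mul (by positivity),
    ← Real.rpow_mul hr]
  congr 2
  · ring
  · ring

lemma thr_sq (j : LinkType) {r : ℝ} (hr : 0 ≤ r) :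
    p.thr j r ^ 2 = (p.K j.other / p.K j) ^ (2 / p.α j.other)
      * r ^ (2 * p.α j / p.α j.other) := by
  rw [← Real.rpow_two, p.thr_rpow j hr]

lemma le_thr_iff (j : LinkType) {r r' : ℝ} (hr : 0 < r) (hr' : 0 < r') :
    r' ≤ p.thr j r ↔ p.pathLoss j r ≤ p.pathLoss j.other r' := by
  have h1 := p.K_pos j
  have h2 := p.K_pos j.other
  have h3 := p.α_pos j.other
  rw [← Real.rpow_le_rpow_iff hr'.le (p.thr_nonneg j hr.le) h3, p.thr_rpow j hr.le,
    div_self h3.ne', Real.rpow_one, mul_comm (p.α j.other), mul_div_assoc, div_self h3.ne', mul_one,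
    pathLoss, pathLoss, Real.rpow_neg hr.le, Real.rpow_neg hr'.le, ← div_eq_mul_inv,
    ← div_eq_mul_inv, div_le_div_iff₀ (by positivity) (by positivity), div_mul_eq_mul_div,
    le_div_iff₀ h1, mul_comm (p.K j)]

lemma thr_le_iff (j : LinkType) {r r' : ℝ} (hr : 0 < r) (hr' : 0 < r') :
    p.thr j r ≤ r' ↔ p.pathLoss j.other r' ≤ p.pathLoss j r := by
  have h1 := p.K_pos j
  have h2 := p.K_pos j.other
  have h3 := p.α_pos j.other
  rw [← Real.rpow_le_rpow_iff (p.thr_nonneg j hr.le) hr'.le h3, p.thr_rpow j hr.le,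
    div_self h3.ne', Real.rpow_one, mul_comm (p.α j.other), mul_div_assoc, div_self h3.ne', mul_one,
    pathLoss, pathLoss, Real.rpow_neg hr.le, Real.rpow_neg hr'.le, ← div_eq_mul_inv,
    ← div_eq_mul_inv, div_le_div_iff₀ (by positivity) (by positivity), div_mul_eq_mul_div,
    div_le_iff₀ h1, mul_comm (p.K j)]

/-- This is where `nlos_le_los` enters: when the best LOS station is within D, only NLOS stations
within D can compete, so `meanBS` is needed only in its regime of radii at most D. -/
lemma thr_los_le {r : ℝ} (hr : 0 < r) (hrD : r ≤ p.D) : p.thr los r ≤ p.D := by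
  have h1 : p.thr los r ≤ p.thr los p.D := by
    have h1 := p.K_pos los
    have h2 := p.K_pos nlos
    have h3 := p.α_pos los
    have h4 := p.α_pos nlos
    unfold thr other
    gcongr
  exact h1.trans ((p.thr_le_iff los p.D_pos p.D_pos).2 p.nlos_le_los)

/-- The two threshold maps are inverse to each other. The right-hand radius is the cutoff μ of the
theorem. -/
lemma thr_nlos_le_iff {r : ℝ} (hr : 0 < r) : p.thr nlos r ≤ p.D ↔ r ≤ p.thr los p.D := by
  rw [p.thr_le_iff nlos hr p.D_pos, p.le_thr_iff los p.D_pos hr]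
  rfl

/-- The density of the distance to the serving base station on the event that it is of type
`j`. -/
def servedDensity (j : LinkType) (r : ℝ) : ℝ :=
  p.nearestDensity j r * Real.exp (-p.meanBS j.other (p.thr j r))

lemma servedDensity_nonneg (j : LinkType) {r : ℝ} (hr : 0 ≤ r) : 0 ≤ p.servedDensity j r :=
  mul_nonneg (p.nearestDensity_nonneg j hr) (Real.exp_pos _).le

lemma measurable_servedDensity (j : LinkType) : Measurable (p.servedDensity j) :=
  (p.measurable_nearestDensity j).mul
    (Real.measurable_exp.comp (f := fun r => -p.meanBS j.other (p.thr j r))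
      (((p.continuous_meanBS j.other).measurable.comp (p.measurable_thr j)).neg))

lemma distPdf_los_eq {r : ℝ} (hr : 0 < r) :
    p.distPdf los r = p.servedDensity los r / p.assoc los := by
  simp only [distPdf, servedDensity, nearestDensity, p.linkProb_eq]
  by_cases h : r ≤ p.D
  · rw [Set.indicator_of_mem (show r ∈ Set.Icc 0 p.D from ⟨hr.le, h⟩), if_pos h,
      p.meanBS_of_le los h, other, p.meanBS_of_le nlos (p.thr_los_le hr h)]
    have h2 := p.thr_sq los hr.le
    simp only [other] at h2
    rw [h2]
    simp only [q]
    ring_nf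
  · rw [Set.indicator_of_notMem (fun h' => h h'.2), if_neg h]
    simp [qFar]

/-- The part of the density of the serving distance that is due to NLOS base stations serving the
user despite the presence of an LOS base station. -/
def excessDensity (r : ℝ) : ℝ :=
  2 * Real.pi * (1 - p.C) * p.lamB * r * Real.exp (-((1 - p.C) * p.lamB * Real.pi * r ^ 2))
    * (Real.exp (-(p.C * p.lamB * Real.pi * (p.K los / p.K nlos) ^ (2 / p.α los)
        * r ^ (2 * p.α nlos / p.α los)))
      - Real.exp (-(p.C * p.lamB * Real.pi * p.D ^ 2)))

lemma continuous_excessDensity : Continuous p.excessDensity := by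
  have hαL := p.α_pos los
  have hαN := p.α_pos nlos
  have : Continuous fun r : ℝ => r ^ (2 * p.α nlos / p.α los) :=
    Real.continuous_rpow_const (by positivity)
  unfold excessDensity
  fun_prop

lemma excessDensity_nonneg {r : ℝ} (hr : r ∈ Set.Ioc 0 (p.thr los p.D)) :
    0 ≤ p.excessDensity r := by
  have hC := p.C_nonneg
  have hlam := p.lamB_pos
  have hπ := Real.pi_pos
  have hC1 : 0 ≤ 1 - p.C := sub_nonneg.2 p.C_le_one
  have h1 := p.thr_sq nlos hr.1.le
  simp only [other] at h1
  have h2 : p.thr nlos r ^ 2 ≤ p.D ^ 2 :=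
    pow_le_pow_left₀ (p.thr_nonneg nlos hr.1.le) ((p.thr_nlos_le_iff hr.1).2 hr.2) 2
  rw [h1] at h2
  have hr0 := hr.1
  refine mul_nonneg (by positivity) (sub_nonneg.2 (Real.exp_le_exp.2 (neg_le_neg ?_)))
  rw [mul_assoc _ (_ ^ _) (_ ^ _)]
  gcongr

/-- The first term accounts for an LOS ball without LOS stations. The excess occurs when the
threshold radius is below D, where LOS stations may exist but must lie beyond the threshold. -/
lemma servedDensity_nlos_eq {r : ℝ} (hr : 0 < r) :
    p.servedDensity nlos r
      = p.nearestDensity nlos r * Real.exp (-(p.C * p.lamB * Real.pi * p.D ^ 2))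
        + if r ≤ p.thr los p.D then
          p.excessDensity r else 0 := by
  simp only [servedDensity, other]
  split_ifs with h
  · have hrD : r ≤ p.D := h.trans (p.thr_los_le p.D_pos le_rfl)
    have h2 := p.thr_sq nlos hr.le
    simp only [other] at h2
    rw [p.meanBS_of_le los ((p.thr_nlos_le_iff hr).2 h), nearestDensity, p.meanBS_of_le nlos hrD,
      p.linkProb_of_le nlos hrD, h2]
    simp only [q, excessDensity]
    ring_nf
  · have h3 : p.D ≤ p.thr nlos r := (not_le.1 fun h' => h ((p.thr_nlos_le_iff hr).1 h')).le
    rw [p.meanBS_of_ge los h3]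
    simp only [q, qFar]
    ring_nf

/-- At r = D both indicators in `distPdf` equal 1, so the formulas are compared away from that
point. -/
lemma distPdf_nlos_eq {r : ℝ} (hr : 0 < r) (hrD : r ≠ p.D) :
    p.distPdf nlos r = p.servedDensity nlos r / p.assoc nlos := by
  have hbase : p.nearestDensity nlos r * Real.exp (-(p.C * p.lamB * Real.pi * p.D ^ 2))
      = 2 * Real.pi * p.lamB * r * Real.exp (-(Real.pi * p.lamB * r ^ 2))
        * ((1 - p.C) * Real.exp (Real.pi * p.C * p.lamB * (r ^ 2 - p.D ^ 2))
            * (if r ≤ p.D then 1 else 0)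
          + (if p.D ≤ r then 1 else 0)) := by
    rw [nearestDensity, p.linkProb_eq]
    rcases lt_or_gt_of_ne hrD with h | h
    · rw [if_pos h.le, if_pos h.le, if_neg (not_le.2 h), p.meanBS_of_le nlos h.le, mul_assoc,
        ← Real.exp_add, mul_one, add_zero]
      have : Real.exp (-(Real.pi * p.lamB * (p.q nlos * r ^ 2))
            + -(p.C * p.lamB * Real.pi * p.D ^ 2))
          = Real.exp (-(Real.pi * p.lamB * r ^ 2))
            * Real.exp (Real.pi * p.C * p.lamB * (r ^ 2 - p.D ^ 2)) := by
        rw [← Real.exp_add]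
        congr 1
        simp only [q]
        ring
      rw [this]
      simp only [q]
      ring
    · rw [if_neg (not_le.2 h), if_neg (not_le.2 h), if_pos h.le, p.meanBS_of_ge nlos h.le,
        mul_assoc, ← Real.exp_add]
      simp only [q, qFar]
      ring_nf
  rw [p.servedDensity_nlos_eq hr, hbase]
  have hμ : (p.K nlos / p.K los) ^ (1 / p.α nlos) * p.D ^ (p.α los / p.α nlos)
      = p.thr los p.D := rfl
  simp only [distPdf, hμ, excessDensity]
  by_cases h : r ≤ p.thr los p.D
  · simp only [if_pos h]
    ring
  · simp only [if_neg h]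
    ring

lemma assocNLOS_eq : p.assocNLOS
    = (∫ r in Set.Ioc 0 (p.thr los p.D),
        p.excessDensity r)
      + Real.exp (-(p.C * p.lamB * Real.pi * p.D ^ 2)) := by
  have h1 := p.K_pos los
  have h2 := p.K_pos nlos
  have hμ : (p.K los / p.K nlos) ^ (-(1 / p.α nlos)) * p.D ^ (p.α los / p.α nlos)
      = p.thr los p.D := by
    rw [thr, other, Real.rpow_neg (by positivity), ← Real.inv_rpow (by positivity), inv_div]
  rw [assocNLOS, hμ, intervalIntegral.integral_of_le (p.thr_nonneg los p.D_pos.le)]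
  congr 1
  · refine integral_congr_ae (ae_of_all _ fun r => ?_)
    simp only [excessDensity]
    ring_nf
  · ring_nf

lemma assocNLOS_pos : 0 < p.assocNLOS := by
  rw [p.assocNLOS_eq]
  exact add_pos_of_nonneg_of_pos
    (setIntegral_nonneg measurableSet_Ioc fun r hr => p.excessDensity_nonneg hr) (Real.exp_pos _)

lemma ae_distPdf_eq (j : LinkType) : ∀ᵐ r ∂volume.restrict (Set.Ioi (0 : ℝ)),
    p.distPdf j r = p.servedDensity j r / p.assoc j := by
  have h : ∀ᵐ r : ℝ ∂volume.restrict (Set.Ioi (0 : ℝ)), r ≠ p.D :=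
    ae_restrict_of_ae (measure_eq_zero_iff_ae_notMem.1 (measure_singleton p.D))
  filter_upwards [h, ae_restrict_mem measurableSet_Ioi] with r hr hr0
  cases j
  · exact p.distPdf_los_eq hr0
  · exact p.distPdf_nlos_eq hr0 hr

end Params

/-- Fubini with the second variable redrawn on a copy of Ω. The integrals below use it to freeze one
variable and average over the other. -/
lemma lintegral_indepFun_pair {Ω E F : Type*} [MeasurableSpace Ω] [MeasurableSpace E]
    [MeasurableSpace F] {P : Measure Ω} [IsProbabilityMeasure P] {X : Ω → E} {Y : Ω → F}
    (hX : Measurable X) (hY : Measurable Y) (h : IndepFun X Y P) {φ : E × F → ℝ≥0∞}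
    (hφ : Measurable φ) :
    ∫⁻ ω, φ (X ω, Y ω) ∂P = ∫⁻ ω, ∫⁻ ω', φ (X ω, Y ω') ∂P ∂P := by
  have h1 := (indepFun_iff_map_prod_eq_prod_map_map hX.aemeasurable hY.aemeasurable).1 h
  have := Measure.isProbabilityMeasure_map (μ := P) hX.aemeasurable
  have := Measure.isProbabilityMeasure_map (μ := P) hY.aemeasurable
  rw [← lintegral_map hφ (hX.prodMk hY), h1, lintegral_prod _ hφ.aemeasurable,
    lintegral_map hφ.lintegral_prod_right' hX]
  exact lintegral_congr fun ω => lintegral_map (hφ.comp measurable_prodMk_left) hY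

/-! ### The serving base station and the association probabilities -/

namespace Network

variable {p : Params} {Ω : Type*} [MeasurableSpace Ω] {P : Measure Ω} (net : Network p P)

/-- The event that the nearest base station of type `j` beats all those of the other type. -/
def served (j : LinkType) : Set Ω :=
  {ω | net.nearest j ω ≠ ∞
    ∧ ENNReal.ofReal (p.thr j (net.nearest j ω).toReal) < net.nearest j.other ω}

lemma measurableSet_served (j : LinkType) : MeasurableSet (net.served j) := by
  have h1 := net.measurable_nearest
  have h2 := p.measurable_thr j
  refine MeasurableSet.inter ((h1 j) (measurableSet_singleton ∞).compl) ?_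
  exact measurableSet_lt (h2.comp (h1 j).ennreal_toReal).ennreal_ofReal (h1 _)

/-- With the nearest distance of type j frozen at r, independence makes the other type lie beyond
the threshold with probability exp(-meanBS(thr j r)). This factor turns `nearestDensity` into
`servedDensity`. -/
lemma lintegral_served [IsProbabilityMeasure P] (j : LinkType) {f : ℝ → ℝ≥0∞}
    (hf : Measurable f) :
    ∫⁻ ω in net.served j, f (net.nearest j ω).toReal ∂P
      = ∫⁻ r in Set.Ioi (0 : ℝ), ENNReal.ofReal (p.servedDensity j r) * f r := by
  have hn := net.measurable_nearest
  have ht := p.measurable_thr j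
  set S : Set (ℝ≥0∞ × ℝ≥0∞) := {q | q.1 ≠ ∞ ∧ ENNReal.ofReal (p.thr j q.1.toReal) < q.2} with hS
  have hSm : MeasurableSet S :=
    (measurable_fst (measurableSet_singleton ∞).compl).inter
      (measurableSet_lt (ht.comp measurable_fst.ennreal_toReal).ennreal_ofReal measurable_snd)
  have hφ : Measurable (S.indicator fun q => f q.1.toReal) :=
    (hf.comp measurable_fst.ennreal_toReal).indicator hSm
  set h : ℝ → ℝ≥0∞ := fun r => ENNReal.ofReal (Real.exp (-p.meanBS j.other (p.thr j r))) * f r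
    with hh
  have hhm : Measurable h := by
    have := (p.continuous_meanBS j.other).measurable
    fun_prop
  have hmeas : MeasurableSet {ω | net.nearest j ω ≠ ∞} := hn j (measurableSet_singleton ∞).compl
  have e1 : ∫⁻ ω in net.served j, f (net.nearest j ω).toReal ∂P
      = ∫⁻ ω, S.indicator (fun q => f q.1.toReal) (net.nearest j ω, net.nearest j.other ω) ∂P := by
    rw [← lintegral_indicator (net.measurableSet_served j)]
    rfl
  have e2 : ∀ ω, ∫⁻ ω', S.indicator (fun q => f q.1.toReal)
        (net.nearest j ω, net.nearest j.other ω') ∂P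
      = {ω | net.nearest j ω ≠ ∞}.indicator (fun ω => h (net.nearest j ω).toReal) ω := by
    intro ω
    by_cases hω : net.nearest j ω ≠ ∞
    · rw [Set.indicator_of_mem (show ω ∈ {ω | net.nearest j ω ≠ ∞} from hω), hh]
      simp only
      rw [← net.measure_lt_nearest j.other (p.thr_nonneg j ENNReal.toReal_nonneg), mul_comm,
        ← lintegral_indicator_const (measurableSet_lt measurable_const (hn _))]
      refine lintegral_congr fun ω' => ?_
      simp only [Set.indicator_apply, hS, Set.mem_ofPred_eq, hω, ne_eq, not_false_eq_true,
        true_and]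
    · rw [Set.indicator_of_notMem (show ω ∉ {ω | net.nearest j ω ≠ ∞} from hω)]
      rw [lintegral_congr (g := fun _ => 0), lintegral_zero]
      intro ω'
      exact Set.indicator_of_notMem (fun h => hω h.1) _
  rw [e1, lintegral_indepFun_pair (hn j) (hn j.other) (net.indepFun_nearest j) hφ,
    lintegral_congr e2, lintegral_indicator hmeas,
    ← lintegral_map hhm (hn j).ennreal_toReal, net.map_nearest j,
    lintegral_withDensity_eq_lintegral_mul _ (p.measurable_nearestDensity j).ennreal_ofReal hhm]
  refine setLIntegral_congr_fun measurableSet_Ioi fun r hr => ?_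
  simp only [Pi.mul_apply, hh, Params.servedDensity]
  rw [ENNReal.ofReal_mul (p.nearestDensity_nonneg j (le_of_lt hr)), mul_assoc]

/-- Almost surely the best base stations of the two types are not equally good. -/
lemma ae_nearest_ne_thr [IsProbabilityMeasure P] (j : LinkType) :
    ∀ᵐ ω ∂P, net.nearest j.other ω ≠ ENNReal.ofReal (p.thr j (net.nearest j ω).toReal) := by
  have hn := net.measurable_nearest
  have ht := p.measurable_thr j
  set S : Set (ℝ≥0∞ × ℝ≥0∞) := {q | q.2 = ENNReal.ofReal (p.thr j q.1.toReal)} with hS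
  have hSm : MeasurableSet S :=
    measurableSet_eq_fun measurable_snd (ht.comp measurable_fst.ennreal_toReal).ennreal_ofReal
  have h := lintegral_indepFun_pair (hn j) (hn j.other) (net.indepFun_nearest j)
    (measurable_one.indicator hSm)
  have h0 : ∀ ω, ∫⁻ ω', S.indicator 1 (net.nearest j ω, net.nearest j.other ω') ∂P = 0 := by
    intro ω
    rw [← net.measure_nearest_eq_ofReal j.other (p.thr j (net.nearest j ω).toReal),
      ← lintegral_indicator_one (show MeasurableSet {ω' | net.nearest j.other ω' = _} from
        hn _ (measurableSet_singleton _))]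
    rfl
  rw [lintegral_congr h0, lintegral_zero] at h
  have hA : MeasurableSet {ω | (net.nearest j ω, net.nearest j.other ω) ∈ S} :=
    ((hn j).prodMk (hn j.other)) hSm
  have h' : P {ω | (net.nearest j ω, net.nearest j.other ω) ∈ S} = 0 := by
    rw [← h, ← lintegral_indicator_one hA]
    rfl
  exact measure_eq_zero_iff_ae_notMem.1 h'

/-- A station at the origin would make some nearest distance 0, a null event. It has to be excluded
because `rpow` assigns path loss 0 to distance 0. -/
lemma ae_norm_bs_pos [IsProbabilityMeasure P] : ∀ᵐ ω ∂P, ∀ i, 0 < ‖net.bs i ω‖ := by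
  have h : ∀ j, ∀ᵐ ω ∂P, net.nearest j ω ≠ ENNReal.ofReal 0 := fun j =>
    measure_eq_zero_iff_ae_notMem.1 (net.measure_nearest_eq_ofReal j 0)
  filter_upwards [ae_all_iff.2 h] with ω hω i
  have h1 := (net.le_nearest_iff (net.userLink i ω) ω _).1 le_rfl i rfl
  have h2 := hω (net.userLink i ω)
  rw [ENNReal.ofReal_zero] at h2
  rw [norm_pos_iff, ← enorm_ne_zero]
  exact ((pos_iff_ne_zero.2 h2).trans_le h1).ne'

lemma ae_finite_ball [IsProbabilityMeasure P] :
    ∀ᵐ ω ∂P, ∀ R : ℝ, {i | ‖net.bs i ω‖ ≤ R}.Finite := by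
  have h : ∀ n : ℕ, ∀ᵐ ω ∂P, {i | net.bs i ω ∈ Metric.closedBall (0 : Plane) n}.encard ≠ ⊤ :=
    fun n => net.bs_poisson.ae_count_ne_top measurableSet_closedBall (by
      rw [Measure.smul_apply, smul_eq_mul]
      exact ENNReal.mul_ne_top ENNReal.ofReal_ne_top measure_closedBall_lt_top.ne)
  filter_upwards [ae_all_iff.2 h] with ω hω R
  obtain ⟨n, hn⟩ := exists_nat_ge R
  refine (Set.encard_ne_top_iff.1 (hω n)).subset fun i hi => ?_
  exact mem_closedBall_zero_iff.2 (le_trans hi hn)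

/-- A station received at least as well as station 0 lies within a radius depending on its type. By
local finiteness there are finitely many of these, so a maximum exists. -/
lemma exists_isMax_userLoss {ω : Ω} (hpos : ∀ i, 0 < ‖net.bs i ω‖)
    (hfin : ∀ R : ℝ, {i | ‖net.bs i ω‖ ≤ R}.Finite) :
    ∃ i, ∀ k, net.userLoss k ω ≤ net.userLoss i ω := by
  have hS : {i | net.userLoss 0 ω ≤ net.userLoss i ω}.Finite := by
    have hc : 0 < net.userLoss 0 ω := mul_pos (p.K_pos _) (Real.rpow_pos_of_pos (hpos 0) _)
    have hsub : {i | net.userLoss 0 ω ≤ net.userLoss i ω}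
        ⊆ ⋃ j : LinkType, {i | ‖net.bs i ω‖ ≤ (p.K j / net.userLoss 0 ω) ^ (1 / p.α j)} := by
      intro i hi
      refine Set.mem_iUnion.2 ⟨net.userLink i ω, ?_⟩
      have hi' : net.userLoss 0 ω ≤ net.userLoss i ω := hi
      have hK := p.K_pos (net.userLink i ω)
      have hα := p.α_pos (net.userLink i ω)
      have hr := hpos i
      change ‖net.bs i ω‖ ≤ _
      rw [one_div, Real.le_rpow_inv_iff_of_pos hr.le (by positivity) hα, le_div_iff₀ hc]
      calc ‖net.bs i ω‖ ^ p.α (net.userLink i ω) * net.userLoss 0 ω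
          ≤ ‖net.bs i ω‖ ^ p.α (net.userLink i ω) * net.userLoss i ω := by gcongr
        _ = p.K (net.userLink i ω) := by
          rw [userLoss, Params.pathLoss, mul_left_comm, ← Real.rpow_add hr, add_neg_cancel,
            Real.rpow_zero, mul_one]
    exact (Set.finite_iUnion fun j => hfin _).subset hsub
  obtain ⟨i, hi, hmax⟩ := Set.exists_max_image _ (fun i => net.userLoss i ω) hS
    ⟨0, le_refl (net.userLoss 0 ω)⟩
  refine ⟨i, fun k => ?_⟩
  rcases le_total (net.userLoss 0 ω) (net.userLoss k ω) with h | h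
  · exact hmax k h
  · exact h.trans hi

/-- Almost surely the serving base station is the nearest one of its type, and it beats all the
base stations of the other type. -/
lemma ae_serving [IsProbabilityMeasure P] : ∀ᵐ ω ∂P,
    0 < ‖net.bs (net.serving ω) ω‖
      ∧ net.nearest (net.userLink (net.serving ω) ω) ω = ‖net.bs (net.serving ω) ω‖ₑ
      ∧ ω ∈ net.served (net.userLink (net.serving ω) ω) := by
  filter_upwards [net.ae_norm_bs_pos, net.ae_finite_ball, ae_all_iff.2 net.ae_nearest_ne_thr]
    with ω hpos hfin hne
  -- The set of maximizers is nonempty, so its infimum belongs to it and is not the default value of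
  -- `sInf ∅`.
  have hmax : ∀ k, net.userLoss k ω ≤ net.userLoss (net.serving ω) ω :=
    Nat.sInf_mem (net.exists_isMax_userLoss hpos hfin)
  set i := net.serving ω
  set j := net.userLink i ω with hj
  have hnear : net.nearest j ω = ‖net.bs i ω‖ₑ := by
    refine le_antisymm ((net.le_nearest_iff j ω _).1 le_rfl i rfl)
      ((net.le_nearest_iff j ω _).2 fun k hk => ?_)
    have h := hmax k
    rw [userLoss, userLoss, hk, ← hj, Params.pathLoss, Params.pathLoss,
      mul_le_mul_iff_right₀ (p.K_pos j),
      Real.rpow_le_rpow_iff_of_neg (hpos k) (hpos i) (neg_lt_zero.2 (p.α_pos j))] at h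
    rw [← ofReal_norm, ← ofReal_norm]
    exact ENNReal.ofReal_le_ofReal h
  refine ⟨hpos i, hnear, ?_, ?_⟩
  · rw [hnear]
    exact enorm_ne_top
  · refine lt_of_le_of_ne ((net.le_nearest_iff j.other ω _).2 fun k hk => ?_) (hne j).symm
    have h := hmax k
    rw [userLoss, userLoss, hk, ← hj, ← p.thr_le_iff j (hpos i) (hpos k)] at h
    rw [hnear, toReal_enorm, ← ofReal_norm]
    exact ENNReal.ofReal_le_ofReal h

/-- At most one of the two types is served. -/
lemma ae_disjoint_served [IsProbabilityMeasure P] :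
    ∀ᵐ ω ∂P, ω ∉ net.served los ∩ net.served nlos := by
  have h : ∀ j, ∀ᵐ ω ∂P, net.nearest j ω ≠ ENNReal.ofReal 0 := fun j =>
    measure_eq_zero_iff_ae_notMem.1 (net.measure_nearest_eq_ofReal j 0)
  filter_upwards [ae_all_iff.2 h] with ω hω
  rintro ⟨⟨h1, h2⟩, ⟨h3, h4⟩⟩
  have hpos : ∀ j, net.nearest j ω ≠ ∞ → 0 < (net.nearest j ω).toReal := fun j hj =>
    ENNReal.toReal_pos (by simpa using hω j) hj
  have h5 := hpos los h1
  have h6 := hpos nlos h3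
  simp only [other] at h2 h4
  rw [ENNReal.ofReal_lt_iff_lt_toReal (p.thr_nonneg _ ENNReal.toReal_nonneg) h3] at h2
  rw [ENNReal.ofReal_lt_iff_lt_toReal (p.thr_nonneg _ ENNReal.toReal_nonneg) h1] at h4
  rw [← not_le, p.le_thr_iff _ h5 h6] at h2
  have h7 := (p.thr_le_iff _ h6 h5).1 h4.le
  exact h2 h7

lemma measure_served_add [IsProbabilityMeasure P] :
    P (net.served los) + P (net.served nlos) = 1 := by
  have hd : P (net.served los ∩ net.served nlos) = 0 :=
    measure_eq_zero_iff_ae_notMem.2 net.ae_disjoint_served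
  rw [← measure_union_add_inter _ (net.measurableSet_served nlos), hd, add_zero]
  refine (mem_ae_iff_prob_eq_one
    ((net.measurableSet_served los).union (net.measurableSet_served nlos))).1 ?_
  filter_upwards [net.ae_serving] with ω hω
  cases hj : net.userLink (net.serving ω) ω
  · exact Or.inl (hj ▸ hω.2.2)
  · exact Or.inr (hj ▸ hω.2.2)

lemma lintegral_servedDensity [IsProbabilityMeasure P] (j : LinkType) :
    ∫⁻ r in Set.Ioi (0 : ℝ), ENNReal.ofReal (p.servedDensity j r) = P (net.served j) := by
  have h := net.lintegral_served j (f := fun _ => 1) measurable_const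
  simpa using h.symm

/-- All links beyond D are NLOS, so the mean number of NLOS stations within u is unbounded as u
grows and one exists almost surely. The density therefore has full mass. -/
lemma lintegral_nearestDensity_nlos [IsProbabilityMeasure P] (net : Network p P) :
    ∫⁻ r in Set.Ioi (0 : ℝ), ENNReal.ofReal (p.nearestDensity nlos r) = 1 := by
  have h1 : P {ω | net.nearest nlos ω = ∞} = 0 := by
    have hlim : Filter.Tendsto (fun n : ℕ => ENNReal.ofReal (Real.exp (-p.meanBS nlos (n : ℝ))))
        Filter.atTop (nhds 0) := by
      rw [← ENNReal.ofReal_zero]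
      refine ENNReal.tendsto_ofReal (Real.tendsto_exp_neg_atTop_nhds_zero.comp ?_)
      have h2 : Filter.Tendsto (fun n : ℕ => Real.pi * p.lamB * ((n : ℝ) ^ 2 - p.D ^ 2))
          Filter.atTop Filter.atTop :=
        (Filter.tendsto_atTop_add_const_right _ (-p.D ^ 2)
          ((Filter.tendsto_pow_atTop two_ne_zero).comp tendsto_natCast_atTop_atTop)).const_mul_atTop
          (mul_pos Real.pi_pos p.lamB_pos)
      refine Filter.tendsto_atTop_mono' _ ?_ h2
      filter_upwards [Filter.eventually_ge_atTop ⌈p.D⌉₊] with n hn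
      have h3 := mul_pos Real.pi_pos p.lamB_pos
      have h4 := p.q_nonneg nlos
      rw [p.meanBS_of_ge nlos ((Nat.le_ceil _).trans (Nat.cast_le.2 hn))]
      refine mul_le_mul_of_nonneg_left ?_ h3.le
      simp only [Params.qFar]
      nlinarith [sq_nonneg p.D, mul_nonneg h4 (sq_nonneg p.D)]
    refine le_antisymm (ge_of_tendsto' hlim fun n => ?_) zero_le
    rw [← net.measure_le_nearest_single nlos n.cast_nonneg]
    refine measure_mono fun ω hω => ?_
    have hω' : net.nearest nlos ω = ∞ := hω
    simp [hω']
  have h2 : P {ω | net.nearest nlos ω ≠ ∞} = 1 :=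
    (mem_ae_iff_prob_eq_one ((net.measurable_nearest nlos) (measurableSet_singleton ∞).compl)).1
      (measure_eq_zero_iff_ae_notMem.1 h1)
  have h3 := congrArg (fun μ => μ Set.univ) (net.map_nearest nlos)
  rw [Measure.map_apply (net.measurable_nearest nlos).ennreal_toReal MeasurableSet.univ,
    withDensity_apply _ MeasurableSet.univ, Measure.restrict_univ, Set.preimage_univ,
    Measure.restrict_apply_univ, h2] at h3
  exact h3.symm

/-- Integrate the decomposition of `servedDensity_nlos_eq`: the first term has mass exp(-π C λ_B D²)
since `nearestDensity nlos` has mass 1, and the excess gives the integral in A_N. -/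
lemma measure_served_nlos [IsProbabilityMeasure P] :
    P (net.served nlos) = ENNReal.ofReal p.assocNLOS := by
  have hFint : IntegrableOn p.excessDensity (Set.Ioc 0 (p.thr los p.D)) :=
    (p.continuous_excessDensity.integrableOn_Icc).mono_set Set.Ioc_subset_Icc_self
  have hset : Set.Ioc 0 (p.thr los p.D) = Set.Ioi 0 ∩ Set.Iic (p.thr los p.D) := rfl
  have hsplit : ∀ r ∈ Set.Ioi (0 : ℝ), ENNReal.ofReal (p.servedDensity nlos r)
      = ENNReal.ofReal (p.nearestDensity nlos r)
          * ENNReal.ofReal (Real.exp (-(p.C * p.lamB * Real.pi * p.D ^ 2)))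
        + (Set.Iic (p.thr los p.D)).indicator (fun r => ENNReal.ofReal (p.excessDensity r)) r := by
    intro r hr
    have hn := p.nearestDensity_nonneg nlos (le_of_lt hr)
    rw [p.servedDensity_nlos_eq hr, ← ENNReal.ofReal_mul hn]
    by_cases h : r ≤ p.thr los p.D
    · rw [if_pos h, Set.indicator_of_mem (show r ∈ Set.Iic (p.thr los p.D) from h),
        ENNReal.ofReal_add (by positivity) (p.excessDensity_nonneg ⟨hr, h⟩)]
    · rw [if_neg h, Set.indicator_of_notMem (show r ∉ Set.Iic (p.thr los p.D) from h), add_zero,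
        add_zero]
  rw [← net.lintegral_servedDensity nlos, setLIntegral_congr_fun measurableSet_Ioi hsplit,
    lintegral_add_left ((p.measurable_nearestDensity nlos).ennreal_ofReal.mul_const _),
    lintegral_mul_const _ (p.measurable_nearestDensity nlos).ennreal_ofReal,
    net.lintegral_nearestDensity_nlos, one_mul, lintegral_indicator measurableSet_Iic,
    Measure.restrict_restrict measurableSet_Iic, Set.inter_comm, ← hset,
    ← ofReal_integral_eq_lintegral_ofReal hFint
      ((ae_restrict_iff' measurableSet_Ioc).2 (ae_of_all _ fun r hr => p.excessDensity_nonneg hr)),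
    ← ENNReal.ofReal_add (Real.exp_pos _).le 
      (setIntegral_nonneg measurableSet_Ioc fun r hr => p.excessDensity_nonneg hr),
    p.assocNLOS_eq, add_comm]

lemma measure_served [IsProbabilityMeasure P] (j : LinkType) :
    P (net.served j) = ENNReal.ofReal (p.assoc j) := by
  cases j
  · have h := net.measure_served_add
    have h1 : P (net.served los) = 1 - P (net.served nlos) :=
      ENNReal.eq_sub_of_add_eq (measure_ne_top _ _) h
    rw [h1, net.measure_served_nlos, Params.assoc, ENNReal.ofReal_sub _ p.assocNLOS_pos.le,
       ENNReal.ofReal_one]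
  · exact net.measure_served_nlos

end Network

/-! ### The connection bound as a function of the serving distance -/

namespace Params

variable (p : Params)

lemma laplaceIE_zero : p.laplaceIE 0 = 1 := by
  simp [laplaceIE, Xi]

/-- Clipping at 0 makes the Laplace transform monotone on the whole line. Measurability and the
bound by 1 follow without any regularity of the hypergeometric expression. -/
lemma antitone_laplaceIE_max : Antitone fun s => p.laplaceIE (max s 0) := by
  intro s s' h
  simp only
  rcases le_or_gt s 0 with hs | hs
  · rw [max_eq_right hs, p.laplaceIE_zero]
    rcases le_or_gt s' 0 with hs' | hs'
    · rw [max_eq_right hs', p.laplaceIE_zero]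
    · rw [max_eq_left hs'.le]
      exact p.laplaceIE_le_one hs'
  · have hs' := hs.trans_le h
    rw [max_eq_left hs.le, max_eq_left hs'.le]
    exact p.laplaceIE_antitoneOn hs hs' h

/-- The argument of the Laplace transform in the `n`-th term of the bound. -/
def laplaceArg (j : LinkType) (n : ℕ) (r : ℝ) : ℝ := p.a j * n * r ^ p.α j / (p.Ms * p.K j)

lemma a_pos (j : LinkType) : 0 < p.a j :=
  Real.rpow_pos_of_pos (by exact_mod_cast Nat.factorial_pos _) _

lemma laplaceArg_nonneg (j : LinkType) (n : ℕ) {r : ℝ} (hr : 0 ≤ r) : 0 ≤ p.laplaceArg j n r := by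
  have h1 := p.a_pos j
  have h2 := p.Ms_pos
  have h3 := p.K_pos j
  unfold laplaceArg
  positivity

lemma laplaceArg_pos (j : LinkType) {n : ℕ} (hn : n ≠ 0) {r : ℝ} (hr : 0 < r) :
    0 < p.laplaceArg j n r := by
  have h1 := p.a_pos j
  have h2 := p.Ms_pos
  have h3 := p.K_pos j
  have h4 : (0 : ℝ) < n := by exact_mod_cast Nat.pos_of_ne_zero hn
  unfold laplaceArg
  positivity

lemma measurable_laplaceArg (j : LinkType) (n : ℕ) : Measurable (p.laplaceArg j n) := by
  unfold laplaceArg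
  fun_prop

/-- The bound on the connection probability of a serving base station of type `j` at
distance `r`. -/
def coverBound (j : LinkType) (r : ℝ) : ℝ :=
  ∑ n ∈ Finset.Icc 1 (p.N j), ((p.N j).choose n : ℝ) * (-1) ^ (n + 1)
    * p.laplaceIE (max (p.laplaceArg j n r) 0)

lemma measurable_coverBound (j : LinkType) : Measurable (p.coverBound j) := by
  unfold coverBound
  refine Finset.measurable_sum _ fun n _ => Measurable.const_mul ?_ _
  exact p.antitone_laplaceIE_max.measurable.comp (p.measurable_laplaceArg j n)

lemma integrableOn_mul_laplaceIE {f : ℝ → ℝ} (hf : IntegrableOn f (Set.Ioi 0)) (j : LinkType)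
    (n : ℕ) : IntegrableOn (fun r => f r * p.laplaceIE (p.laplaceArg j n r)) (Set.Ioi 0) := by
  have h : IntegrableOn (fun r => f r * p.laplaceIE (max (p.laplaceArg j n r) 0)) (Set.Ioi 0) := by
    refine hf.mul_bdd (c := 1) ((p.antitone_laplaceIE_max.measurable.comp
      (p.measurable_laplaceArg j n)).aestronglyMeasurable) (ae_of_all _ fun r => ?_)
    rw [Real.norm_of_nonneg (p.laplaceIE_pos _).le]
    have := p.antitone_laplaceIE_max (le_max_right (p.laplaceArg j n r) 0)
    simpa [p.laplaceIE_zero] using this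
  refine h.congr_fun (fun r hr => ?_) measurableSet_Ioi
  simp only
  rw [max_eq_left (p.laplaceArg_nonneg j n (le_of_lt hr))]

lemma integral_mul_coverBound {f : ℝ → ℝ} (hf : IntegrableOn f (Set.Ioi 0)) (j : LinkType) :
    ∫ r in Set.Ioi (0 : ℝ), f r * p.coverBound j r
      = ∑ n ∈ Finset.Icc 1 (p.N j), ((p.N j).choose n : ℝ) * (-1) ^ (n + 1)
          * ∫ r in Set.Ioi (0 : ℝ), f r * p.laplaceIE (p.laplaceArg j n r) := by
  rw [setIntegral_congr_fun (g := fun r => ∑ n ∈ Finset.Icc 1 (p.N j),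
    ((p.N j).choose n : ℝ) * (-1) ^ (n + 1) * (f r * p.laplaceIE (p.laplaceArg j n r)))
    measurableSet_Ioi, integral_finsetSum]
  · simp_rw [integral_const_mul]
  · exact fun n _ => (p.integrableOn_mul_laplaceIE hf j n).const_mul _
  · intro r hr
    simp only [coverBound, Finset.mul_sum]
    refine Finset.sum_congr rfl fun n _ => ?_
    rw [max_eq_left (p.laplaceArg_nonneg j n (le_of_lt hr))]
    ring

lemma integrableOn_mul_coverBound {f : ℝ → ℝ} (hf : IntegrableOn f (Set.Ioi 0)) (j : LinkType) :
    IntegrableOn (fun r => f r * p.coverBound j r) (Set.Ioi 0) := by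
  have h : IntegrableOn (fun r => ∑ n ∈ Finset.Icc 1 (p.N j),
    ((p.N j).choose n : ℝ) * (-1) ^ (n + 1) * (f r * p.laplaceIE (p.laplaceArg j n r)))
      (Set.Ioi 0) :=
    integrable_finsetSum _ fun n _ => (p.integrableOn_mul_laplaceIE hf j n).const_mul _
  refine h.congr_fun (fun r hr => ?_) measurableSet_Ioi
  simp only [coverBound, Finset.mul_sum]
  refine Finset.sum_congr rfl fun n _ => ?_
  rw [max_eq_left (p.laplaceArg_nonneg j n (le_of_lt hr))]
  ring

end Params

lemma one_sub_one_sub_pow (y : ℝ) (N : ℕ) :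
    1 - (1 - y) ^ N = ∑ n ∈ Finset.Icc 1 N, (N.choose n : ℝ) * (-1) ^ (n + 1) * y ^ n := by
  have h : (1 - y) ^ N = ∑ n ∈ Finset.range (N + 1), (-y) ^ n * (N.choose n : ℝ) := by
    rw [sub_eq_neg_add, add_pow]
    simp
  rw [h, Finset.sum_range_succ', Finset.range_eq_Ico, Finset.sum_Ico_add' (fun n =>
    (-y) ^ n * (N.choose n : ℝ)) 0 N 1, zero_add, pow_zero, Nat.choose_zero_right, Nat.cast_one,
    mul_one, sub_add_cancel_right, ← Finset.sum_neg_distrib]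
  refine Finset.sum_congr rfl fun n _ => ?_
  rw [neg_pow]
  ring

namespace Network

variable {p : Params} {Ω : Type*} [MeasurableSpace Ω] {P : Measure Ω}

lemma integrableOn_servedDensity [IsProbabilityMeasure P] (net : Network p P) (j : LinkType) :
    IntegrableOn (p.servedDensity j) (Set.Ioi 0) := by
  refine ⟨(p.measurable_servedDensity j).aestronglyMeasurable, ?_⟩
  rw [hasFiniteIntegral_iff_ofReal, net.lintegral_servedDensity j]
  · exact measure_lt_top _ _
  · filter_upwards [ae_restrict_mem measurableSet_Ioi] with r hr
    exact p.servedDensity_nonneg j (le_of_lt hr)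

lemma integrableOn_distPdf [IsProbabilityMeasure P] (net : Network p P) (j : LinkType) :
    IntegrableOn (p.distPdf j) (Set.Ioi 0) :=
  ((net.integrableOn_servedDensity j).div_const _).congr
    ((p.ae_distPdf_eq j).mono fun _ h => h.symm)

lemma assoc_le_one [IsProbabilityMeasure P] (net : Network p P) (j : LinkType) :
    p.assoc j ≤ 1 := by
  have h : P (net.served j) ≤ 1 := prob_le_one
  rwa [net.measure_served j, ENNReal.ofReal_le_one] at h

lemma assoc_nonneg [IsProbabilityMeasure P] (net : Network p P) (j : LinkType) :
    0 ≤ p.assoc j := by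
  cases j
  · exact sub_nonneg.2 (net.assoc_le_one nlos)
  · exact p.assocNLOS_pos.le

/-- Division by A_j is harmless even when A_j = 0: then `servedDensity j` has total mass 0 and
vanishes almost everywhere. -/
lemma ae_assoc_mul_distPdf [IsProbabilityMeasure P] (net : Network p P) (j : LinkType) :
    ∀ᵐ r ∂volume.restrict (Set.Ioi (0 : ℝ)), p.assoc j * p.distPdf j r = p.servedDensity j r := by
  by_cases h : p.assoc j = 0
  · have h1 := net.lintegral_servedDensity j
    rw [net.measure_served j, h, ENNReal.ofReal_zero,
      lintegral_eq_zero_iff (p.measurable_servedDensity j).ennreal_ofReal] at h1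
    filter_upwards [h1, ae_restrict_mem measurableSet_Ioi] with r hr hr0
    rw [h, zero_mul]
    exact le_antisymm (p.servedDensity_nonneg j (le_of_lt hr0)) (ENNReal.ofReal_eq_zero.1 hr)
  · filter_upwards [p.ae_distPdf_eq j] with r hr
    rw [hr, mul_div_cancel₀ _ h]

end Network

/-! ### Measurability of the serving index -/

namespace Params

variable (p : Params)

/-- The path loss of the link between the origin and a base station at `x` with blockage
mark `b`. -/
def markedLoss (x : Plane) (b : ℝ) : ℝ := p.pathLoss (p.linkType ‖x‖ b) ‖x‖

lemma measurable_markedLoss : Measurable fun q : Plane × ℝ => p.markedLoss q.1 q.2 := by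
  have h : ∀ j, MeasurableSet {q : Plane × ℝ | p.linkType ‖q.1‖ q.2 = j} := fun j =>
    (p.measurableSet_linkType_eq j).preimage (f := fun q : Plane × ℝ => (‖q.1‖, q.2))
      (by fun_prop)
  have heq : (fun q : Plane × ℝ => p.markedLoss q.1 q.2)
      = fun q => if p.linkType ‖q.1‖ q.2 = los then p.pathLoss los ‖q.1‖
        else p.pathLoss nlos ‖q.1‖ := by
    ext q
    unfold markedLoss
    cases hj : p.linkType ‖q.1‖ q.2 <;> simp
  rw [heq]
  exact Measurable.ite (h los) ((p.measurable_pathLoss los).comp measurable_fst.norm)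
    ((p.measurable_pathLoss nlos).comp measurable_fst.norm)

/-- The index of the best base station, as a function of the positions and the blockage marks. -/
def bestIndex (w : (ℕ → Plane) × (ℕ → ℝ)) : ℕ :=
  sInf {i | ∀ k, p.markedLoss (w.1 k) (w.2 k) ≤ p.markedLoss (w.1 i) (w.2 i)}

lemma measurable_bestIndex : Measurable p.bestIndex := by
  have hL : ∀ i, Measurable fun w : (ℕ → Plane) × (ℕ → ℝ) => p.markedLoss (w.1 i) (w.2 i) :=
    fun i => p.measurable_markedLoss.comp
      (f := fun w : (ℕ → Plane) × (ℕ → ℝ) => (w.1 i, w.2 i)) (by fun_prop)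
  set S : ℕ → Set ((ℕ → Plane) × (ℕ → ℝ)) := fun i =>
    {w | ∀ k, p.markedLoss (w.1 k) (w.2 k) ≤ p.markedLoss (w.1 i) (w.2 i)} with hS
  have hSm : ∀ i, MeasurableSet (S i) := fun i => by
    simp only [hS, Set.ofPred_forall]
    exact MeasurableSet.iInter fun k => measurableSet_le (hL k) (hL i)
  refine measurable_to_countable' fun i => ?_
  -- The first set says that i is the least maximizer. The second accounts for configurations
  -- without a maximizer, where `sInf ∅ = 0`.
  have : p.bestIndex ⁻¹' {i}
      = (S i ∩ ⋂ l ∈ Finset.range i, (S l)ᶜ) ∪ {w | i = 0 ∧ ∀ l, w ∉ S l} := by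
    ext w
    have hmem : ∀ l, w ∈ S l ↔
      l ∈ {i | ∀ k, p.markedLoss (w.1 k) (w.2 k) ≤ p.markedLoss (w.1 i) (w.2 i)} := fun l => Iff.rfl
    simp only [Set.mem_preimage, Set.mem_singleton_iff, Set.mem_union, Set.mem_inter_iff,
      Set.mem_iInter, Finset.mem_range, Set.mem_compl_iff, Set.mem_ofPred_eq (p := fun w => _ ∧ _),
      hmem]
    rw [bestIndex]
    set T := {i | ∀ k, p.markedLoss (w.1 k) (w.2 k) ≤ p.markedLoss (w.1 i) (w.2 i)}
    constructor
    · rintro rfl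
      rcases T.eq_empty_or_nonempty with h | h
      · right
        simp [h]
      · exact Or.inl ⟨Nat.sInf_mem h, fun l hl => Nat.notMem_of_lt_sInf hl⟩
    · rintro (⟨h1, h2⟩ | ⟨rfl, h⟩)
      · refine le_antisymm (Nat.sInf_le h1) (not_lt.1 fun h => h2 _ h (Nat.sInf_mem ⟨i, h1⟩))
      · exact Nat.sInf_eq_zero.2 (Or.inr (Set.eq_empty_iff_forall_notMem.2 h))
  rw [this]
  refine MeasurableSet.union ((hSm i).inter
    (Finset.measurableSet_biInter _ fun l _ => (hSm l).compl)) ?_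
  have : {w | i = 0 ∧ ∀ l, w ∉ S l} = {w | i = 0} ∩ ⋂ l, (S l)ᶜ := by
    ext w
    simp
  rw [this]
  exact (MeasurableSet.const _).inter (MeasurableSet.iInter fun l => (hSm l).compl)

end Params

/-! ### Decoupling the serving station from its links -/

namespace Network

variable {p : Params} {Ω : Type*} [MeasurableSpace Ω] {P : Measure Ω} (net : Network p P)

/-- The positions and the blockage marks of the base stations. -/
def bsConfig (ω : Ω) : (ℕ → Plane) × (ℕ → ℝ) :=
  (fun i => net.bs i ω, fun i => net.mark (.userBlock i) ω)

lemma measurable_bsConfig : Measurable net.bsConfig :=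
  (measurable_pi_lambda _ net.bs_poisson.measurable).prodMk
    (measurable_pi_lambda _ fun _ => net.mark_measurable _)

lemma measurable_serving : Measurable net.serving :=
  p.measurable_bestIndex.comp net.measurable_bsConfig

/-- The fading of the link from base station `i` to the user, for each possible link type. -/
def userFades (i : ℕ) (ω : Ω) (j : LinkType) : ℝ := net.mark (.userFade j i) ω

/-- The randomness of base station `i` that does not affect the choice of the serving station. -/
def linkConfig (i : ℕ) (ω : Ω) : (LinkType → ℝ) × (ℕ → Plane) × (ℕ → LinkMark → ℝ) :=
  (net.userFades i ω, fun k => net.eve k ω, net.eveMarks i ω)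

lemma measurable_userFades (i : ℕ) : Measurable (net.userFades i) :=
  measurable_pi_lambda _ fun _ => net.mark_measurable _

lemma measurable_eve : Measurable fun ω k => net.eve k ω :=
  measurable_pi_lambda _ net.eve_poisson.measurable

lemma measurable_linkConfig (i : ℕ) : Measurable (net.linkConfig i) :=
  (net.measurable_userFades i).prodMk (net.measurable_eve.prodMk (net.measurable_eveMarks i))

/-- The mark indices of the links from base station `i`, except for the blockage of the link to
the user. -/
def linkIndex (i : ℕ) : LinkType ⊕ (ℕ × LinkMark) → Mark
  | .inl j => .userFade j i
  | .inr (k, c) => eveMark i k c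

/-- Points are independent of marks, base stations of eavesdroppers, and user blockages of the other
marks in use. `indepFun_prod_comm` regroups these four pieces crosswise. -/
lemma indepFun_bsConfig_linkConfig [IsProbabilityMeasure P] (i : ℕ) :
    IndepFun net.bsConfig (net.linkConfig i) P := by
  have hm : Measurable fun ω c => net.mark c ω := measurable_pi_lambda _ net.mark_measurable
  have hmarks : IndepFun (fun ω k => net.mark (.userBlock k) ω)
      (fun ω c => net.mark (linkIndex i c) ω) P :=
    indepFun_of_disjoint_range net.mark_measurable net.mark_indep _ _ (by
      rintro k (j | ⟨k', c⟩)
      · simp [linkIndex]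
      · cases c <;> simp [linkIndex, eveMark])
  have hpoints : IndepFun (fun ω => ((fun k => net.bs k ω), (fun k => net.eve k ω)))
      (fun ω => ((fun k => net.mark (.userBlock k) ω), (fun c => net.mark (linkIndex i c) ω))) P :=
    net.points_indep_mark.comp (φ := id)
      (ψ := fun m : Mark → ℝ => ((fun k => m (.userBlock k)), (fun c => m (linkIndex i c))))
      measurable_id (by fun_prop)
  have h := indepFun_prod_comm (measurable_pi_lambda _ net.bs_poisson.measurable)
    net.measurable_eve (measurable_pi_lambda _ fun k => net.mark_measurable (.userBlock k))
    (measurable_pi_lambda _ fun c => net.mark_measurable (linkIndex i c))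
    net.bs_indep_eve hmarks hpoints
  exact h.comp (φ := id) (ψ := fun q : (ℕ → Plane) × (LinkType ⊕ (ℕ × LinkMark) → ℝ) =>
    ((fun j => q.2 (.inl j)), q.1, (fun k c => q.2 (.inr (k, c))))) measurable_id (by fun_prop)

lemma indepFun_eve_userFades [IsProbabilityMeasure P] (i : ℕ) :
    IndepFun (fun ω => ((fun k => net.eve k ω), net.eveMarks i ω)) (net.userFades i) P := by
  have hmarks : IndepFun (fun ω (c : ℕ × LinkMark) => net.mark (eveMark i c.1 c.2) ω)
      (fun ω j => net.mark (.userFade j i) ω) P :=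
    indepFun_of_disjoint_range net.mark_measurable net.mark_indep _ _ (by
      rintro ⟨k', c⟩ j
      cases c <;> simp [eveMark])
  -- Only three pieces occur here; a constant fills the fourth place of `indepFun_prod_comm`.
  have hpoints : IndepFun (fun ω => ((fun k => net.eve k ω), ()))
      (fun ω => ((fun c : ℕ × LinkMark => net.mark (eveMark i c.1 c.2) ω),
        (fun j => net.mark (.userFade j i) ω))) P :=
    net.points_indep_mark.comp (φ := fun q => (q.2, ()))
      (ψ := fun m : Mark → ℝ => ((fun c : ℕ × LinkMark => m (eveMark i c.1 c.2)),
        (fun j => m (.userFade j i))))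
      (by fun_prop) (by fun_prop)
  have h := indepFun_prod_comm net.measurable_eve measurable_const
    (measurable_pi_lambda _ fun c => net.mark_measurable _)
    (measurable_pi_lambda _ fun c => net.mark_measurable _)
    (indepFun_const_right _ _) hmarks hpoints
  exact h.comp (φ := fun q : (ℕ → Plane) × (ℕ × LinkMark → ℝ) => (q.1, fun k c => q.2 (k, c)))
    (ψ := Prod.snd) (by fun_prop) measurable_snd

/-- The links from the serving base station are independent of its position and its link type. -/
lemma lintegral_serving [IsProbabilityMeasure P]
    {φ : (Plane × ℝ) × (LinkType → ℝ) × (ℕ → Plane) × (ℕ → LinkMark → ℝ) → ℝ≥0∞}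
    (hφ : Measurable φ) :
    ∫⁻ ω, φ ((net.bs (net.serving ω) ω, net.mark (.userBlock (net.serving ω)) ω),
        net.linkConfig (net.serving ω) ω) ∂P
      = ∫⁻ ω, ∫⁻ ω', φ ((net.bs (net.serving ω) ω, net.mark (.userBlock (net.serving ω)) ω),
        net.linkConfig (net.serving ω) ω') ∂P ∂P := by
  have hsplit : ∀ f : Ω → ℝ≥0∞, ∫⁻ ω, f ω ∂P = ∑' i, ∫⁻ ω in net.serving ⁻¹' {i}, f ω ∂P := by
    intro f
    rw [← lintegral_iUnion (fun i => net.measurable_serving (measurableSet_singleton i)),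
      ← Set.preimage_iUnion, Set.iUnion_of_singleton, Set.preimage_univ, Measure.restrict_univ]
    intro i i' h
    exact Disjoint.preimage _ (Set.disjoint_singleton.2 h)
  rw [hsplit, hsplit]
  refine tsum_congr fun i => ?_
  have hm : MeasurableSet (net.serving ⁻¹' {i}) :=
    net.measurable_serving (measurableSet_singleton i)
  -- On the event that the serving index is i, the station is fixed, and the event itself depends on
  -- `bsConfig` only. So `linkConfig i` can be redrawn on this piece.
  set A : Set ((ℕ → Plane) × (ℕ → ℝ)) := p.bestIndex ⁻¹' {i} with hA
  have hAm : MeasurableSet A := p.measurable_bestIndex (measurableSet_singleton i)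
  set ψ : ((ℕ → Plane) × (ℕ → ℝ)) × ((LinkType → ℝ) × (ℕ → Plane) × (ℕ → LinkMark → ℝ)) → ℝ≥0∞ :=
    fun q => A.indicator 1 q.1 * φ ((q.1.1 i, q.1.2 i), q.2) with hψ
  have hψm : Measurable ψ := by
    refine Measurable.mul ((measurable_one.indicator hAm).comp measurable_fst) ?_
    exact hφ.comp (f := fun q : ((ℕ → Plane) × (ℕ → ℝ))
      × ((LinkType → ℝ) × (ℕ → Plane) × (ℕ → LinkMark → ℝ)) => ((q.1.1 i, q.1.2 i), q.2))
      (by fun_prop)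
  have h := lintegral_indepFun_pair net.measurable_bsConfig (net.measurable_linkConfig i)
    (net.indepFun_bsConfig_linkConfig i) hψm
  rw [← lintegral_indicator hm, ← lintegral_indicator hm]
  refine Eq.trans ?_ (h.trans ?_)
  · refine lintegral_congr fun ω => ?_
    by_cases hω : ω ∈ net.serving ⁻¹' {i}
    · have hω' : net.bsConfig ω ∈ A := hω
      rw [Set.indicator_of_mem hω]
      simp only [hψ]
      rw [Set.indicator_of_mem hω', Pi.one_apply, one_mul, show net.serving ω = i from hω]
      rfl
    · have hω' : net.bsConfig ω ∉ A := hω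
      rw [Set.indicator_of_notMem hω]
      simp only [hψ]
      rw [Set.indicator_of_notMem hω', zero_mul]
  · refine lintegral_congr fun ω => ?_
    by_cases hω : ω ∈ net.serving ⁻¹' {i}
    · have hω' : net.bsConfig ω ∈ A := hω
      rw [Set.indicator_of_mem hω]
      simp only [hψ]
      rw [Set.indicator_of_mem hω', show net.serving ω = i from hω]
      simp only [Pi.one_apply, one_mul]
      rfl
    · have hω' : net.bsConfig ω ∉ A := hω
      rw [Set.indicator_of_notMem hω]
      simp only [hψ]
      rw [Set.indicator_of_notMem hω']
      simp only [zero_mul, lintegral_zero]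

end Network

/-! ### The eavesdropped power and the connection probability at a fixed position -/

namespace Network

variable {p : Params} {Ω : Type*} [MeasurableSpace Ω] {P : Measure Ω} (net : Network p P)

/-- Reduces the law of the total power to that of a fixed station. The inner integrals for
finiteness and for the Laplace transform do not depend on the station, so the outer average is
trivial. -/
lemma lintegral_serving_totalPower [IsProbabilityMeasure P] {f : ℝ≥0∞ → ℝ≥0∞}
    (hf : Measurable f) :
    ∫⁻ ω, f (net.powerE ω) ∂P
      = ∫⁻ ω, ∫⁻ ω', f (p.totalPower (net.bs (net.serving ω) ω) (fun k => net.eve k ω')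
          (net.eveMarks (net.serving ω) ω')) ∂P ∂P :=
  net.lintegral_serving (φ := fun q => f (p.totalPower q.1.1 q.2.2.1 q.2.2.2))
    (hf.comp (p.measurable_totalPower.comp
      (f := fun q : (Plane × ℝ) × (LinkType → ℝ) × (ℕ → Plane) × (ℕ → LinkMark → ℝ) =>
        (q.1.1, q.2.2.1, q.2.2.2)) (by fun_prop)))

lemma measurable_powerE : Measurable net.powerE := by
  have h : net.powerE = fun ω => ∑' i, (net.serving ⁻¹' {i}).indicator
      (fun ω => p.totalPower (net.bs i ω) (fun k => net.eve k ω) (net.eveMarks i ω)) ω := by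
    ext ω
    rw [tsum_eq_single (net.serving ω), Set.indicator_of_mem
      (show ω ∈ net.serving ⁻¹' {net.serving ω} from rfl), powerE_eq]
    intro i hi
    rw [Set.indicator_of_notMem]
    exact fun h => hi (Eq.symm h)
  rw [h]
  refine Measurable.tsum fun i => Measurable.indicator ?_
    (net.measurable_serving (measurableSet_singleton i))
  exact p.measurable_totalPower.comp
    (f := fun ω => (net.bs i ω, (fun k => net.eve k ω), net.eveMarks i ω))
    ((net.bs_poisson.measurable i).prodMk (net.measurable_eve.prodMk (net.measurable_eveMarks i)))

theorem ae_powerE_ne_top [IsProbabilityMeasure P] : ∀ᵐ ω ∂P, net.powerE ω ≠ ∞ := by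
  have hf : Measurable (({∞} : Set ℝ≥0∞).indicator (1 : ℝ≥0∞ → ℝ≥0∞)) :=
    measurable_one.indicator (measurableSet_singleton ∞)
  have h := net.lintegral_serving_totalPower hf
  have h0 : ∀ ω, ∫⁻ ω', ({∞} : Set ℝ≥0∞).indicator 1 (p.totalPower (net.bs (net.serving ω) ω)
      (fun k => net.eve k ω') (net.eveMarks (net.serving ω) ω')) ∂P = 0 := by
    intro ω
    rw [lintegral_congr_ae (g := fun _ => 0), lintegral_zero]
    filter_upwards [net.ae_totalPower_ne_top (net.serving ω) (net.bs (net.serving ω) ω)] with ω' h'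
    rw [Set.indicator_of_notMem]
    exact h'
  rw [lintegral_congr h0, lintegral_zero] at h
  filter_upwards [(lintegral_eq_zero_iff (hf.comp net.measurable_powerE)).1 h] with ω hω htop
  simp [htop] at hω

theorem integral_exp_powerE [IsProbabilityMeasure P] {s : ℝ} (hs : 0 < s) :
    ∫ ω, Real.exp (-s * (net.powerE ω).toReal) ∂P = p.laplaceIE s := by
  have hf : Measurable fun x : ℝ≥0∞ => ENNReal.ofReal (Real.exp (-(s * x.toReal))) := by
    fun_prop
  have h := net.lintegral_serving_totalPower hf
  simp_rw [net.lintegral_exp_totalPower _ _ hs] at h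
  rw [lintegral_const, measure_univ, mul_one] at h
  have hm := net.measurable_powerE
  rw [integral_eq_lintegral_of_nonneg_ae (ae_of_all _ fun ω => (Real.exp_pos _).le)
    (by fun_prop : Measurable _).aestronglyMeasurable]
  simp_rw [neg_mul]
  rw [h, ENNReal.toReal_ofReal (p.laplaceIE_pos s).le]

lemma integral_exp_totalPower [IsProbabilityMeasure P] (i : ℕ) (x : Plane) {s : ℝ} (hs : 0 < s) :
    ∫ ω, Real.exp (-(s * (p.totalPower x (fun k => net.eve k ω) (net.eveMarks i ω)).toReal)) ∂P
      = p.laplaceIE s := by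
  have hm := net.measurable_totalPower_eve i x
  rw [integral_eq_lintegral_of_nonneg_ae (ae_of_all _ fun ω => (Real.exp_pos _).le)
    (by fun_prop : Measurable _).aestronglyMeasurable, net.lintegral_exp_totalPower i x hs,
    ENNReal.toReal_ofReal (p.laplaceIE_pos s).le]

/-- The binomial expansion gives exponentials at n times the basic argument, whose expectations are
Laplace transforms. Being an expectation is also what shows that the alternating sum is nonnegative,
which its formula does not reveal. -/
lemma lintegral_alzer_totalPower [IsProbabilityMeasure P] (i : ℕ) (x : Plane) (j : LinkType)
    {r : ℝ} (hr : 0 < r) :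
    0 ≤ p.coverBound j r ∧
    ∫⁻ ω, ENNReal.ofReal (1 - (1 - Real.exp (-(p.laplaceArg j 1 r
        * (p.totalPower x (fun k => net.eve k ω) (net.eveMarks i ω)).toReal))) ^ p.N j) ∂P
      = ENNReal.ofReal (p.coverBound j r) := by
  have hm := net.measurable_totalPower_eve i x
  set I : Ω → ℝ := fun ω => (p.totalPower x (fun k => net.eve k ω) (net.eveMarks i ω)).toReal
    with hI
  have hIm : Measurable I := hm.ennreal_toReal
  have hI0 : ∀ ω, 0 ≤ I ω := fun ω => ENNReal.toReal_nonneg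
  have harg : ∀ n : ℕ, p.laplaceArg j n r = n * p.laplaceArg j 1 r := by
    intro n
    unfold Params.laplaceArg
    push_cast
    ring
  have hterm : ∀ n ∈ Finset.Icc 1 (p.N j), Integrable (fun ω =>
      ((p.N j).choose n : ℝ) * (-1) ^ (n + 1) * Real.exp (-(p.laplaceArg j n r * I ω))) P := by
    intro n _
    refine Integrable.const_mul ?_ _
    refine Integrable.of_bound (by fun_prop : Measurable _).aestronglyMeasurable 1
      (ae_of_all _ fun ω => ?_)
    rw [Real.norm_of_nonneg (Real.exp_pos _).le, Real.exp_le_one_iff, neg_nonpos]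
    exact mul_nonneg (p.laplaceArg_nonneg j n hr.le) (hI0 ω)
  have hexpand : ∀ ω, 1 - (1 - Real.exp (-(p.laplaceArg j 1 r * I ω))) ^ p.N j
      = ∑ n ∈ Finset.Icc 1 (p.N j),
        ((p.N j).choose n : ℝ) * (-1) ^ (n + 1) * Real.exp (-(p.laplaceArg j n r * I ω)) := by
    intro ω
    rw [one_sub_one_sub_pow]
    refine Finset.sum_congr rfl fun n _ => ?_
    rw [← Real.exp_nat_mul, harg n]
    ring_nf
  have hpos : ∀ ω, 0 ≤ 1 - (1 - Real.exp (-(p.laplaceArg j 1 r * I ω))) ^ p.N j := by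
    intro ω
    have h1 : Real.exp (-(p.laplaceArg j 1 r * I ω)) ≤ 1 := by
      rw [Real.exp_le_one_iff, neg_nonpos]
      exact mul_nonneg (p.laplaceArg_nonneg j 1 hr.le) (hI0 ω)
    have h2 := Real.exp_pos (-(p.laplaceArg j 1 r * I ω))
    exact sub_nonneg.2 (pow_le_one₀ (by linarith) (by linarith))
  have hintegral : ∫ ω, (1 - (1 - Real.exp (-(p.laplaceArg j 1 r * I ω))) ^ p.N j) ∂P
      = p.coverBound j r := by
    simp_rw [hexpand]
    rw [integral_finsetSum _ hterm, Params.coverBound]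
    refine Finset.sum_congr rfl fun n hn => ?_
    have hn0 : n ≠ 0 := by
      have := (Finset.mem_Icc.1 hn).1
      omega
    rw [integral_const_mul, net.integral_exp_totalPower i x (p.laplaceArg_pos j hn0 hr),
      max_eq_left (p.laplaceArg_nonneg j n hr.le)]
  constructor
  · rw [← hintegral]
    exact integral_nonneg hpos
  · rw [← ofReal_integral_eq_lintegral_ofReal _ (ae_of_all _ hpos), hintegral]
    simp_rw [hexpand]
    exact integrable_finsetSum _ hterm

/-- The hypothesis forces a > 0, because `ofReal` truncates and 0 / b = 0. Only this implication is
used, as an upper bound is wanted. -/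
lemma toReal_le_of_one_le_ofReal_div {a : ℝ} {b : ℝ≥0∞} (h : 1 ≤ ENNReal.ofReal a / b) :
    b.toReal ≤ a := by
  have ha : 0 < a := by
    by_contra ha
    rw [ENNReal.ofReal_of_nonpos (not_lt.1 ha), ENNReal.zero_div] at h
    exact absurd h (by simp)
  have hb : b ≤ ENNReal.ofReal a := by
    have := ENNReal.mul_le_of_le_div h
    rwa [one_mul] at this
  exact ENNReal.toReal_le_of_le_ofReal ha.le hb

lemma measure_le_of_indepFun [IsProbabilityMeasure P] {X Y : Ω → ℝ} (hX : Measurable X)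
    (hY : Measurable Y) (h : IndepFun X Y P) :
    P {ω | X ω ≤ Y ω} = ∫⁻ ω, P.map Y (Set.Ici (X ω)) ∂P := by
  set S : Set (ℝ × ℝ) := {q | q.1 ≤ q.2} with hS
  have hSm : MeasurableSet S := measurableSet_le measurable_fst measurable_snd
  have hpair := lintegral_indepFun_pair hX hY h (measurable_one.indicator hSm)
  change P ((fun ω => (X ω, Y ω)) ⁻¹' S) = _
  rw [← lintegral_indicator_one ((hX.prodMk hY) hSm)]
  refine Eq.trans hpair (lintegral_congr fun ω => ?_)
  rw [Measure.map_apply hY measurableSet_Ici, ← lintegral_indicator_one (hY measurableSet_Ici)]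
  rfl

/-- The connection probability for a base station of type `j` at a fixed position. -/
lemma measure_connected_le [IsProbabilityMeasure P] (i : ℕ) {x : Plane} (hx : 0 < ‖x‖)
    (j : LinkType) :
    P {ω | 1 ≤ ENNReal.ofReal (p.Ms * p.pathLoss j ‖x‖ * net.mark (.userFade j i) ω)
        / p.totalPower x (fun k => net.eve k ω) (net.eveMarks i ω)}
      ≤ ENNReal.ofReal (p.coverBound j ‖x‖) := by
  have hc0 : 0 < p.Ms * p.pathLoss j ‖x‖ :=
    mul_pos p.Ms_pos (mul_pos (p.K_pos j) (Real.rpow_pos_of_pos hx _))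
  have hind : IndepFun (fun ω => (p.totalPower x (fun k => net.eve k ω)
      (net.eveMarks i ω)).toReal / (p.Ms * p.pathLoss j ‖x‖)) (net.mark (.userFade j i)) P := by
    have hφ : Measurable fun q : (ℕ → Plane) × (ℕ → LinkMark → ℝ) =>
        (p.totalPower x q.1 q.2).toReal / (p.Ms * p.pathLoss j ‖x‖) :=
      (Measurable.ennreal_toReal (p.measurable_totalPower.comp
        (f := fun q : (ℕ → Plane) × (ℕ → LinkMark → ℝ) => (x, q.1, q.2))
        (measurable_const.prodMk measurable_id))).div_const _
    have hψ : Measurable fun y : LinkType → ℝ => y j := measurable_pi_apply j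
    exact (net.indepFun_eve_userFades i).comp hφ hψ
  have hle := measure_le_of_indepFun
    ((net.measurable_totalPower_eve i x).ennreal_toReal.div_const _) (net.mark_measurable _) hind
  have hsub : {ω | 1 ≤ ENNReal.ofReal (p.Ms * p.pathLoss j ‖x‖ * net.mark (.userFade j i) ω)
        / p.totalPower x (fun k => net.eve k ω) (net.eveMarks i ω)}
      ⊆ {ω | (p.totalPower x (fun k => net.eve k ω) (net.eveMarks i ω)).toReal
        / (p.Ms * p.pathLoss j ‖x‖) ≤ net.mark (.userFade j i) ω} := by
    intro ω hω
    have h1 := toReal_le_of_one_le_ofReal_div hω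
    exact (div_le_iff₀' hc0).2 h1
  refine (measure_mono hsub).trans (hle.le.trans ?_)
  rw [← (net.lintegral_alzer_totalPower i x j hx).2, (net.mark_law (.userFade j i)).map_eq]
  refine lintegral_mono fun ω => ?_
  refine (gammaMeasure_Ici_le (p.N_pos j) (div_nonneg ENNReal.toReal_nonneg hc0.le)).trans
    (le_of_eq ?_)
  -- Alzer's exponent at the fading level t / (M_s L) is the first Laplace argument times t.
  have h2 : ∀ t : ℝ, ((p.N j).factorial : ℝ) ^ (-(1 / (p.N j : ℝ)))
      * (t / (p.Ms * p.pathLoss j ‖x‖)) = p.laplaceArg j 1 ‖x‖ * t := by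
    intro t
    have h3 := p.Ms_pos
    have h4 := p.K_pos j
    have h5 := Real.rpow_pos_of_pos hx (p.α j)
    rw [Params.laplaceArg, Params.pathLoss, Real.rpow_neg hx.le, ← Params.a]
    generalize ‖x‖ ^ p.α j = r at h5
    push_cast
    field_simp
  rw [h2]

end Network

/-! ### The connection event and the final bound -/

namespace Params

variable (p : Params)

/-- The configurations for which the base station at `x` with blockage mark `b` is received at
least as well by the user as by the eavesdroppers. -/
def connectedSet : Set ((Plane × ℝ) × (LinkType → ℝ) × (ℕ → Plane) × (ℕ → LinkMark → ℝ)) :=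
  {q | 1 ≤ ENNReal.ofReal (p.Ms * p.markedLoss q.1.1 q.1.2 * q.2.1 (p.linkType ‖q.1.1‖ q.1.2))
    / p.totalPower q.1.1 q.2.2.1 q.2.2.2}

lemma measurableSet_connectedSet : MeasurableSet p.connectedSet := by
  have h1 : Measurable fun q : (Plane × ℝ) × (LinkType → ℝ) × (ℕ → Plane) × (ℕ → LinkMark → ℝ) =>
      p.markedLoss q.1.1 q.1.2 := p.measurable_markedLoss.comp measurable_fst
  have h2 : Measurable fun q : (Plane × ℝ) × (LinkType → ℝ) × (ℕ → Plane) × (ℕ → LinkMark → ℝ) =>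
      p.totalPower q.1.1 q.2.2.1 q.2.2.2 :=
    p.measurable_totalPower.comp
      (f := fun q : (Plane × ℝ) × (LinkType → ℝ) × (ℕ → Plane) × (ℕ → LinkMark → ℝ) =>
        (q.1.1, q.2.2.1, q.2.2.2)) (by fun_prop)
  have h3 : Measurable fun q : (Plane × ℝ) × (LinkType → ℝ) × (ℕ → Plane) × (ℕ → LinkMark → ℝ) =>
      q.2.1 (p.linkType ‖q.1.1‖ q.1.2) := by
    have h4 : (fun q : (Plane × ℝ) × (LinkType → ℝ) × (ℕ → Plane) × (ℕ → LinkMark → ℝ) =>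
        q.2.1 (p.linkType ‖q.1.1‖ q.1.2))
        = fun q => if p.linkType ‖q.1.1‖ q.1.2 = los then q.2.1 los else q.2.1 nlos := by
      ext q
      cases hj : p.linkType ‖q.1.1‖ q.1.2 <;> simp
    rw [h4]
    refine Measurable.ite ?_ ((measurable_pi_apply los).comp (measurable_fst.comp measurable_snd))
      ((measurable_pi_apply nlos).comp (measurable_fst.comp measurable_snd))
    exact (p.measurableSet_linkType_eq los).preimage
      (f := fun q : (Plane × ℝ) × (LinkType → ℝ) × (ℕ → Plane) × (ℕ → LinkMark → ℝ) =>
        (‖q.1.1‖, q.1.2)) (by fun_prop)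
  exact measurableSet_le measurable_const (((h1.const_mul _).mul h3).ennreal_ofReal.div h2)

end Params

namespace Network

variable {p : Params} {Ω : Type*} [MeasurableSpace Ω] {P : Measure Ω} (net : Network p P)

/-- The event that the user is securely connected. -/
def connected : Set Ω :=
  {ω | 1 ≤ ENNReal.ofReal (p.Ms * net.userLoss (net.serving ω) ω
    * net.userFading (net.serving ω) ω) / net.powerE ω}

lemma mem_connected_iff (ω : Ω) : ω ∈ net.connected ↔
    ((net.bs (net.serving ω) ω, net.mark (.userBlock (net.serving ω)) ω),
      net.linkConfig (net.serving ω) ω) ∈ p.connectedSet := Iff.rfl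

lemma measurableSet_connected : MeasurableSet net.connected := by
  have h : net.connected = ⋃ i, net.serving ⁻¹' {i}
      ∩ {ω | ((net.bs i ω, net.mark (.userBlock i) ω), net.linkConfig i ω) ∈ p.connectedSet} := by
    ext ω
    rw [mem_connected_iff]
    simp
  rw [h]
  refine MeasurableSet.iUnion fun i =>
    (net.measurable_serving (measurableSet_singleton i)).inter ?_
  exact (((net.bs_poisson.measurable i).prodMk (net.mark_measurable _)).prodMk
    (net.measurable_linkConfig i)) p.measurableSet_connectedSet

lemma coverBound_nonneg [IsProbabilityMeasure P] (net : Network p P) (j : LinkType) {r : ℝ}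
    (hr : 0 < r) : 0 ≤ p.coverBound j r :=
  (net.lintegral_alzer_totalPower 0 0 j hr).1

/-- After the links are redrawn independently by `lintegral_serving`, the inner probability is that
of a station at a fixed position with a fixed type, bounded by `measure_connected_le`. -/
lemma measure_connected_le_lintegral [IsProbabilityMeasure P] :
    P net.connected ≤ ∫⁻ ω, ENNReal.ofReal
      (p.coverBound (net.userLink (net.serving ω) ω) ‖net.bs (net.serving ω) ω‖) ∂P := by
  have h := net.lintegral_serving (measurable_one.indicator p.measurableSet_connectedSet)
  rw [← lintegral_indicator_one net.measurableSet_connected]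
  refine (le_of_eq h).trans (lintegral_mono_ae ?_)
  filter_upwards [net.ae_serving] with ω hω
  refine le_trans ?_ (net.measure_connected_le (net.serving ω) hω.1
    (net.userLink (net.serving ω) ω))
  exact lintegral_indicator_one_le {ω' | ((net.bs (net.serving ω) ω,
    net.mark (.userBlock (net.serving ω)) ω), net.linkConfig (net.serving ω) ω')
      ∈ p.connectedSet}

lemma integral_servedDensity_mul_coverBound [IsProbabilityMeasure P] (net : Network p P)
    (j : LinkType) :
    ∫ r in Set.Ioi (0 : ℝ), p.servedDensity j r * p.coverBound j r
      = p.assoc j * ∫ r in Set.Ioi (0 : ℝ), p.distPdf j r * p.coverBound j r := by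
  rw [← integral_const_mul]
  refine integral_congr_ae ?_
  filter_upwards [net.ae_assoc_mul_distPdf j] with r hr
  rw [← hr, mul_assoc]

lemma measure_connected_le_sum [IsProbabilityMeasure P] :
    P net.connected ≤ ∑ j, ENNReal.ofReal
      (p.assoc j * ∫ r in Set.Ioi (0 : ℝ), p.distPdf j r * p.coverBound j r) := by
  have hm : ∀ j, Measurable fun r => ENNReal.ofReal (p.coverBound j r) := fun j =>
    (p.measurable_coverBound j).ennreal_ofReal
  calc P net.connected
      ≤ ∫⁻ ω, ∑ j, (net.served j).indicator
          (fun ω => ENNReal.ofReal (p.coverBound j (net.nearest j ω).toReal)) ω ∂P := by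
        refine net.measure_connected_le_lintegral.trans (lintegral_mono_ae ?_)
        filter_upwards [net.ae_serving] with ω hω
        -- The summand of the actual serving type equals the bound; the other one is nonnegative, so
        -- disjointness of the two events is not needed here.
        refine le_trans (le_of_eq ?_) (Finset.single_le_sum
          (f := fun j => (net.served j).indicator
            (fun ω => ENNReal.ofReal (p.coverBound j (net.nearest j ω).toReal)) ω)
          (fun _ _ => zero_le) (Finset.mem_univ (net.userLink (net.serving ω) ω)))
        rw [Set.indicator_of_mem hω.2.2, hω.2.1, toReal_enorm]
    _ = ∑ j, ∫⁻ ω in net.served j,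
          ENNReal.ofReal (p.coverBound j (net.nearest j ω).toReal) ∂P := by
        rw [lintegral_finsetSum]
        · exact Finset.sum_congr rfl fun j _ => lintegral_indicator (net.measurableSet_served j) _
        · exact fun j _ => ((hm j).comp (net.measurable_nearest j).ennreal_toReal).indicator
            (net.measurableSet_served j)
    _ = ∑ j, ENNReal.ofReal
          (p.assoc j * ∫ r in Set.Ioi (0 : ℝ), p.distPdf j r * p.coverBound j r) := by
        refine Finset.sum_congr rfl fun j _ => ?_
        rw [net.lintegral_served j (hm j), ← net.integral_servedDensity_mul_coverBound j,
          ofReal_integral_eq_lintegral_ofReal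
            (p.integrableOn_mul_coverBound (net.integrableOn_servedDensity j) j)]
        · refine setLIntegral_congr_fun measurableSet_Ioi fun r hr => ?_
          exact (ENNReal.ofReal_mul (p.servedDensity_nonneg j (le_of_lt hr))).symm
        · filter_upwards [ae_restrict_mem measurableSet_Ioi] with r hr
          exact mul_nonneg (p.servedDensity_nonneg j (le_of_lt hr)) (net.coverBound_nonneg j hr)

/-- Nonnegativity is needed for the whole sum over n of each type, since its individual terms
alternate in sign; it permits dropping the weights A_j. -/
lemma integral_distPdf_mul_coverBound_nonneg [IsProbabilityMeasure P] (net : Network p P)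
    (j : LinkType) : 0 ≤ ∫ r in Set.Ioi (0 : ℝ), p.distPdf j r * p.coverBound j r := by
  refine integral_nonneg_of_ae ?_
  filter_upwards [p.ae_distPdf_eq j, ae_restrict_mem measurableSet_Ioi] with r hr hr0
  rw [Pi.zero_apply, hr]
  exact mul_nonneg (div_nonneg (p.servedDensity_nonneg j (le_of_lt hr0)) (net.assoc_nonneg j))
    (net.coverBound_nonneg j hr0)

lemma tauC_le [IsProbabilityMeasure P] : net.tauC ≤ ∑ j, p.assoc j
    * ∫ r in Set.Ioi (0 : ℝ), p.distPdf j r * p.coverBound j r := by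
  have h0 : ∀ j ∈ Finset.univ, 0 ≤ p.assoc j
      * ∫ r in Set.Ioi (0 : ℝ), p.distPdf j r * p.coverBound j r := fun j _ =>
    mul_nonneg (net.assoc_nonneg j) (net.integral_distPdf_mul_coverBound_nonneg j)
  have h := net.measure_connected_le_sum
  rw [← ENNReal.ofReal_sum_of_nonneg h0] at h
  exact ENNReal.toReal_le_of_le_ofReal (Finset.sum_nonneg h0) h

end Network

end MmWave

end

theorem theorem4 (p : MmWave.Params) {Ω : Type*} [MeasurableSpace Ω] (P : Measure Ω)
    [IsProbabilityMeasure P] (net : MmWave.Network p P) :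
    (∀ᵐ ω ∂P, net.powerE ω ≠ ∞) ∧
    (∀ s : ℝ, 0 < s → ∫ ω, Real.exp (-s * (net.powerE ω).toReal) ∂P = p.laplaceIE s) ∧
    (∀ j : MmWave.LinkType, ∀ n ∈ Finset.Icc 1 (p.N j),
      IntegrableOn (fun r : ℝ => p.distPdf j r
        * p.laplaceIE (p.a j * n * r ^ p.α j / (p.Ms * p.K j))) (Set.Ioi 0)) ∧
    net.tauC ≤ ∑ j : MmWave.LinkType, p.assoc j * ∑ n ∈ Finset.Icc 1 (p.N j),
      ((p.N j).choose n : ℝ) * (-1) ^ (n + 1) *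
        ∫ r in Set.Ioi (0 : ℝ), p.distPdf j r
          * p.laplaceIE (p.a j * n * r ^ p.α j / (p.Ms * p.K j)) ∧
    net.tauC ≤ ∑ j : MmWave.LinkType, ∑ n ∈ Finset.Icc 1 (p.N j),
      ((p.N j).choose n : ℝ) * (-1) ^ (n + 1) *
        ∫ r in Set.Ioi (0 : ℝ), p.distPdf j r
          * p.laplaceIE (p.a j * n * r ^ p.α j / (p.Ms * p.K j)) := by
  have hsum := fun j => p.integral_mul_coverBound (net.integrableOn_distPdf j) j
  refine ⟨net.ae_powerE_ne_top, fun s hs => net.integral_exp_powerE hs,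
    fun j n _ => p.integrableOn_mul_laplaceIE (net.integrableOn_distPdf j) j n, ?_, ?_⟩
  · refine net.tauC_le.trans (le_of_eq (Finset.sum_congr rfl fun j _ => ?_))
    rw [hsum j]
    rfl
  · refine net.tauC_le.trans (Finset.sum_le_sum fun j _ => ?_)
    -- Since A_j ≤ 1 and it multiplies a nonnegative quantity, omitting it only enlarges the bound.
    refine (mul_le_of_le_one_left (net.integral_distPdf_mul_coverBound_nonneg j)
      (net.assoc_le_one j)).trans (le_of_eq ?_)
    rw [hsum j]
    rfl
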